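/- Let $n\ge 0$. For $z\in\mathbb C^n$ with pairwise distinct coordinates put $\theta_i=\sum_{j\ne i}\frac{s_{ij}}{z_i-z_j}\in\mathbb C[S_n]$ ($1\le i\le n$), where $s_{ij}$ is the transposition of $i$ and $j$. For a partition $\lambda=(\lambda_1\ge\dots\ge\lambda_\ell\ge1)$ of $n$, let $V$ be a complex vector space with basis $v_1,v_2,\dots$ and let $S_n$ permute the factors of $V^{\otimes n}$. For a bijective labelling $T$ of the boxes of the Young diagram of $\lambda$ by $\{1,\dots,n\}$ let $e_T=v_{i_1}\otimes\cdots\otimes v_{i_n}$, where $i_j$ is the row of the box labelled $j$, and $v_T=\sum_{\sigma}\operatorname{sgn}(\sigma)\,\sigma e_T$, the sum over the permutations $\sigma$ that preserve the contents of each column of $T$. The Specht module $W^\lambda\subset V^{\otimes n}$ is the span of all $v_T$. (The $W^\lambda$ are, up to isomorphism, the irreducible $S_n$-modules.) Let $\mathcal A_{z}^\lambda\subset\operatorname{End}(W^\lambda)$ be the algebra generated by the operators $\theta_i$. Its joint spectrum is the set of linear functionals $\chi:\mathcal A_z^\lambda\to\mathbb C$ for which $\bigcap_{A}\bigcup_k\ker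 (A-\chi(A))^k\ne0$. Let $m_i=\sum_{j>i}\lambda_j$, take variables $t_i^{(b)}$ ($i\ge1$, $1\le b\le m_i$), and let $$S(t,z)=\sum_{k<l}\log(z_k-z_l)-\sum_{k,b}\log(z_k-t_1^{(b)})+2\sum_i\sum_{b<c}\log(t_i^{(b)}-t_i^{(c)})-\sum_i\sum_{b,c}\log(t_i^{(b)}-t_{i+1}^{(c)}).$$ A nondegenerate critical point at $z$ is a $t$ with pairwise distinct coordinates and $t_1^{(b)}\neq z_k$ for all $b,k$, such that all $\partial S/\partial t_i^{(b)}$ vanish at $(t,z)$ and the Hessian of $S$ in $t$ is nonsingular there. The corresponding Bethe vector is $$\Phi(t,z)=\sum_{r}\sum_{\sigma}\ \prod_{k=1}^n\prod_{i=1}^{r_k-1}\frac1{t_i^{(\sigma_i(k))}-t_{i-1}^{(\sigma_{i-1}(k))}}\ v_{r_1}\otimes\cdots\otimes v_{r_n},\qquad t_0^{(\sigma_0(k))}:=z_k,$$ where $r$ runs over the words in $\{1,\dots,\ell\}^n$ in which each letter $i$ occurs $\lambda_i$ times, and $\sigma$ over the families of bijections $\sigma_i:\{k: r_k>i\}\to\{1,\dots,m_i\}$,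 $i\ge1$. Then there is a nonzero polynomial $P\in\mathbb C[z_1,\dots,z_n]$ such that for every $z\in\mathbb C^n$ with pairwise distinct coordinates and $P(z)\neq0$, and for every partition $\lambda$ of $n$: 1. the $\theta_i$ act semisimply on $W^\lambda$, that is, $W^\lambda$ has a basis in which every element of $\mathcal A_z^\lambda$ is diagonal; 2. the Bethe vectors of the nondegenerate critical points at $z$ span $W^\lambda$; 3. the joint spectrum of $\mathcal A_z^\lambda$ has exactly $\dim W^\lambda$ elements. -/

import Mathlib

noncomputable section

namespace GaudinSymm

/-! ### The elements `θ_i` and the Specht modules -/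

/-- The element `θ_i = ∑_{j ≠ i} s_{ij} / (z_i - z_j)` of the group algebra `ℂ[S_n]`. -/
def theta {n : ℕ} (z : Fin n → ℂ) (i : Fin n) : MonoidAlgebra ℂ (Equiv.Perm (Fin n)) :=
  ∑ j ∈ Finset.univ.erase i,
    (z i - z j)⁻¹ • MonoidAlgebra.of ℂ (Equiv.Perm (Fin n)) (Equiv.swap i j)

/-- The tensor power `V^{⊗ n}` of the complex vector space `V` with basis `v_0, v_1, v_2, …`,
in coordinates: the word `r` stands for the basis tensor `v_{r 0} ⊗ ⋯ ⊗ v_{r (n-1)}`. -/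
abbrev TensorPow (n : ℕ) : Type := (Fin n → ℕ) →₀ ℂ

/-- The action of `S_n` on `V^{⊗ n}` by permuting the tensor factors. -/
def tensorRep (n : ℕ) : Representation ℂ (Equiv.Perm (Fin n)) (TensorPow n) where
  toFun σ := Finsupp.lmapDomain ℂ ℂ (fun r : Fin n → ℕ => r ∘ σ.symm)
  map_one' := by
    refine Finsupp.lhom_ext fun r c => ?_
    have h : (r ∘ (1 : Equiv.Perm (Fin n)).symm) = r := rfl
    simp [Finsupp.lmapDomain_apply, Finsupp.mapDomain_single, h]
  map_mul' σ τ := by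
    refine Finsupp.lhom_ext fun r c => ?_
    simp [Finsupp.lmapDomain_apply, Finsupp.mapDomain_single, Function.comp_def,
      Equiv.Perm.mul_def]

theorem tensorRep_single {n : ℕ} (σ : Equiv.Perm (Fin n)) (r : Fin n → ℕ) (c : ℂ) :
    tensorRep n σ (Finsupp.single r c) = Finsupp.single (r ∘ σ.symm) c := by
  simp [tensorRep]

/-- A labelling of the Young diagram `μ` by `Fin n`: a bijection from the boxes to `Fin n`.
A box is a pair `(row, column)`, both counted from `0`. -/
abbrev Labelling (n : ℕ) (μ : YoungDiagram) : Type := {c // c ∈ μ.cells} ≃ Fin n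

/-- The index of the basis tensor `e_T = v_{i_1} ⊗ ⋯ ⊗ v_{i_n}`, with `i_j` the row of the
box labelled `j`. -/
def rowWord {n : ℕ} {μ : YoungDiagram} (T : Labelling n μ) : Fin n → ℕ :=
  fun j => (T.symm j).1.1

/-- The column of the box labelled `j`. -/
def colOf {n : ℕ} {μ : YoungDiagram} (T : Labelling n μ) : Fin n → ℕ :=
  fun j => (T.symm j).1.2

/-- The group `C(T)` of the permutations that preserve the contents of each column of `T`. -/
def colStab {n : ℕ} {μ : YoungDiagram} (T : Labelling n μ) : Finset (Equiv.Perm (Fin n)) :=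
  Finset.univ.filter fun σ => ∀ j, colOf T (σ j) = colOf T j

/-- The vector `v_T = ∑_{σ ∈ C(T)} (-1)^σ σ e_T`. -/
def polytabloid {n : ℕ} {μ : YoungDiagram} (T : Labelling n μ) : TensorPow n :=
  ∑ σ ∈ colStab T,
    ((Equiv.Perm.sign σ : ℤ) : ℂ) • tensorRep n σ (Finsupp.single (rowWord T) 1)

theorem tensorRep_polytabloid {n : ℕ} {μ : YoungDiagram} (τ : Equiv.Perm (Fin n))
    (T : Labelling n μ) : tensorRep n τ (polytabloid T) = polytabloid (T.trans τ) := by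
  unfold polytabloid
  rw [map_sum]
  refine Finset.sum_bij' (fun σ _ => τ * σ * τ⁻¹) (fun σ _ => τ⁻¹ * σ * τ) ?_ ?_ ?_ ?_ ?_
  · intro σ hσ
    refine Finset.mem_filter.mpr ⟨Finset.mem_univ _, fun j => ?_⟩
    replace hσ := (Finset.mem_filter.mp hσ).2
    have h := hσ (τ⁻¹ j)
    simpa [colOf, Equiv.symm_trans_apply, Equiv.Perm.inv_def] using h
  · intro σ hσ
    refine Finset.mem_filter.mpr ⟨Finset.mem_univ _, fun j => ?_⟩
    replace hσ := (Finset.mem_filter.mp hσ).2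
    have h := hσ (τ j)
    simpa [colOf, Equiv.symm_trans_apply, Equiv.Perm.inv_def] using h
  · intro σ _
    group
  · intro σ _
    group
  · intro σ _
    rw [map_smul]
    have hs : Equiv.Perm.sign (τ * σ * τ⁻¹) = Equiv.Perm.sign σ := by
      rw [map_mul, map_mul, map_inv, mul_comm, inv_mul_cancel_left]
    rw [hs, tensorRep_single, tensorRep_single, tensorRep_single]
    congr 2
    funext j
    simp [rowWord, Equiv.Perm.mul_def, Equiv.Perm.inv_def]

/-- The Specht module `W^μ`, as the subrepresentation of `V^{⊗ n}` spanned by the `v_T`,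
where `T` runs over the labellings of `μ`. -/
def specht (n : ℕ) (μ : YoungDiagram) : Subrepresentation (tensorRep n) where
  toSubmodule := Submodule.span ℂ (Set.range (polytabloid : Labelling n μ → TensorPow n))
  apply_mem_toSubmodule τ v hv := by
    induction hv using Submodule.span_induction with
    | mem x hx =>
      obtain ⟨T, rfl⟩ := hx
      rw [tensorRep_polytabloid]
      exact Submodule.subset_span ⟨_, rfl⟩
    | zero => simp
    | add x y _ _ hx hy => rw [map_add]; exact Submodule.add_mem _ hx hy
    | smul c x _ hx => rw [map_smul]; exact Submodule.smul_mem _ c hx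

/-- The operator by which `θ_i` acts on the Specht module `W^μ`. -/
def thetaOp {n : ℕ} (z : Fin n → ℂ) (μ : YoungDiagram) (i : Fin n) :
    Module.End ℂ (specht n μ).toSubmodule :=
  (specht n μ).toRepresentation.asAlgebraHom (theta z i)

/-- The algebra of operators on `W^μ` generated by the `θ_i`. -/
def thetaAlgebra {n : ℕ} (z : Fin n → ℂ) (μ : YoungDiagram) :
    Subalgebra ℂ (Module.End ℂ (specht n μ).toSubmodule) :=
  Algebra.adjoin ℂ (Set.range (thetaOp z μ))

/-! ### Semisimple actions and the joint spectrum -/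

/-- The action of an algebra `𝒜` of operators on `V` is semisimple if `V` has a basis with
respect to which every element of `𝒜` is diagonal. -/
def ActsSemisimply {V : Type} [AddCommGroup V] [Module ℂ V]
    (𝒜 : Subalgebra ℂ (Module.End ℂ V)) : Prop :=
  ∃ (ι : Type) (b : Module.Basis ι ℂ V), ∀ A ∈ 𝒜, ∀ k : ι, ∃ c : ℂ, A (b k) = c • b k

/-- The weight space `V_χ = ⋂_{A ∈ 𝒜} ⋃_k ker (A - χ(A))^k` of a linear functional `χ`. -/
def weightSpace {V : Type} [AddCommGroup V] [Module ℂ V]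
    (𝒜 : Subalgebra ℂ (Module.End ℂ V)) (χ : 𝒜 →ₗ[ℂ] ℂ) : Submodule ℂ V :=
  ⨅ A : 𝒜, Module.End.maxGenEigenspace (A : Module.End ℂ V) (χ A)

/-- The joint spectrum of `𝒜`: the functionals with nonzero weight space. -/
def jointSpectrum {V : Type} [AddCommGroup V] [Module ℂ V]
    (𝒜 : Subalgebra ℂ (Module.End ℂ V)) : Set (𝒜 →ₗ[ℂ] ℂ) :=
  {χ | weightSpace 𝒜 χ ≠ ⊥}

/-! ### The master function and the Bethe vectors -/

/-- The boxes of `μ` below row `i` (rows are counted from `0`). Their number is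
`μ_{i+1} + μ_{i+2} + ⋯`. -/
abbrev BoxBelow (μ : YoungDiagram) (i : ℕ) : Type := {b : {c // c ∈ μ.cells} // i < b.1.1}

/-- The index set of the variables `t_i^{(b)}`: a colour `i` (a simple root; colours are
counted from `0`) and a box `b` below row `i`. -/
abbrev BetheVar (μ : YoungDiagram) : Type := (i : Fin (μ.colLen 0)) × BoxBelow μ i

/-- The exponential `Ψ = exp S` of the master function
`S(t,z) = ∑_{k<l} log (z_k - z_l) - ∑_{k,b} log (z_k - t_0^{(b)})
  + 2 ∑_i ∑_{b<c} log (t_i^{(b)} - t_i^{(c)}) - ∑_i ∑_{b,c} log (t_i^{(b)} - t_{i+1}^{(c)})`.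
It is a single-valued rational function. The factors `(t_i^{(b)} - t_i^{(c)})^2` are written as
products over ordered pairs `b ≠ c`, which changes `Ψ` by a sign only. -/
def expMaster {n : ℕ} {μ : YoungDiagram} (z : Fin n → ℂ) (t : BetheVar μ → ℂ) : ℂ :=
  (∏ k : Fin n, ∏ l : Fin n, if k < l then z k - z l else 1) *
  (∏ k : Fin n, ∏ a : BetheVar μ, if a.1.val = 0 then (z k - t a)⁻¹ else 1) *
  (∏ a : BetheVar μ, ∏ b : BetheVar μ, if a.1 = b.1 ∧ a ≠ b then t a - t b else 1) *
  (∏ a : BetheVar μ, ∏ b : BetheVar μ, if a.1.val + 1 = b.1.val then (t a - t b)⁻¹ else 1)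

/-- The partial derivative `∂S/∂t_a = (∂Ψ/∂t_a) / Ψ` of the master function `S = log Ψ`. -/
def masterGrad {n : ℕ} {μ : YoungDiagram} (z : Fin n → ℂ) (t : BetheVar μ → ℂ)
    (a : BetheVar μ) : ℂ :=
  logDeriv (fun s : ℂ => expMaster z (Function.update t a s)) (t a)

/-- The Hessian matrix `∂²S/∂t_b∂t_a` of the master function. -/
def masterHessian {n : ℕ} {μ : YoungDiagram} (z : Fin n → ℂ) (t : BetheVar μ → ℂ) :
    Matrix (BetheVar μ) (BetheVar μ) ℂ :=
  Matrix.of fun a b => deriv (fun s : ℂ => masterGrad z (Function.update t b s) a) (t b)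

/-- `t` is a nondegenerate critical point of `S(·, z)`: the coordinates of `t` are pairwise
distinct and those of colour `0` differ from all `z_k` (so that `S` is defined near `t`), all
`∂S/∂t_a` vanish at `t`, and the Hessian is nonsingular there. -/
structure IsNondegenerateCritical {n : ℕ} {μ : YoungDiagram} (z : Fin n → ℂ)
    (t : BetheVar μ → ℂ) : Prop where
  injective : Function.Injective t
  ne_z : ∀ (a : BetheVar μ) (k : Fin n), a.1.val = 0 → t a ≠ z k
  grad_eq_zero : ∀ a : BetheVar μ, masterGrad z t a = 0
  hessian : (masterHessian z t).det ≠ 0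

/-- A placement of the variables on the tensor factors, adapted to the word `r`: for each
colour `i`, a bijection from the positions `k` with `r k > i` to the variables of colour `i`.
There is one exactly if `v_r` has weight `μ`, that is if for each `i` exactly `μ_i` letters of
`r` are equal to `i`. -/
abbrev Placement {n : ℕ} (μ : YoungDiagram) (r : Fin n → Fin (μ.colLen 0)) : Type :=
  (i : Fin (μ.colLen 0)) → {k : Fin n // i < r k} ≃ BoxBelow μ i

/-- The chain `z_k, t_0^{(·)}, t_1^{(·)}, …, t_{r k - 1}^{(·)}` of the variables that the
placement `σ` puts at position `k` (continued by `0`). -/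
def chain {n : ℕ} {μ : YoungDiagram} (z : Fin n → ℂ) (t : BetheVar μ → ℂ)
    (r : Fin n → Fin (μ.colLen 0)) (σ : Placement μ r) (k : Fin n) : ℕ → ℂ
  | 0 => z k
  | i + 1 =>
    if h : i < (r k).val then
      t ⟨⟨i, h.trans (r k).isLt⟩, σ ⟨i, h.trans (r k).isLt⟩ ⟨k, h⟩⟩
    else 0

/-- The universal weight function of the tensor power of the vector representation,
`Φ(t,z) = ∑_r ∑_σ ∏_k ∏_{i < r k} 1 / (t_i^{(σ_i k)} - t_{i-1}^{(σ_{i-1} k)}) v_r`,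
with `t_{-1}^{(σ_{-1} k)} = z_k`; the sum is over the words `r` of weight `μ` and the
placements `σ` of the variables. -/
def betheVector {n : ℕ} {μ : YoungDiagram} (z : Fin n → ℂ) (t : BetheVar μ → ℂ) :
    TensorPow n :=
  ∑ r : Fin n → Fin (μ.colLen 0),
    Finsupp.single (fun k => (r k).val)
      (∑ σ : Placement μ r,
        ∏ k : Fin n, ∏ i ∈ Finset.range (r k).val,
          (chain z t r σ k (i + 1) - chain z t r σ k i)⁻¹)

/-- The Bethe vectors of shape `μ` at `z`: the vectors `Φ(t,z)`, where `t` runs over the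
nondegenerate critical points of the master function at `z`. -/
def betheVectors {n : ℕ} (z : Fin n → ℂ) (μ : YoungDiagram) : Set (TensorPow n) :=
  {v | ∃ t : BetheVar μ → ℂ, IsNondegenerateCritical z t ∧ v = betheVector z t}

end GaudinSymm

end

/-!
The proof is by induction on the number of points: the point `z_0 = u` is moved to infinity, and
everything splits according to the decomposition `V^{⊗ (n+1)} = ⨁_r v_r ⊗ V^{⊗ n}`. The Specht
module `W^μ` consists of all singular vectors of weight `μ`, that is, of the vectors killed by the
raising operators of `𝔤𝔩` (`specht_eq_sing`). The component of such a vector at its greatest first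
letter `r` is a singular vector whose weight is `μ` with the last box of row `r` removed, and every
such vector occurs. So vectors of `W^μ` whose top components run through bases of the smaller
Specht modules form a basis of `W^μ` (`specht_triangular`).

*Semisimplicity and the joint spectrum.* The `θ_i` commute (`theta_comm`), so that it suffices to
find a combination of them whose characteristic polynomial has no multiple roots
(`SimpleSpectrum.semisimple_and_encard`). This condition is the nonvanishing of a resultant, which
is rational in `z` (`exists_discriminant`), so that one good point is enough. As `u → ∞`, the
operator `u θ_0` tends to the Jucys–Murphy element `∑_k s_{0k}`, which multiplies the top component
of a vector by the content of the removed box (`sum_swap_zero_of_top`). Contents of different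
removable boxes differ, so that `M u θ_0 + ∑_i c_i θ_{i+1}` has simple spectrum for generic `M` and
large `u` if `∑_i c_i θ_i` has simple spectrum for `n` points (`exists_simpleSpectrum`).

*Bethe vectors.* The equations for a critical point make the weight function singular: the terms of
its image under a simple raising operator cancel in pairs under the exchange of two variables of
one colour (`kills_weightCoeff`). Hence Bethe vectors lie in `W^μ`. To see that they span it at
some points, let `t` be a nondegenerate critical point for `n` points and for `μ` without the last
box of row `r`. Removing this box takes away one variable of each colour `i < r`; the missing
variables are put at distances proportional to `u`, and the equations are rescaled accordingly by
`ε = u⁻¹`. At `ε = 0` they decouple into the equations for `t` and a system for the new variables,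
which sees the old points and variables as a single charge at `0`. It has an explicit solution,
given by products of hook lengths (`limPt_equation`). The Hessian of the new variables is a
weighted graph Laplacian with absorption and therefore nonsingular (`det_laplacian_ne_zero`), so
the implicit function theorem continues the solution to small `ε`
(`exists_tendsto_dampedDeriv_eq_zero`). The rescaled Bethe vectors converge to vectors of `W^μ`
with the Bethe vector of `t` as top component (`exists_tendsto_betheVector`). By triangularity the
limits form a basis if the Bethe vectors for `n` points span, and so do the Bethe vectors for large
`u` (`eventually_mem_spanningSet`).

It follows that the points at which the Bethe vectors span are Zariski dense
(`eq_zero_of_eval_spanningSet`). Such points are the projections of the solutions of a system of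
polynomial equations and inequations in `z` and `dim W^μ` sets of variables `t`. By Chevalley's
theorem a dense set of this kind contains the complement of a hypersurface
(`exists_ne_zero_forall_exists_of_dense`), which gives the spanning property for generic `z`
(`exists_polynomial_span_betheVectors`).
-/


noncomputable section

namespace GaudinSymm

/-! ### Elimination of variables -/

/-- The set of `z` for which the system `f(z,t) = 0` (`f ∈ I`), `g(z,t) ≠ 0` is solvable in `t`
contains a nonempty principal Zariski-open set as soon as it is Zariski dense. By Chevalley's
theorem its scheme-theoretic version is constructible; by density it contains the generic
point. -/
theorem exists_ne_zero_forall_exists_of_dense {σ τ : Type} [Finite σ] [Finite τ]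
    (I : Set (MvPolynomial (σ ⊕ τ) ℂ)) (g : MvPolynomial (σ ⊕ τ) ℂ)
    (hd : ∀ P : MvPolynomial σ ℂ,
      (∀ (z : σ → ℂ) (t : τ → ℂ), (∀ f ∈ I, MvPolynomial.eval (Sum.elim z t) f = 0) →
        MvPolynomial.eval (Sum.elim z t) g ≠ 0 → MvPolynomial.eval z P = 0) → P = 0) :
    ∃ P : MvPolynomial σ ℂ, P ≠ 0 ∧ ∀ z : σ → ℂ, MvPolynomial.eval z P ≠ 0 →
      ∃ t : τ → ℂ, (∀ f ∈ I, MvPolynomial.eval (Sum.elim z t) f = 0) ∧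
        MvPolynomial.eval (Sum.elim z t) g ≠ 0 := by
  classical
  have hae : ∀ {ι : Type} (y : ι → ℂ) (p : MvPolynomial ι ℂ),
      MvPolynomial.aeval y p = MvPolynomial.eval y p := fun y p => by
    rw [← MvPolynomial.coe_aeval_eq_eval]; rfl
  let φ : MvPolynomial σ ℂ →+* MvPolynomial (σ ⊕ τ) ℂ :=
    (MvPolynomial.rename Sum.inl : MvPolynomial σ ℂ →ₐ[ℂ] MvPolynomial (σ ⊕ τ) ℂ).toRingHom
  have hφ : φ.FinitePresentation := by
    have h1 : φ = (MvPolynomial.renameEquiv ℂ (Equiv.sumComm τ σ)).toRingEquiv.toRingHom.comp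
        ((MvPolynomial.sumAlgEquiv ℂ τ σ).symm.toRingEquiv.toRingHom.comp
          (MvPolynomial.C : MvPolynomial σ ℂ →+* MvPolynomial τ (MvPolynomial σ ℂ))) := by
      refine MvPolynomial.ringHom_ext (fun c => ?_) (fun i => ?_)
      · simp [φ]
      · simp [φ]
    rw [h1]
    refine RingHom.FinitePresentation.comp (RingHom.FinitePresentation.of_bijective
      (MvPolynomial.renameEquiv ℂ (Equiv.sumComm τ σ)).bijective) ?_
    refine RingHom.FinitePresentation.comp (RingHom.FinitePresentation.of_bijective
      (MvPolynomial.sumAlgEquiv ℂ τ σ).symm.bijective) ?_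
    have : Algebra.FinitePresentation (MvPolynomial σ ℂ)
      (MvPolynomial τ (MvPolynomial σ ℂ)) := Algebra.FinitePresentation.mvPolynomial _ _ τ
    exact (RingHom.finitePresentation_algebraMap).2 this
  have heval : ∀ (z : σ → ℂ) (t : τ → ℂ) (P : MvPolynomial σ ℂ),
      MvPolynomial.eval (Sum.elim z t) (φ P) = MvPolynomial.eval z P := by
    intro z t P
    simp [φ, MvPolynomial.eval_rename]
  let J := Ideal.span I
  have hJ : ∀ y : σ ⊕ τ → ℂ, (∀ f ∈ I, MvPolynomial.eval y f = 0) → ∀ f ∈ J,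
      MvPolynomial.eval y f = 0 := by
    intro y hy f hf
    have : J ≤ RingHom.ker (MvPolynomial.eval y) := Ideal.span_le.2 fun f hf => hy f hf
    exact this hf
  let s : Set (PrimeSpectrum (MvPolynomial (σ ⊕ τ) ℂ)) :=
    PrimeSpectrum.zeroLocus I ∩ PrimeSpectrum.basicOpen g
  have hs : Topology.IsConstructible s := by
    refine Topology.IsConstructible.inter ?_ ?_
    · rw [← PrimeSpectrum.zeroLocus_span]
      have h := PrimeSpectrum.isRetrocompact_zeroLocus_compl_of_fg
        (IsNoetherian.noetherian (Ideal.span I))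
      have h2 := (h.isConstructible (PrimeSpectrum.isClosed_zeroLocus _).isOpen_compl).compl
      rwa [compl_compl] at h2
    · exact (PrimeSpectrum.isRetrocompact_basicOpen).isConstructible
        (PrimeSpectrum.isOpen_basicOpen)
  have himg := PrimeSpectrum.isConstructible_comap_image hφ hs
  -- the generic point lies in the image
  have hgen : (⊥ : PrimeSpectrum (MvPolynomial σ ℂ)) ∈ PrimeSpectrum.comap φ '' s := by
    let S : Submonoid (MvPolynomial (σ ⊕ τ) ℂ) :=
      (nonZeroDivisors (MvPolynomial σ ℂ)).map φ ⊔ Submonoid.powers g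
    have hdisj : Disjoint (J : Set (MvPolynomial (σ ⊕ τ) ℂ)) S := by
      rw [Set.disjoint_left]
      intro f hf hfS
      obtain ⟨a, ha, b, hb, rfl⟩ := Submonoid.mem_sup.1 hfS
      obtain ⟨h, hh, rfl⟩ := ha
      obtain ⟨k, rfl⟩ := hb
      refine nonZeroDivisors.ne_zero hh (hd h fun z t hI hg => ?_)
      have h0 := hJ _ hI _ hf
      simp only [map_mul, map_pow] at h0
      rcases mul_eq_zero.1 h0 with h0 | h0
      · exact (heval z t h).symm.trans h0
      · exact hg (by by_contra hne; exact pow_ne_zero k hne h0) |>.elim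
    obtain ⟨q, hq, hJq, hqS⟩ := Ideal.exists_le_prime_disjoint J S hdisj
    refine ⟨⟨q, hq⟩, ⟨?_, ?_⟩, ?_⟩
    · exact fun f hf => hJq (Ideal.subset_span hf)
    · exact fun hgq => Set.disjoint_left.1 hqS hgq
        ((le_sup_right : Submonoid.powers g ≤ S) (Submonoid.mem_powers g))
    · ext1
      change Ideal.comap φ q = ⊥
      rw [eq_bot_iff]
      intro h hh
      by_contra hne
      exact Set.disjoint_left.1 hqS hh ((le_sup_left : _ ≤ S)
        ⟨h, mem_nonZeroDivisors_of_ne_zero hne, rfl⟩)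
  obtain ⟨D, hD⟩ := PrimeSpectrum.exists_constructibleSetData_iff.mpr himg
  rw [← hD] at hgen
  obtain ⟨C, hC, hCgen⟩ : ∃ C ∈ D, (⊥ : PrimeSpectrum (MvPolynomial σ ℂ)) ∈ C.toSet := by
    simpa [PrimeSpectrum.ConstructibleSetData.toSet] using hgen
  have hg0 : ∀ i, C.g i = 0 := fun i => by
    have := hCgen.1 (Set.mem_range_self i)
    simpa using this
  have hf0 : C.f ≠ 0 := fun h => hCgen.2 (by
    intro x hx
    simp only [Set.mem_singleton_iff] at hx
    rw [hx, h]
    exact Ideal.zero_mem _)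
  refine ⟨C.f, hf0, fun z hz => ?_⟩
  have hzmem : (MvPolynomial.pointToPoint (k := ℂ) z) ∈ PrimeSpectrum.comap φ '' s := by
    rw [← hD]
    refine Set.mem_iUnion₂.2 ⟨C, hC, ?_, ?_⟩
    · rintro _ ⟨i, rfl⟩
      rw [hg0]; exact Ideal.zero_mem _
    · intro h
      have : C.f ∈ MvPolynomial.vanishingIdeal ℂ {z} := h (Set.mem_singleton _)
      rw [MvPolynomial.mem_vanishingIdeal_singleton_iff] at this
      exact hz ((hae _ _).symm.trans this)
  obtain ⟨q, ⟨hqI, hqg⟩, hqz⟩ := hzmem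
  have hq := q.2
  have hvan := MvPolynomial.IsPrime.vanishingIdeal_zeroLocus (K := ℂ) q.asIdeal
  have : ∃ y ∈ MvPolynomial.zeroLocus ℂ q.asIdeal, MvPolynomial.eval y g ≠ 0 := by
    by_contra! hcon
    apply hqg
    rw [← hvan, MvPolynomial.mem_vanishingIdeal_iff]
    intro y hy
    exact (hae _ _).trans (hcon y hy)
  obtain ⟨y, hy, hyg⟩ := this
  have hy' : ∀ f ∈ q.asIdeal, MvPolynomial.eval y f = 0 :=
    fun f hf => (hae _ _).symm.trans (hy f hf)
  have hyz : ∀ i, y (Sum.inl i) = z i := by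
    intro i
    have h1 : (MvPolynomial.X i - MvPolynomial.C (z i) : MvPolynomial σ ℂ) ∈
        (PrimeSpectrum.comap φ q).asIdeal := by
      rw [hqz]
      change _ ∈ MvPolynomial.vanishingIdeal ℂ {z}
      rw [MvPolynomial.mem_vanishingIdeal_singleton_iff]
      simp
    have h2 := hy' _ h1
    simpa [φ, sub_eq_zero] using h2
  have hyy : y = Sum.elim z (fun j => y (Sum.inr j)) := by
    funext i
    rcases i with i | i
    · simp [hyz]
    · simp
  rw [hyy] at hy' hyg
  exact ⟨_, fun f hf => hy' f (hqI hf), hyg⟩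

/-! ### Singular vectors -/

/-- The condition that the raising operator `E_{ij}` (which sends `v_j` to `v_i`) kills the
vector with coefficients `v`. -/
def Kills {n : ℕ} (i j : ℕ) (v : (Fin n → ℕ) → ℂ) : Prop :=
  ∀ w : Fin n → ℕ, ∑ k ∈ Finset.univ.filter (fun k => w k = i), v (Function.update w k j) = 0

/-- The space of the singular vectors of weight `lam` in `V^{⊗ n}`: only words with `lam i`
letters `i` occur, and the raising operators `E_{ij}`, `i < j`, act by zero. -/
def sing (n : ℕ) (lam : ℕ → ℕ) : Submodule ℂ (TensorPow n) where
  carrier := {v | (∀ w, v w ≠ 0 → ∀ i, (Finset.univ.filter fun k => w k = i).card = lam i) ∧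
    ∀ i j, i < j → Kills i j v}
  add_mem' := by
    rintro a b ⟨ha, ha'⟩ ⟨hb, hb'⟩
    refine ⟨fun w hw => ?_, fun i j hij w => ?_⟩
    · by_cases h : a w = 0
      · exact hb w fun h' => hw (by simp [h, h'])
      · exact ha w h
    · simp only [Finsupp.add_apply, Finset.sum_add_distrib]
      rw [ha' i j hij w, hb' i j hij w, add_zero]
  zero_mem' := ⟨fun w hw => absurd rfl hw, fun i j _ w => by simp⟩
  smul_mem' := by
    rintro c a ⟨ha, ha'⟩
    refine ⟨fun w hw => ha w fun h => hw (by simp [h]), fun i j hij w => ?_⟩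
    simp only [Finsupp.smul_apply, ← Finset.smul_sum]
    rw [ha' i j hij w, smul_zero]

theorem mem_sing {n : ℕ} {lam : ℕ → ℕ} {v : TensorPow n} : v ∈ sing n lam ↔
    (∀ w, v w ≠ 0 → ∀ i, (Finset.univ.filter fun k => w k = i).card = lam i) ∧
      ∀ i j, i < j → Kills i j v := Iff.rfl

/-- `E_{ik} = [E_{ij}, E_{jk}]`. -/
theorem Kills.comp {n : ℕ} {i j k : ℕ} {v : (Fin n → ℕ) → ℂ} (hij : i ≠ j)
    (h1 : Kills i j v) (h2 : Kills j k v) (hik : i ≠ k) : Kills i k v := by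
  classical
  intro w
  -- `E_{jk} v = 0` at the words in which one letter `i` of `w` is replaced by `j`
  have e1 : ∀ a ∈ Finset.univ.filter (fun a => w a = i),
      v (Function.update w a k) + ∑ b ∈ Finset.univ.filter (fun b => w b = j),
        v (Function.update (Function.update w a j) b k) = 0 := by
    intro a ha
    have ha' : w a = i := by simpa using ha
    have := h2 (Function.update w a j)
    have hs : (Finset.univ.filter fun b => Function.update w a j b = j) =
        insert a (Finset.univ.filter fun b => w b = j) := by
      ext b
      by_cases hb : b = a
      · simp [hb]
      · simp [hb, Function.update_of_ne]
    rw [hs, Finset.sum_insert (by simp [ha', hij])] at this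
    simpa using this
  -- `E_{ij} v = 0` at the words in which one letter `j` of `w` is replaced by `k`
  have e2 : ∀ b ∈ Finset.univ.filter (fun b => w b = j),
      ∑ a ∈ Finset.univ.filter (fun a => w a = i),
        v (Function.update (Function.update w a j) b k) = 0 := by
    intro b hb
    have hb' : w b = j := by simpa using hb
    have := h1 (Function.update w b k)
    rw [← this]
    refine Finset.sum_congr ?_ fun a ha => ?_
    · ext a
      by_cases hab : a = b
      · simp [hab, hb', hij.symm, hik.symm]
      · simp [hab]
    · have hab : a ≠ b := by
        rintro rfl
        simp only [Finset.mem_filter, Finset.mem_univ, true_and, Function.update_self] at ha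
        exact hik ha.symm
      rw [Function.update_comm hab]
  have := Finset.sum_eq_zero e1
  rw [Finset.sum_add_distrib, Finset.sum_comm, Finset.sum_eq_zero e2, add_zero] at this
  exact this

theorem kills_of_simple {n : ℕ} {v : (Fin n → ℕ) → ℂ} (h : ∀ i, Kills i (i + 1) v) {i j : ℕ}
    (hij : i < j) : Kills i j v := by
  induction j, hij using Nat.le_induction with
  | base => exact h i
  | succ j hj ih => exact ih.comp (by omega) (h j) (by omega)

/-- The weight of a nonzero singular vector is dominant. If `f` is the lowering operator adjoint to
`e = E_{i,i+1}`, then `0 ≤ ⟨f v, f v⟩ = ⟨v, e f v⟩ = (lam i - lam (i + 1)) ⟨v, v⟩`. -/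
theorem antitone_of_mem_sing {n : ℕ} {lam : ℕ → ℕ} {v : TensorPow n} (hv : v ∈ sing n lam)
    (h0 : v ≠ 0) : Antitone lam := by
  classical
  refine antitone_nat_of_succ_le fun i => ?_
  obtain ⟨hw, he⟩ := hv
  have he := he i (i + 1) (Nat.lt_succ_self i)
  obtain ⟨N, hN⟩ : ∃ N, ∀ w ∈ v.support, ∀ k, w k < N := by
    refine ⟨(v.support.sup fun w => Finset.univ.sup w) + i + 2, fun w hw k => ?_⟩
    have h1 : w k ≤ Finset.univ.sup w := Finset.le_sup (Finset.mem_univ k)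
    have h2 : Finset.univ.sup w ≤ v.support.sup fun w => Finset.univ.sup w :=
      Finset.le_sup (f := fun w : Fin n → ℕ => Finset.univ.sup w) hw
    omega
  let S : Finset (Fin n → ℕ) := Fintype.piFinset fun _ => Finset.range (N + i + 2)
  have hvS : ∀ w, v w ≠ 0 → w ∈ S := fun w hw => Fintype.mem_piFinset.2 fun k =>
    Finset.mem_range.2 (by have := hN w (Finsupp.mem_support_iff.2 hw) k; omega)
  have hupd : ∀ w ∈ S, ∀ k, ∀ j < i + 2, Function.update w k j ∈ S := by
    intro w hw k j hj
    refine Fintype.mem_piFinset.2 fun l => ?_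
    by_cases hl : l = k
    · simp only [hl, Function.update_self, Finset.mem_range]; omega
    · rw [Function.update_of_ne hl]; exact Fintype.mem_piFinset.1 hw l
  let fv : (Fin n → ℕ) → ℂ := fun w =>
    ∑ k ∈ Finset.univ.filter (fun k => w k = i + 1), v (Function.update w k i)
  -- `e f v = (lam i - lam (i + 1)) v`
  have hef : ∀ w, v w ≠ 0 →
      ∑ k ∈ Finset.univ.filter (fun k => w k = i), fv (Function.update w k (i + 1)) =
        ((lam i : ℂ) - lam (i + 1)) * v w := by
    intro w hvw
    have e1 : ∀ a ∈ Finset.univ.filter (fun a => w a = i),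
        fv (Function.update w a (i + 1)) = v w +
          ∑ b ∈ Finset.univ.filter (fun b => w b = i + 1),
            v (Function.update (Function.update w a (i + 1)) b i) := by
      intro a ha
      have ha' : w a = i := by simpa using ha
      have hs : (Finset.univ.filter fun b => Function.update w a (i + 1) b = i + 1) =
          insert a (Finset.univ.filter fun b => w b = i + 1) := by
        ext b
        by_cases hb : b = a
        · simp [hb]
        · simp [hb, Function.update_of_ne]
      simp only [fv]
      rw [hs, Finset.sum_insert (by simp [ha'])]
      congr 2
      rw [Function.update_idem, ← ha', Function.update_eq_self]
    have e2 : ∀ b ∈ Finset.univ.filter (fun b => w b = i + 1),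
        v w + ∑ a ∈ Finset.univ.filter (fun a => w a = i),
            v (Function.update (Function.update w a (i + 1)) b i) = 0 := by
      intro b hb
      have hb' : w b = i + 1 := by simpa using hb
      have := he (Function.update w b i)
      have hs : (Finset.univ.filter fun a => Function.update w b i a = i) =
          insert b (Finset.univ.filter fun a => w a = i) := by
        ext a
        by_cases ha : a = b
        · simp [ha]
        · simp [ha, Function.update_of_ne]
      rw [hs, Finset.sum_insert (by simp [hb']), Function.update_idem, ← hb',
        Function.update_eq_self] at this
      rw [← this]
      congr 1
      refine Finset.sum_congr rfl fun a ha => ?_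
      have hab : a ≠ b := by
        rintro rfl
        simp at ha
        omega
      rw [hb', Function.update_comm hab]
    have s2 := Finset.sum_eq_zero e2
    rw [Finset.sum_congr rfl e1]
    rw [Finset.sum_add_distrib, Finset.sum_const, nsmul_eq_mul, hw w hvw] at s2 ⊢
    rw [Finset.sum_comm] at s2
    linear_combination s2
  have key : ∑ w ∈ S, (starRingEnd ℂ) (fv w) * fv w =
      ((lam i : ℂ) - lam (i + 1)) * ∑ w ∈ S, (starRingEnd ℂ) (v w) * v w := by
    have h1 : ∑ w ∈ S, (starRingEnd ℂ) (fv w) * fv w =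
        ∑ w ∈ S, ∑ k ∈ Finset.univ.filter (fun k => w k = i + 1),
          (starRingEnd ℂ) (v (Function.update w k i)) * fv w := by
      refine Finset.sum_congr rfl fun w _ => ?_
      simp only [fv, map_sum, Finset.sum_mul]
    have h2 : ∑ w ∈ S, ∑ k ∈ Finset.univ.filter (fun k => w k = i + 1),
          (starRingEnd ℂ) (v (Function.update w k i)) * fv w =
        ∑ w ∈ S, ∑ k ∈ Finset.univ.filter (fun k => w k = i),
          (starRingEnd ℂ) (v w) * fv (Function.update w k (i + 1)) := by
      rw [Finset.sum_sigma', Finset.sum_sigma']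
      refine Finset.sum_bij' (fun p _ => ⟨Function.update p.1 p.2 i, p.2⟩)
        (fun p _ => ⟨Function.update p.1 p.2 (i + 1), p.2⟩) ?_ ?_ ?_ ?_ ?_
      · rintro ⟨w, k⟩ h
        simp only [Finset.mem_sigma, Finset.mem_filter, Finset.mem_univ, true_and,
          Function.update_self, and_true] at h ⊢
        exact hupd w h.1 k i (by omega)
      · rintro ⟨w, k⟩ h
        simp only [Finset.mem_sigma, Finset.mem_filter, Finset.mem_univ, true_and,
          Function.update_self, and_true] at h ⊢
        exact hupd w h.1 k (i + 1) (by omega)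
      · rintro ⟨w, k⟩ h
        simp only [Finset.mem_sigma, Finset.mem_filter, Finset.mem_univ, true_and] at h
        simp [← h.2]
      · rintro ⟨w, k⟩ h
        simp only [Finset.mem_sigma, Finset.mem_filter, Finset.mem_univ, true_and] at h
        simp only [Function.update_idem]
        congr 1
        rw [← h.2, Function.update_eq_self]
      · rintro ⟨w, k⟩ h
        simp only [Finset.mem_sigma, Finset.mem_filter, Finset.mem_univ, true_and] at h
        simp [← h.2]
    rw [h1, h2, Finset.mul_sum]
    refine Finset.sum_congr rfl fun w _ => ?_
    by_cases hvw : v w = 0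
    · simp [hvw]
    · rw [← Finset.mul_sum, hef w hvw]
      ring
  have key' : ∑ w ∈ S, Complex.normSq (fv w) =
      ((lam i : ℝ) - lam (i + 1)) * ∑ w ∈ S, Complex.normSq (v w) := by
    have := key
    simp only [mul_comm ((starRingEnd ℂ) _), Complex.mul_conj] at this
    exact_mod_cast this
  have hpos : 0 < ∑ w ∈ S, Complex.normSq (v w) := by
    obtain ⟨w, hw⟩ := Finsupp.ne_iff.1 h0
    exact Finset.sum_pos' (fun w _ => Complex.normSq_nonneg _)
      ⟨w, hvS w hw, Complex.normSq_pos.2 hw⟩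
  have hnn : 0 ≤ ∑ w ∈ S, Complex.normSq (fv w) :=
    Finset.sum_nonneg fun w _ => Complex.normSq_nonneg _
  by_contra hlt
  push Not at hlt
  have : ((lam i : ℝ) - lam (i + 1)) < 0 := by
    have : (lam i : ℝ) < lam (i + 1) := by exact_mod_cast hlt
    linarith
  have := mul_neg_of_neg_of_pos this hpos
  linarith

/-- The component `v^{(j)}` in the decomposition `v = ∑_j v_j ⊗ v^{(j)}`. -/
def headComp (n j : ℕ) : TensorPow (n + 1) →ₗ[ℂ] TensorPow n :=
  Finsupp.lcomapDomain (fun w : Fin n → ℕ => (Fin.cons j w : Fin (n + 1) → ℕ))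
    (Fin.cons_right_injective (α := fun _ => ℕ) j)

@[simp] theorem headComp_apply {n : ℕ} (j : ℕ) (v : TensorPow (n + 1)) (w : Fin n → ℕ) :
    headComp n j v w = v (Fin.cons j w) := rfl

theorem ext_headComp {n : ℕ} {v : TensorPow (n + 1)} (h : ∀ j, headComp n j v = 0) : v = 0 := by
  ext w
  have := DFunLike.congr_fun (h (w 0)) (Fin.tail w)
  simpa [Fin.cons_self_tail] using this

theorem filter_cons_card {n : ℕ} (r : ℕ) (w : Fin n → ℕ) (i : ℕ) :
    (Finset.univ.filter fun k => (Fin.cons r w : Fin (n + 1) → ℕ) k = i).card =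
      (if r = i then 1 else 0) + (Finset.univ.filter fun k => w k = i).card := by
  rw [Finset.card_filter, Finset.card_filter, Fin.sum_univ_succ]
  simp

theorem sum_filter_cons {n : ℕ} (r : ℕ) (w : Fin n → ℕ) (i : ℕ) (f : Fin (n + 1) → ℂ) :
    (∑ k ∈ Finset.univ.filter (fun k => (Fin.cons r w : Fin (n + 1) → ℕ) k = i), f k) =
      (if r = i then f 0 else 0) + ∑ k ∈ Finset.univ.filter (fun k => w k = i), f k.succ := by
  rw [Finset.sum_filter, Finset.sum_filter, Fin.sum_univ_succ]
  simp

theorem Kills.cons {n : ℕ} {i j : ℕ} {v : (Fin (n + 1) → ℕ) → ℂ} (h : Kills i j v) (r : ℕ)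
    (w : Fin n → ℕ) :
    (if r = i then v (Fin.cons j w) else 0) +
      ∑ k ∈ Finset.univ.filter (fun k => w k = i), v (Fin.cons r (Function.update w k j)) = 0 := by
  have := h (Fin.cons r w)
  rw [sum_filter_cons] at this
  simpa [Fin.cons_update, Fin.update_cons_zero] using this

/-- The top component of a singular vector is singular. -/
theorem headComp_mem_sing {n : ℕ} {lam : ℕ → ℕ} {v : TensorPow (n + 1)} (hv : v ∈ sing (n + 1) lam)
    {r : ℕ} (hr : ∀ j, r < j → headComp n j v = 0) :
    headComp n r v ∈ sing n (fun i => lam i - if r = i then 1 else 0) := by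
  refine ⟨fun w hw i => ?_, fun i j hij w => ?_⟩
  · have := hv.1 _ hw i
    rw [filter_cons_card] at this
    simp only
    omega
  · have := (hv.2 i j hij).cons r w
    have h0 : (if r = i then v (Fin.cons j w) else 0) = 0 := by
      split_ifs with h
      · exact DFunLike.congr_fun (hr j (h ▸ hij)) w
      · rfl
    rw [h0, zero_add] at this
    exact this

/-- A nonzero vector has a top component: the nonzero component with the greatest letter. -/
theorem exists_top {n : ℕ} {v : TensorPow (n + 1)} (h0 : v ≠ 0) :
    ∃ r, headComp n r v ≠ 0 ∧ ∀ j, r < j → headComp n j v = 0 := by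
  classical
  have hex : ∃ j, headComp n j v ≠ 0 := by
    by_contra! h
    exact h0 (ext_headComp h)
  obtain ⟨N, hN⟩ : ∃ N, ∀ j, N < j → headComp n j v = 0 := by
    refine ⟨v.support.sup fun w => w 0, fun j hj => ?_⟩
    ext w
    by_contra hne
    have : (Fin.cons j w : Fin (n + 1) → ℕ) ∈ v.support := Finsupp.mem_support_iff.2 hne
    have := Finset.le_sup (f := fun w : Fin (n + 1) → ℕ => w 0) this
    simp at this
    omega
  let r := Nat.findGreatest (fun j => headComp n j v ≠ 0) N
  obtain ⟨j, hj⟩ := hex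
  have hjN : j ≤ N := by
    by_contra hlt
    exact hj (hN j (by omega))
  refine ⟨r, Nat.findGreatest_spec (P := fun j => headComp n j v ≠ 0) hjN hj, fun k hk => ?_⟩
  by_contra hne
  by_cases hkN : k ≤ N
  · have := Nat.le_findGreatest (P := fun j => headComp n j v ≠ 0) hkN hne
    omega
  · exact hne (hN k (by omega))

/-! ### Specht modules consist of the singular vectors -/

theorem polytabloid_apply {n : ℕ} {μ : YoungDiagram} (T : Labelling n μ) (w : Fin n → ℕ) :
    polytabloid T w = ∑ σ ∈ colStab T,
      if rowWord T ∘ σ.symm = w then ((Equiv.Perm.sign σ : ℤ) : ℂ) else 0 := by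
  classical
  simp [polytabloid, tensorRep_single, Finsupp.finsetSum_apply, Finsupp.single_apply]

theorem mem_colStab {n : ℕ} {μ : YoungDiagram} {T : Labelling n μ} {σ : Equiv.Perm (Fin n)} :
    σ ∈ colStab T ↔ ∀ j, colOf T (σ j) = colOf T j := by
  simp [colStab]

theorem card_rowWord {n : ℕ} {μ : YoungDiagram} (T : Labelling n μ) (i : ℕ) :
    (Finset.univ.filter fun k => rowWord T k = i).card = μ.rowLen i := by
  rw [YoungDiagram.rowLen_eq_card]
  refine Finset.card_bij (fun k _ => (T.symm k).1) ?_ ?_ ?_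
  · intro k hk
    rw [YoungDiagram.mem_row_iff]
    exact ⟨(T.symm k).2, (Finset.mem_filter.1 hk).2⟩
  · intro a _ b _ h
    exact T.symm.injective (Subtype.ext h)
  · intro c hc
    rw [YoungDiagram.mem_row_iff] at hc
    exact ⟨T ⟨c, hc.1⟩, Finset.mem_filter.2 ⟨Finset.mem_univ _, by simp [rowWord, hc.2]⟩, by simp⟩

/-- The label of the box of row `i` in the column of the box labelled `k`. -/
theorem exists_label_above {n : ℕ} {μ : YoungDiagram} (T : Labelling n μ) (i : ℕ) (k : Fin n)
    (h : i < rowWord T k) : ∃ l, rowWord T l = i ∧ colOf T l = colOf T k := by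
  have hm : (i, colOf T k) ∈ μ.cells := by
    have := (T.symm k).2
    exact μ.isLowerSet (show ((i, colOf T k) : ℕ × ℕ) ≤ (T.symm k).1 from ⟨h.le, le_rfl⟩) this
  exact ⟨T ⟨_, hm⟩, by simp [rowWord], by simp [colOf]⟩

/-- Raising operators kill `v_T`: after replacing a letter `j` by `i`, two letters of one column
coincide, and the transposition of their positions reverses the sign. -/
theorem polytabloid_mem_sing {n : ℕ} {μ : YoungDiagram} (T : Labelling n μ) :
    polytabloid T ∈ sing n μ.rowLen := by
  classical
  refine ⟨fun w hw i => ?_, fun i j hij w => ?_⟩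
  · rw [polytabloid_apply] at hw
    obtain ⟨σ, -, hσ⟩ := Finset.exists_ne_zero_of_sum_ne_zero hw
    have hσ' : rowWord T ∘ σ.symm = w := by
      by_contra h
      simp [h] at hσ
    rw [← card_rowWord T i, ← hσ']
    refine Finset.card_bij (fun k _ => σ.symm k) ?_ ?_ ?_
    · intro k hk; simpa using hk
    · intro a _ b _ h; exact σ.symm.injective h
    · intro b hb; exact ⟨σ b, by simpa using hb, by simp⟩
  · choose! up hup using fun k => exists_label_above T i k
    simp only [polytabloid_apply]
    rw [Finset.sum_sigma']
    rw [← Finset.sum_filter_ne_zero]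
    refine Finset.sum_involution
      (fun p _ => ⟨p.2 (up (p.2.symm p.1)), Equiv.swap p.1 (p.2 (up (p.2.symm p.1))) * p.2⟩)
      ?_ ?_ ?_ ?_
    all_goals
      rintro ⟨k, σ⟩ hp
      simp only [Finset.mem_filter, Finset.mem_sigma, Finset.mem_univ, true_and, ne_eq,
        ite_eq_right_iff, not_forall] at hp
      obtain ⟨⟨hk, hσ⟩, hword, hsgn⟩ := hp
      have hk0 : rowWord T (σ.symm k) = j := by
        have := congrFun hword k
        simpa using this
      obtain ⟨hu1, hu2⟩ := hup (σ.symm k) (by omega)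
      set k0 := σ.symm k with hk0def
      set l := σ (up k0) with hl
      have hkl : k ≠ l := by
        intro h
        have : up k0 = k0 := by
          conv_rhs => rw [hk0def, h]
          exact (σ.symm_apply_apply _).symm
        rw [this] at hu1
        omega
      have hwl : w l = i := by
        have := congrFun hword l
        rw [Function.update_of_ne hkl.symm] at this
        rw [← this]
        simp [hl, hu1]
      have hword' : rowWord T ∘ (Equiv.swap k l * σ).symm = Function.update w l j := by
        funext m
        have hm := congrFun hword (Equiv.swap k l m)
        simp only [Function.comp_apply] at hm ⊢
        have e : (Equiv.swap k l * σ).symm m = σ.symm (Equiv.swap k l m) := by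
          simp [Equiv.Perm.mul_def]
        rw [e, hm]
        rcases eq_or_ne m k with rfl | hmk
        · rw [Equiv.swap_apply_left, Function.update_of_ne hkl.symm, Function.update_of_ne hkl,
            hwl, hk]
        rcases eq_or_ne m l with rfl | hml
        · simp
        · rw [Equiv.swap_apply_of_ne_of_ne hmk hml, Function.update_of_ne hmk,
            Function.update_of_ne hml]
      have hs : Equiv.Perm.sign (Equiv.swap k l * σ) = - Equiv.Perm.sign σ := by
        rw [map_mul, Equiv.Perm.sign_swap hkl]; simp
      have hmem : Equiv.swap k l * σ ∈ colStab T := by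
        have hcol : colOf T k = colOf T l := by
          have h1 := mem_colStab.1 hσ k0
          have h2 := mem_colStab.1 hσ (up k0)
          rw [← hl, hu2] at h2
          rw [hk0def, Equiv.apply_symm_apply] at h1
          rw [h1, h2]
        refine mem_colStab.2 fun m => ?_
        rw [← mem_colStab.1 hσ m, Equiv.Perm.mul_apply]
        rcases eq_or_ne (σ m) k with h | hmk
        · rw [h, Equiv.swap_apply_left, hcol]
        rcases eq_or_ne (σ m) l with h | hml
        · rw [h, Equiv.swap_apply_right, hcol]
        · rw [Equiv.swap_apply_of_ne_of_ne hmk hml]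
    · simp only [hword, hword', if_true, hs]
      simp
    · intro _ h
      exact hkl (congrArg Sigma.fst h).symm
    · simp only [Finset.mem_filter, Finset.mem_sigma, Finset.mem_univ, true_and]
      refine ⟨⟨hwl, hmem⟩, ?_⟩
      rw [if_pos hword', hs]
      simp
    · have e : (Equiv.swap k l * σ).symm l = k0 := by
        simp [Equiv.Perm.mul_def, hk0def]
      simp only [e]
      have e2 : (Equiv.swap k l * σ) (up k0) = k := by
        rw [Equiv.Perm.mul_apply, ← hl, Equiv.swap_apply_right]
      rw [e2, Equiv.swap_comm l k, Equiv.swap_mul_self_mul]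

/-- The diagram `μ` arises from `μ'` by adding the box `c`. -/
def AddsBox (μ' μ : YoungDiagram) (c : ℕ × ℕ) : Prop :=
  c ∉ μ'.cells ∧ μ.cells = insert c μ'.cells

theorem AddsBox.card {μ' μ : YoungDiagram} {c : ℕ × ℕ} (h : AddsBox μ' μ c) :
    μ.card = μ'.card + 1 := by
  change μ.cells.card = μ'.cells.card + 1
  rw [h.2, Finset.card_insert_of_notMem h.1]

theorem AddsBox.rowLen {μ' μ : YoungDiagram} {c : ℕ × ℕ} (h : AddsBox μ' μ c) (i : ℕ) :
    μ.rowLen i = μ'.rowLen i + if c.1 = i then 1 else 0 := by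
  rw [YoungDiagram.rowLen_eq_card, YoungDiagram.rowLen_eq_card, YoungDiagram.row,
    YoungDiagram.row, h.2, Finset.filter_insert]
  split_ifs with hc
  · rw [Finset.card_insert_of_notMem]
    exact fun hm => h.1 (Finset.mem_filter.1 hm).1
  · rfl

theorem AddsBox.lt_of_mem {μ' μ : YoungDiagram} {c : ℕ × ℕ} (h : AddsBox μ' μ c) {i : ℕ}
    (hi : (i, c.2) ∈ μ'.cells) : i < c.1 := by
  by_contra hlt
  exact h.1 (μ'.isLowerSet (show c ≤ (i, c.2) from ⟨by simpa using hlt, le_rfl⟩) hi)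

theorem exists_addsBox {μ : YoungDiagram} {r : ℕ} (h : μ.rowLen (r + 1) < μ.rowLen r) :
    ∃ μ', AddsBox μ' μ (r, μ.rowLen r - 1) := by
  have hc : (r, μ.rowLen r - 1) ∈ μ.cells := by
    rw [YoungDiagram.mem_cells, YoungDiagram.mem_iff_lt_rowLen]; omega
  refine ⟨⟨μ.cells.erase (r, μ.rowLen r - 1), ?_⟩, ?_, ?_⟩
  · rintro ⟨x1, x2⟩ y hyx hx
    simp only [Finset.coe_erase, Set.mem_sdiff, Finset.mem_coe, Set.mem_singleton_iff] at hx ⊢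
    refine ⟨μ.isLowerSet hyx hx.1, ?_⟩
    rintro rfl
    obtain ⟨h1, h2⟩ := hyx
    simp only at h1 h2
    have hx1 := hx.1
    rw [YoungDiagram.mem_cells, YoungDiagram.mem_iff_lt_rowLen] at hx1
    rcases h1.eq_or_lt with rfl | h1
    · exact hx.2 (by ext <;> simp; omega)
    · have := μ.rowLen_anti (r + 1) x1 h1
      omega
  · simp
  · rw [Finset.insert_erase hc]

/-- The labelling of `μ` that gives the label `0` to the added box and shifts the labels of the
other boxes. -/
def AddsBox.labelling {n : ℕ} {μ' μ : YoungDiagram} {c : ℕ × ℕ} (h : AddsBox μ' μ c)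
    (T : Labelling n μ') : Labelling (n + 1) μ where
  toFun x := if hx : x.1 ∈ μ'.cells then (T ⟨x.1, hx⟩).succ else 0
  invFun := Fin.cons ⟨c, by rw [h.2]; exact Finset.mem_insert_self _ _⟩
    fun k => ⟨(T.symm k).1, by rw [h.2]; exact Finset.mem_insert_of_mem (T.symm k).2⟩
  left_inv x := by
    by_cases hx : x.1 ∈ μ'.cells
    · simp [hx]
    · have : x.1 = c := (Finset.mem_insert.1 (h.2 ▸ x.2)).resolve_right hx
      ext1
      beta_reduce
      rw [dif_neg hx, Fin.cons_zero, this]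
  right_inv k := by
    refine Fin.cases ?_ (fun k => ?_) k
    · simp [h.1]
    · have : (T.symm k).1 ∈ μ'.cells := (T.symm k).2
      simp [this, -YoungDiagram.mem_cells]

theorem AddsBox.rowWord_labelling {n : ℕ} {μ' μ : YoungDiagram} {c : ℕ × ℕ} (h : AddsBox μ' μ c)
    (T : Labelling n μ') : rowWord (h.labelling T) = Fin.cons c.1 (rowWord T) := by
  funext k
  refine Fin.cases ?_ (fun k => ?_) k <;> simp [rowWord, AddsBox.labelling]

theorem AddsBox.colOf_labelling {n : ℕ} {μ' μ : YoungDiagram} {c : ℕ × ℕ} (h : AddsBox μ' μ c)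
    (T : Labelling n μ') : colOf (h.labelling T) = Fin.cons c.2 (colOf T) := by
  funext k
  refine Fin.cases ?_ (fun k => ?_) k <;> simp [colOf, AddsBox.labelling]

/-- A column permutation that moves another label to the added box takes it from the same column,
where all other boxes lie above the added one. -/
theorem AddsBox.letter_lt {n : ℕ} {μ' μ : YoungDiagram} {c : ℕ × ℕ} (h : AddsBox μ' μ c)
    (T : Labelling n μ') {σ : Equiv.Perm (Fin (n + 1))} (hσ : σ ∈ colStab (h.labelling T))
    (h0 : σ.symm 0 ≠ 0) : rowWord (h.labelling T) (σ.symm 0) < c.1 := by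
  obtain ⟨k, hk⟩ := Fin.exists_succ_eq.2 h0
  have h1 := mem_colStab.1 hσ (σ.symm 0)
  rw [Equiv.apply_symm_apply, ← hk, h.colOf_labelling, Fin.cons_zero, Fin.cons_succ] at h1
  rw [← hk, h.rowWord_labelling, Fin.cons_succ]
  refine h.lt_of_mem ?_
  rw [h1]
  exact (T.symm k).2

theorem AddsBox.headComp_polytabloid_of_lt {n : ℕ} {μ' μ : YoungDiagram} {c : ℕ × ℕ}
    (h : AddsBox μ' μ c) (T : Labelling n μ') {j : ℕ} (hj : c.1 < j) :
    headComp n j (polytabloid (h.labelling T)) = 0 := by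
  ext w
  rw [headComp_apply, polytabloid_apply]
  refine Finset.sum_eq_zero fun σ hσ => if_neg fun hw => ?_
  have h0 := congrFun hw 0
  simp only [Function.comp_apply, Fin.cons_zero] at h0
  by_cases hs : σ.symm 0 = 0
  · rw [hs, h.rowWord_labelling, Fin.cons_zero] at h0
    omega
  · have := h.letter_lt T hσ hs
    omega

/-- Only the column permutations that fix the label `0` put the letter of the added box at position
`0`, and these are the column permutations of the smaller labelling. -/
theorem AddsBox.headComp_polytabloid {n : ℕ} {μ' μ : YoungDiagram} {c : ℕ × ℕ}
    (h : AddsBox μ' μ c) (T : Labelling n μ') :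
    headComp n c.1 (polytabloid (h.labelling T)) = polytabloid T := by
  classical
  ext w
  rw [headComp_apply, polytabloid_apply, polytabloid_apply]
  symm
  have hz : ∀ σ : Equiv.Perm (Fin n), ∀ k : Fin n,
      (Equiv.Perm.decomposeFin.symm (0, σ)) k.succ = (σ k).succ := by
    intro σ k; simp
  have hz0 : ∀ σ : Equiv.Perm (Fin n), (Equiv.Perm.decomposeFin.symm (0, σ)) 0 = 0 := by
    intro σ; simp
  refine Finset.sum_of_injOn (fun σ => Equiv.Perm.decomposeFin.symm (0, σ)) ?_ ?_ ?_ ?_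
  · intro a _ b _ hab
    simpa using hab
  · intro σ hσ
    refine mem_colStab.2 fun k => ?_
    have := mem_colStab.1 hσ
    refine Fin.cases ?_ (fun k => ?_) k
    · rw [hz0]
    · rw [hz, h.colOf_labelling, Fin.cons_succ, Fin.cons_succ, this]
  · intro σ hσ hσ'
    refine if_neg fun hw => ?_
    have h0 := congrFun hw 0
    simp only [Function.comp_apply, Fin.cons_zero] at h0
    by_cases hs : σ.symm 0 = 0
    · apply hσ'
      have hσ0 : σ 0 = 0 := by rw [Equiv.symm_apply_eq] at hs; exact hs.symm
      obtain ⟨⟨p, τ⟩, rfl⟩ := Equiv.Perm.decomposeFin.symm.surjective σ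
      have hp : p = 0 := by simpa using hσ0
      subst hp
      refine ⟨τ, mem_colStab.2 fun k => ?_, rfl⟩
      have := mem_colStab.1 hσ k.succ
      rw [hz, h.colOf_labelling, Fin.cons_succ, Fin.cons_succ] at this
      exact this
    · have := h.letter_lt T hσ hs
      omega
  · intro σ _
    have hw : rowWord (h.labelling T) ∘ (Equiv.Perm.decomposeFin.symm (0, σ)).symm =
        Fin.cons c.1 (rowWord T ∘ σ.symm) := by
      funext k
      refine Fin.cases ?_ (fun k => ?_) k
      · have : (Equiv.Perm.decomposeFin.symm (0, σ)).symm 0 = 0 := by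
          rw [Equiv.symm_apply_eq, hz0]
        simp [this, h.rowWord_labelling]
      · have : (Equiv.Perm.decomposeFin.symm (0, σ)).symm k.succ = (σ.symm k).succ := by
          rw [Equiv.symm_apply_eq, hz]; simp
        simp [this, h.rowWord_labelling]
    rw [hw]
    simp [Fin.cons_inj]

theorem polytabloid_mem_specht {n : ℕ} {μ : YoungDiagram} (T : Labelling n μ) :
    polytabloid T ∈ (specht n μ).toSubmodule := Submodule.subset_span ⟨T, rfl⟩

/-- Every vector of `W^{μ'}` is the top component of a vector of `W^μ`. -/
theorem AddsBox.exists_lift {n : ℕ} {μ' μ : YoungDiagram} {c : ℕ × ℕ} (h : AddsBox μ' μ c)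
    {w : TensorPow n} (hw : w ∈ (specht n μ').toSubmodule) :
    ∃ x ∈ (specht (n + 1) μ).toSubmodule, (∀ j, c.1 < j → headComp n j x = 0) ∧
      headComp n c.1 x = w := by
  induction hw using Submodule.span_induction with
  | mem x hx =>
    obtain ⟨T, rfl⟩ := hx
    exact ⟨_, polytabloid_mem_specht (h.labelling T),
      fun j hj => h.headComp_polytabloid_of_lt T hj, h.headComp_polytabloid T⟩
  | zero => exact ⟨0, Submodule.zero_mem _, by simp, by simp⟩
  | add x y _ _ hx hy =>
    obtain ⟨x', h1, h2, h3⟩ := hx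
    obtain ⟨y', h1', h2', h3'⟩ := hy
    exact ⟨x' + y', Submodule.add_mem _ h1 h1', fun j hj => by simp [h2 j hj, h2' j hj],
      by simp [h3, h3']⟩
  | smul a x _ hx =>
    obtain ⟨x', h1, h2, h3⟩ := hx
    exact ⟨a • x', Submodule.smul_mem _ a h1, fun j hj => by simp [h2 j hj], by simp [h3]⟩

theorem specht_le_sing (n : ℕ) (μ : YoungDiagram) :
    (specht n μ).toSubmodule ≤ sing n μ.rowLen := by
  refine Submodule.span_le.2 ?_
  rintro _ ⟨T, rfl⟩
  exact polytabloid_mem_sing T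

theorem labelling_nonempty {n : ℕ} {μ : YoungDiagram} (h : μ.card = n) :
    Nonempty (Labelling n μ) :=
  ⟨Fintype.equivFinOfCardEq (by simpa using h)⟩

/-- If the component at the letter `r` is the top component of a nonzero singular vector of
weight `μ`, then the last box of row `r` is removable. -/
theorem exists_addsBox_of_top {n : ℕ} {μ : YoungDiagram} {v : TensorPow (n + 1)}
    (hv : v ∈ sing (n + 1) μ.rowLen) {r : ℕ} (hr : headComp n r v ≠ 0)
    (hr' : ∀ j, r < j → headComp n j v = 0) :
    ∃ μ' : YoungDiagram, AddsBox μ' μ (r, μ.rowLen r - 1) ∧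
      headComp n r v ∈ sing n μ'.rowLen := by
  have hs := headComp_mem_sing hv hr'
  have hanti := antitone_of_mem_sing hs hr
  obtain ⟨w, hw⟩ := Finsupp.ne_iff.1 hr
  have hpos : 1 ≤ μ.rowLen r := by
    have := hv.1 _ hw r
    rw [filter_cons_card, if_pos rfl] at this
    omega
  have hlt : μ.rowLen (r + 1) < μ.rowLen r := by
    have := hanti (Nat.le_succ r)
    simp only [if_true, Nat.succ_eq_add_one] at this
    rw [if_neg (by omega)] at this
    omega
  obtain ⟨μ', h⟩ := exists_addsBox hlt
  refine ⟨μ', h, ?_⟩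
  have : (fun i => μ.rowLen i - if r = i then 1 else 0) = μ'.rowLen := by
    funext i
    have := h.rowLen i
    simp only at this
    omega
  rwa [this] at hs

/-- The Specht module `W^μ` is the space of all singular vectors of weight `μ`. -/
theorem specht_eq_sing {n : ℕ} {μ : YoungDiagram} (hμ : μ.card = n) :
    (specht n μ).toSubmodule = sing n μ.rowLen := by
  classical
  refine le_antisymm (specht_le_sing n μ) ?_
  induction n generalizing μ with
  | zero =>
    intro v _
    obtain ⟨T⟩ := labelling_nonempty hμ
    have : v = v default • polytabloid T := by
      refine Finsupp.ext fun w => ?_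
      have hσ : colStab T = {1} := by
        ext σ
        simp [mem_colStab, Subsingleton.elim σ 1]
      rw [Finsupp.smul_apply, polytabloid_apply, hσ, Finset.sum_singleton,
        if_pos (Subsingleton.elim _ _), Subsingleton.elim w default]
      simp
    rw [this]
    exact Submodule.smul_mem _ _ (polytabloid_mem_specht T)
  | succ n ih =>
    have key : ∀ R, ∀ v ∈ sing (n + 1) μ.rowLen, (∀ j, R ≤ j → headComp n j v = 0) →
        v ∈ (specht (n + 1) μ).toSubmodule := by
      intro R
      induction R with
      | zero =>
        intro v _ h
        rw [ext_headComp fun j => h j (Nat.zero_le j)]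
        exact Submodule.zero_mem _
      | succ R ihR =>
        intro v hv h
        by_cases h0 : headComp n R v = 0
        · refine ihR v hv fun j hj => ?_
          rcases hj.eq_or_lt with rfl | hj
          · exact h0
          · exact h j hj
        · obtain ⟨μ', hadd, hs⟩ := exists_addsBox_of_top hv h0 fun j hj => h j hj
          have hc := hadd.card
          -- subtracting a lift of the top component lowers the greatest first letter
          obtain ⟨x, hx, hx1, hx2⟩ := hadd.exists_lift (ih (by omega) hs)
          have := ihR (v - x) (Submodule.sub_mem _ hv (specht_le_sing _ _ hx)) fun j hj => by
            rw [map_sub]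
            rcases hj.eq_or_lt with rfl | hj
            · rw [hx2, sub_self]
            · rw [h j hj, hx1 j hj, sub_self]
          simpa using Submodule.add_mem _ this hx
    intro v hv
    by_cases h0 : v = 0
    · rw [h0]; exact Submodule.zero_mem _
    obtain ⟨r, -, hr⟩ := exists_top h0
    exact key (r + 1) v hv fun j hj => hr j hj

/-! ### Operators with simple spectrum -/

theorem repr_apply_of_eigenbasis {V : Type} [AddCommGroup V] [Module ℂ V] {κ : Type}
    (b : Module.Basis κ ℂ V) {A : Module.End ℂ V} {e : κ → ℂ} (hb : ∀ k, A (b k) = e k • b k)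
    (v : V) (k : κ) : b.repr (A v) k = e k * b.repr v k := by
  classical
  have : (b.coord k) ∘ₗ A = e k • b.coord k := by
    refine b.ext fun j => ?_
    simp only [LinearMap.comp_apply, hb, map_smul, LinearMap.smul_apply, Module.Basis.coord_apply,
      Module.Basis.repr_self, Finsupp.single_apply, smul_eq_mul]
    split_ifs with h
    · rw [h]
    · simp
  exact congrArg (fun f : V →ₗ[ℂ] ℂ => f v) this

/-- For a diagonal operator `A`, the basis vector `b k` is not in the range of `A - e k`. -/
theorem apply_sub_smul_ne_of_eigenbasis {V : Type} [AddCommGroup V] [Module ℂ V] {κ : Type}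
    (b : Module.Basis κ ℂ V) {A : Module.End ℂ V} {e : κ → ℂ} (hb : ∀ k, A (b k) = e k • b k)
    (v : V) (k : κ) : A v - e k • v ≠ b k := by
  intro h
  have := congrArg (fun x => b.repr x k) h
  simp [repr_apply_of_eigenbasis b hb] at this

section SimpleSpectrum

variable {V : Type} [AddCommGroup V] [Module ℂ V] [FiniteDimensional ℂ V]

/-- An operator has simple spectrum if its characteristic polynomial has no multiple roots. -/
def SimpleSpectrum (A : Module.End ℂ V) : Prop := A.charpoly.Separable

theorem SimpleSpectrum.exists_basis {A : Module.End ℂ V} (h : SimpleSpectrum A) :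
    ∃ (e : Fin (Module.finrank ℂ V) → ℂ) (b : Module.Basis (Fin (Module.finrank ℂ V)) ℂ V),
      Function.Injective e ∧ ∀ k, A (b k) = e k • b k := by
  classical
  have hnd : A.charpoly.roots.Nodup := Polynomial.nodup_roots h
  have hcard : A.charpoly.roots.toFinset.card = Module.finrank ℂ V := by
    rw [Multiset.toFinset_card_of_nodup hnd, ← LinearMap.charpoly_natDegree A]
    exact (IsAlgClosed.splits _).natDegree_eq_card_roots.symm
  let e : Fin (Module.finrank ℂ V) → ℂ := fun k =>
    (A.charpoly.roots.toFinset.equivFinOfCardEq hcard).symm k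
  have he : Function.Injective e := Subtype.val_injective.comp (Equiv.injective _)
  have hev : ∀ k, ∃ v, A.HasEigenvector (e k) v := fun k => by
    have hk := ((A.charpoly.roots.toFinset.equivFinOfCardEq hcard).symm k).2
    rw [Multiset.mem_toFinset] at hk
    exact ((Module.End.hasEigenvalue_iff_isRoot_charpoly A _).2
      (Polynomial.isRoot_of_mem_roots hk)).exists_hasEigenvector
  choose v hv using hev
  have hli : LinearIndependent ℂ v := Module.End.eigenvectors_linearIndependent' A e he v hv
  refine ⟨e, basisOfLinearIndependentOfCardEqFinrank' v hli (by simp), he, fun k => ?_⟩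
  simpa using (hv k).apply_eq_smul

/-- An operator with at least as many different eigenvalues as the dimension of the space has simple
spectrum. -/
theorem simpleSpectrum_of_card_le {A : Module.End ℂ V} (s : Finset ℂ)
    (hs : ∀ x ∈ s, A.HasEigenvalue x) (hc : Module.finrank ℂ V ≤ s.card) : SimpleSpectrum A := by
  classical
  have h0 : A.charpoly ≠ 0 := (LinearMap.charpoly_monic A).ne_zero
  have hsub : s.val ≤ A.charpoly.roots := by
    rw [Multiset.le_iff_subset s.nodup]
    intro x hx
    exact (Polynomial.mem_roots h0).2
      ((Module.End.hasEigenvalue_iff_isRoot_charpoly A x).1 (hs x hx))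
  have hle : A.charpoly.roots.card ≤ s.val.card := by
    refine (Polynomial.card_roots' _).trans ?_
    rw [LinearMap.charpoly_natDegree]
    exact hc
  have heq := Multiset.eq_of_le_of_card_le hsub hle
  refine (Polynomial.nodup_roots_iff_of_splits h0 (IsAlgClosed.splits _)).1 ?_
  rw [← heq]
  exact s.nodup

/-- If a commuting algebra of operators contains an operator with simple spectrum, it acts
semisimply and its joint spectrum has as many elements as the dimension of the space. -/
theorem SimpleSpectrum.semisimple_and_encard {𝒜 : Subalgebra ℂ (Module.End ℂ V)}
    {X : Module.End ℂ V} (hX : X ∈ 𝒜) (hsimple : SimpleSpectrum X)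
    (hcomm : ∀ A ∈ 𝒜, A * X = X * A) :
    ActsSemisimply 𝒜 ∧ (jointSpectrum 𝒜).encard = (Module.finrank ℂ V : ℕ∞) := by
  classical
  obtain ⟨e, b, he, hb⟩ := hsimple.exists_basis
  have hcoord := repr_apply_of_eigenbasis b hb
  have hline : ∀ (v : V) k, X v = e k • v → v = b.repr v k • b k := by
    intro v k hv
    refine b.ext_elem fun j => ?_
    rcases eq_or_ne j k with rfl | hjk
    · simp
    · have h1 := hcoord v j
      rw [hv] at h1
      simp only [map_smul, Finsupp.smul_apply, smul_eq_mul] at h1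
      have h2 : (e k - e j) * b.repr v j = 0 := by linear_combination h1
      rcases mul_eq_zero.1 h2 with h | h
      · exact absurd (he (sub_eq_zero.1 h)).symm hjk
      · simp [h, hjk.symm]
  have hdiag : ∀ A ∈ 𝒜, ∀ k, A (b k) = b.repr (A (b k)) k • b k := by
    intro A hA k
    refine hline _ k ?_
    have := LinearMap.congr_fun (hcomm A hA) (b k)
    simp only [Module.End.mul_apply, hb, map_smul] at this
    exact this.symm
  refine ⟨⟨_, b, fun A hA k => ⟨_, hdiag A hA k⟩⟩, ?_⟩
  let χ : Fin (Module.finrank ℂ V) → (𝒜 →ₗ[ℂ] ℂ) := fun k =>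
    b.coord k ∘ₗ LinearMap.applyₗ (b k) ∘ₗ 𝒜.val.toLinearMap
  have hχ : ∀ k (A : 𝒜), (A : Module.End ℂ V) (b k) = χ k A • b k := fun k A => hdiag A A.2 k
  have hχX : ∀ k, χ k ⟨X, hX⟩ = e k := fun k => by
    change b.repr (X (b k)) k = e k
    simp [hb]
  have hχinj : Function.Injective χ := fun k l h => he (by rw [← hχX, ← hχX, h])
  have hset : jointSpectrum 𝒜 = Set.range χ := by
    ext ψ
    constructor
    · intro hψ
      obtain ⟨v, hv, hv0⟩ := (Submodule.ne_bot_iff _).1 hψ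
      obtain ⟨k, hk⟩ : ∃ k, b.repr v k ≠ 0 := by
        by_contra! h
        exact hv0 (b.ext_elem fun k => by simp [h k])
      refine ⟨k, LinearMap.ext fun A => ?_⟩
      have hA := (Submodule.mem_iInf _).1 hv A
      rw [Module.End.mem_maxGenEigenspace] at hA
      obtain ⟨m, hm⟩ := hA
      have hpow : ∀ m, b.repr ((((A : Module.End ℂ V) - ψ A • (1 : Module.End ℂ V)) ^ m) v) k =
          (χ k A - ψ A) ^ m * b.repr v k := by
        have hco : (b.coord k) ∘ₗ ((A : Module.End ℂ V) - ψ A • (1 : Module.End ℂ V)) =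
            (χ k A - ψ A) • b.coord k := by
          refine b.ext fun j => ?_
          simp only [LinearMap.comp_apply, LinearMap.sub_apply, hχ, LinearMap.smul_apply,
            Module.End.one_apply, map_sub, map_smul, Module.Basis.coord_apply,
            Module.Basis.repr_self, Finsupp.single_apply, smul_eq_mul]
          split_ifs with h
          · rw [h]; ring
          · simp
        intro m
        induction m with
        | zero => simp
        | succ m ih =>
          rw [pow_succ', Module.End.mul_apply]
          have := LinearMap.congr_fun hco
            ((((A : Module.End ℂ V) - ψ A • (1 : Module.End ℂ V)) ^ m) v)
          simp only [LinearMap.comp_apply, LinearMap.smul_apply, Module.Basis.coord_apply,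
            smul_eq_mul] at this
          rw [this, ih]
          ring
      have := hpow m
      rw [hm] at this
      simp only [map_zero, Finsupp.coe_zero, Pi.zero_apply] at this
      have h2 := (mul_eq_zero.1 this.symm).resolve_right hk
      exact sub_eq_zero.1 (by by_contra hne; exact pow_ne_zero m hne h2)
    · rintro ⟨k, rfl⟩
      refine (Submodule.ne_bot_iff _).2 ⟨b k, (Submodule.mem_iInf _).2 fun A => ?_, b.ne_zero k⟩
      rw [Module.End.mem_maxGenEigenspace]
      exact ⟨1, by simp [hχ]⟩
  rw [hset, ← Set.image_univ, hχinj.encard_image, Set.encard_univ]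
  simp

/-- Among the combinations `∑ a_s A_s` of fixed operators, those with simple spectrum are described
by the nonvanishing of a polynomial in the coefficients `a`: the resultant of the characteristic
polynomial and its derivative. -/
theorem exists_discriminant {κ : Type} [Fintype κ] (A : κ → Module.End ℂ V) :
    ∃ Q : MvPolynomial κ ℂ, ∀ a : κ → ℂ,
      MvPolynomial.eval a Q ≠ 0 ↔ SimpleSpectrum (∑ s, a s • A s) := by
  classical
  let b := Module.finBasis ℂ V
  -- the matrix of `∑ a_s A_s` with indeterminate coefficients `a_s`
  let M : Matrix (Fin (Module.finrank ℂ V)) (Fin (Module.finrank ℂ V)) (MvPolynomial κ ℂ) :=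
    ∑ s, (MvPolynomial.X s : MvPolynomial κ ℂ) •
      (LinearMap.toMatrix b b (A s)).map (MvPolynomial.C : ℂ →+* MvPolynomial κ ℂ)
  have hM : ∀ a : κ → ℂ, M.map (MvPolynomial.eval a) =
      LinearMap.toMatrix b b (∑ s, a s • A s) := by
    intro a
    ext i j
    simp only [M, Matrix.map_apply, Matrix.sum_apply, Matrix.smul_apply, smul_eq_mul, map_sum,
      map_mul, MvPolynomial.eval_X, MvPolynomial.eval_C, map_smul]
  refine ⟨M.charpoly.resultant M.charpoly.derivative M.charpoly.natDegree
    (M.charpoly.natDegree - 1), fun a => ?_⟩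
  have hch : M.charpoly.map (MvPolynomial.eval a) = (∑ s, a s • A s).charpoly := by
    rw [← Matrix.charpoly_map, hM, LinearMap.charpoly_toMatrix]
  have hd : (∑ s, a s • A s).charpoly.natDegree = M.charpoly.natDegree := by
    rw [← hch, (Matrix.charpoly_monic M).natDegree_map]
  have hne : (∑ s, a s • A s).charpoly ≠ 0 := (LinearMap.charpoly_monic _).ne_zero
  rw [← Polynomial.resultant_map_map, ← Polynomial.derivative_map, hch, ← hd,
    ← Polynomial.natDegree_derivative, ne_eq, Polynomial.resultant_eq_zero_iff]
  simp [hne, SimpleSpectrum, Polynomial.Separable]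

end SimpleSpectrum

/-! ### Branching of Specht modules -/

/-- The rows of `μ` whose last box is removable. -/
def corners (μ : YoungDiagram) : Finset ℕ :=
  (Finset.range (μ.colLen 0)).filter fun r => μ.rowLen (r + 1) < μ.rowLen r

theorem mem_corners {μ : YoungDiagram} {r : ℕ} :
    r ∈ corners μ ↔ μ.rowLen (r + 1) < μ.rowLen r := by
  rw [corners, Finset.mem_filter, Finset.mem_range, ← YoungDiagram.mem_iff_lt_colLen,
    YoungDiagram.mem_iff_lt_rowLen]
  omega

open Classical in
/-- The diagram `μ` with the last box of row `r` removed (`μ` itself if this box is not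
removable). -/
def removeBox (μ : YoungDiagram) (r : ℕ) : YoungDiagram :=
  if h : r ∈ corners μ then (exists_addsBox (mem_corners.1 h)).choose else μ

theorem addsBox_removeBox {μ : YoungDiagram} {r : ℕ} (h : r ∈ corners μ) :
    AddsBox (removeBox μ r) μ (r, μ.rowLen r - 1) := by
  rw [removeBox, dif_pos h]
  exact (exists_addsBox (mem_corners.1 h)).choose_spec

theorem card_removeBox {n : ℕ} {μ : YoungDiagram} (hμ : μ.card = n + 1) {r : ℕ}
    (h : r ∈ corners μ) : (removeBox μ r).card = n := by
  have := (addsBox_removeBox h).card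
  omega

theorem AddsBox.mem_corners {μ' μ : YoungDiagram} {c : ℕ × ℕ} (h : AddsBox μ' μ c) :
    c.1 ∈ corners μ := by
  rw [GaudinSymm.mem_corners, h.rowLen, h.rowLen, if_pos rfl, if_neg (by omega)]
  have := μ'.rowLen_anti c.1 (c.1 + 1) (by omega)
  omega

theorem youngDiagram_eq_of_rowLen {μ ν : YoungDiagram} (h : ∀ i, μ.rowLen i = ν.rowLen i) :
    μ = ν := by
  ext ⟨i, j⟩
  rw [YoungDiagram.mem_cells, YoungDiagram.mem_cells, YoungDiagram.mem_iff_lt_rowLen,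
    YoungDiagram.mem_iff_lt_rowLen, h]

/-- A nonzero vector of `W^μ` has its top component in `W^{μ'}`, where `μ'` is `μ` without the
last box of a row. -/
theorem exists_top_mem_specht {n : ℕ} {μ : YoungDiagram} (hμ : μ.card = n + 1)
    {v : TensorPow (n + 1)} (hv : v ∈ (specht (n + 1) μ).toSubmodule) (h0 : v ≠ 0) :
    ∃ r ∈ corners μ, headComp n r v ∈ (specht n (removeBox μ r)).toSubmodule ∧
      headComp n r v ≠ 0 ∧ ∀ j, r < j → headComp n j v = 0 := by
  obtain ⟨r, hr, hr'⟩ := exists_top h0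
  rw [specht_eq_sing hμ] at hv
  obtain ⟨μ', hadd, hs⟩ := exists_addsBox_of_top hv hr hr'
  have hc := hadd.mem_corners
  refine ⟨r, hc, ?_, hr, hr'⟩
  rw [specht_eq_sing (card_removeBox hμ hc)]
  have : μ' = removeBox μ r := youngDiagram_eq_of_rowLen fun i => by
    have h1 := hadd.rowLen i
    have h2 := (addsBox_removeBox hc).rowLen i
    dsimp only at h1 h2
    omega
  rwa [← this]

/-- Vectors of `W^μ` whose top components form bases of the modules `W^{μ'}` form a basis of
`W^μ`. -/
theorem specht_triangular {n : ℕ} {μ : YoungDiagram} (hμ : μ.card = n + 1) {ι : ℕ → Type}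
    [∀ r, Fintype (ι r)] (f : ∀ r, ι r → TensorPow n) (b : ∀ r, ι r → TensorPow (n + 1))
    (hf : ∀ r ∈ corners μ, LinearIndependent ℂ (f r))
    (hspan : ∀ r ∈ corners μ,
      Submodule.span ℂ (Set.range (f r)) = (specht n (removeBox μ r)).toSubmodule)
    (hb : ∀ r ∈ corners μ, ∀ a, b r a ∈ (specht (n + 1) μ).toSubmodule)
    (hb0 : ∀ r ∈ corners μ, ∀ a, ∀ j, r < j → headComp n j (b r a) = 0)
    (hb1 : ∀ r ∈ corners μ, ∀ a, headComp n r (b r a) = f r a) :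
    LinearIndependent ℂ (fun p : (r : corners μ) × ι r => b p.1 p.2) ∧
      Submodule.span ℂ (Set.range fun p : (r : corners μ) × ι r => b p.1 p.2) =
        (specht (n + 1) μ).toSubmodule := by
  classical
  constructor
  · rw [Fintype.linearIndependent_iff]
    intro g hg
    by_contra! hne
    obtain ⟨p, hp⟩ := hne
    let S : Finset ((r : corners μ) × ι r) := Finset.univ.filter fun p => g p ≠ 0
    obtain ⟨q, hq, hmax⟩ := Finset.exists_max_image S (fun p => (p.1 : ℕ))
      ⟨p, Finset.mem_filter.2 ⟨Finset.mem_univ _, hp⟩⟩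
    have hq' : g q ≠ 0 := (Finset.mem_filter.1 hq).2
    have h1 : ∑ a, g ⟨q.1, a⟩ • f q.1 a = 0 := by
      have h2 := congrArg (headComp n q.1) hg
      rw [map_sum, map_zero, Fintype.sum_sigma, Finset.sum_eq_single q.1] at h2
      · rw [← h2]
        exact Finset.sum_congr rfl fun a _ => by rw [map_smul, hb1 _ q.1.2]
      · intro r _ hr
        refine Finset.sum_eq_zero fun a _ => ?_
        by_cases hga : g ⟨r, a⟩ = 0
        · simp [hga]
        · have hle := hmax ⟨r, a⟩ (Finset.mem_filter.2 ⟨Finset.mem_univ _, hga⟩)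
          have hlt : (r : ℕ) < q.1 := lt_of_le_of_ne hle fun h => hr (Subtype.ext h)
          rw [map_smul, hb0 _ r.2 _ _ hlt, smul_zero]
      · simp
    exact hq' (Fintype.linearIndependent_iff.1 (hf _ q.1.2) (fun a => g ⟨q.1, a⟩) h1 q.2)
  · refine le_antisymm (Submodule.span_le.2 ?_) ?_
    · rintro _ ⟨p, rfl⟩
      exact hb _ p.1.2 _
    · have key : ∀ N, ∀ v ∈ (specht (n + 1) μ).toSubmodule, (∀ j, N ≤ j → headComp n j v = 0) →
          v ∈ Submodule.span ℂ (Set.range fun p : (r : corners μ) × ι r => b p.1 p.2) := by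
        intro N
        induction N using Nat.strong_induction_on with
        | _ N ih =>
          intro v hv hN
          by_cases h0 : v = 0
          · rw [h0]; exact Submodule.zero_mem _
          obtain ⟨r, hr, hmem, hne, hr'⟩ := exists_top_mem_specht hμ hv h0
          have hlift : headComp n r v ∈ (Submodule.span ℂ (Set.range (b r))).map
              (headComp n r) := by
            rw [Submodule.map_span, ← Set.range_comp]
            have : (headComp n r) ∘ b r = f r := funext fun a => hb1 r hr a
            rw [this, hspan r hr]
            exact hmem
          obtain ⟨x, hx, hxv⟩ := hlift
          have hxb : x ∈ Submodule.span ℂ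
              (Set.range fun p : (r : corners μ) × ι r => b p.1 p.2) := by
            refine Submodule.span_mono ?_ hx
            rintro _ ⟨a, rfl⟩
            exact ⟨⟨⟨r, hr⟩, a⟩, rfl⟩
          have hxW : x ∈ (specht (n + 1) μ).toSubmodule := by
            refine Submodule.span_le.2 ?_ hx
            rintro _ ⟨a, rfl⟩
            exact hb r hr a
          have hx0 : ∀ j, r < j → headComp n j x = 0 := fun j hj => by
            have : Submodule.span ℂ (Set.range (b r)) ≤ LinearMap.ker (headComp n j) := by
              refine Submodule.span_le.2 ?_
              rintro _ ⟨a, rfl⟩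
              exact hb0 r hr a j hj
            exact this hx
          have hrN : r < N := by
            by_contra hlt
            exact hne (hN r (by omega))
          have := ih r hrN (v - x) (Submodule.sub_mem _ hv hxW) fun j hj => by
            rw [map_sub]
            rcases hj.eq_or_lt with rfl | hj
            · rw [hxv, sub_self]
            · rw [hr' j hj, hx0 j hj, sub_self]
          simpa using Submodule.add_mem _ this hxb
      intro v hv
      by_cases h0 : v = 0
      · rw [h0]; exact Submodule.zero_mem _
      obtain ⟨r, -, hr⟩ := exists_top h0
      exact key (r + 1) v hv fun j hj => hr j hj

instance finiteDimensional_specht (n : ℕ) (μ : YoungDiagram) :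
    FiniteDimensional ℂ (specht n μ).toSubmodule :=
  FiniteDimensional.span_of_finite ℂ (Set.finite_range _)

theorem finite_youngDiagram (n : ℕ) : Finite {μ : YoungDiagram // μ.card = n} := by
  classical
  refine Finite.of_injective (β := (Finset.range n ×ˢ Finset.range n).powerset)
    (fun μ => ⟨μ.1.cells, ?_⟩) fun μ ν h => ?_
  · rw [Finset.mem_powerset]
    rintro ⟨i, j⟩ hc
    have h1 : (Finset.range (i + 1)) ×ˢ (Finset.range (j + 1)) ⊆ μ.1.cells := by
      rintro ⟨a, b⟩ hab
      simp only [Finset.mem_product, Finset.mem_range] at hab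
      exact μ.1.isLowerSet (show ((a, b) : ℕ × ℕ) ≤ (i, j) from
        ⟨Nat.lt_succ_iff.1 hab.1, Nat.lt_succ_iff.1 hab.2⟩) hc
    have h2 := Finset.card_le_card h1
    rw [Finset.card_product, Finset.card_range, Finset.card_range] at h2
    have h3 : μ.1.cells.card = n := μ.2
    rw [h3] at h2
    rw [Finset.mem_product, Finset.mem_range, Finset.mem_range]
    constructor
    · nlinarith
    · nlinarith
  · have : μ.1.cells = ν.1.cells := congrArg Subtype.val h
    exact Subtype.ext (YoungDiagram.ext this)

theorem exists_linearIndependent_span_eq {V : Type} [AddCommGroup V] [Module ℂ V]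
    (W : Submodule ℂ V) [FiniteDimensional ℂ W] : ∃ f : Fin (Module.finrank ℂ W) → V,
      LinearIndependent ℂ f ∧ Submodule.span ℂ (Set.range f) = W := by
  let β := Module.finBasis ℂ W
  refine ⟨fun a => β a, β.linearIndependent.map' W.subtype W.ker_subtype, ?_⟩
  have : Set.range (fun a => (β a : V)) = W.subtype '' Set.range β := by
    rw [← Set.range_comp]; rfl
  rw [this, ← Submodule.map_span, β.span_eq, Submodule.map_subtype_top]

/-- Families of vectors of the smaller Specht modules lift simultaneously to vectors of `W^μ`
with these top components. -/
theorem exists_lift_family {n : ℕ} (μ : YoungDiagram) {ι : ℕ → Type} (f : ∀ r, ι r → TensorPow n)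
    (hf : ∀ r a, f r a ∈ (specht n (removeBox μ r)).toSubmodule) :
    ∃ b : ∀ r, ι r → TensorPow (n + 1), ∀ r ∈ corners μ, ∀ a,
      b r a ∈ (specht (n + 1) μ).toSubmodule ∧ (∀ j, r < j → headComp n j (b r a) = 0) ∧
        headComp n r (b r a) = f r a := by
  have hlift : ∀ r, ∀ a, ∃ x : TensorPow (n + 1), r ∈ corners μ →
      x ∈ (specht (n + 1) μ).toSubmodule ∧ (∀ j, r < j → headComp n j x = 0) ∧
        headComp n r x = f r a := by
    intro r a
    by_cases hr : r ∈ corners μ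
    · obtain ⟨x, h1, h2, h3⟩ := (addsBox_removeBox hr).exists_lift (hf r a)
      exact ⟨x, fun _ => ⟨h1, h2, h3⟩⟩
    · exact ⟨0, fun h => absurd h hr⟩
  choose b hb using hlift
  exact ⟨b, fun r hr a => hb r a hr⟩

/-- A basis of every `W^{μ'}` lifts to a basis of `W^μ`; in particular dimensions add up. -/
theorem finrank_specht_succ {n : ℕ} {μ : YoungDiagram} (hμ : μ.card = n + 1) :
    Module.finrank ℂ (specht (n + 1) μ).toSubmodule =
      ∑ r ∈ corners μ, Module.finrank ℂ (specht n (removeBox μ r)).toSubmodule := by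
  classical
  choose f hf hspan using
    fun r => exists_linearIndependent_span_eq (specht n (removeBox μ r)).toSubmodule
  obtain ⟨b, hb⟩ := exists_lift_family μ f
    fun r a => by rw [← hspan r]; exact Submodule.subset_span ⟨a, rfl⟩
  obtain ⟨hli, hsp⟩ := specht_triangular hμ f b (fun r _ => hf r) (fun r _ => hspan r)
    (fun r hr a => (hb r hr a).1) (fun r hr a => (hb r hr a).2.1) (fun r hr a => (hb r hr a).2.2)
  rw [← hsp, finrank_span_eq_card hli, Fintype.card_sigma]
  simp only [Fintype.card_fin]
  exact Finset.sum_coe_sort (corners μ)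
    fun r => Module.finrank ℂ (specht n (removeBox μ r)).toSubmodule

/-! ### The operators `θ_i` commute -/

theorem theta_eq_sum {n : ℕ} (z : Fin n → ℂ) (i : Fin n) :
    theta z i = ∑ j, (z i - z j)⁻¹ • MonoidAlgebra.of ℂ (Equiv.Perm (Fin n)) (Equiv.swap i j) := by
  rw [theta, Finset.sum_erase]
  simp

/-- The elements `θ_i` commute: the commutators of transpositions with three different indices
`i, j, c` in total cancel because of the partial fraction identity
`1/((z_i-z_j)(z_j-z_c)) + 1/((z_j-z_c)(z_c-z_i)) + 1/((z_c-z_i)(z_i-z_j)) = 0`. -/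
theorem theta_comm {n : ℕ} {z : Fin n → ℂ} (hz : Function.Injective z) (i j : Fin n) :
    theta z i * theta z j = theta z j * theta z i := by
  classical
  rcases eq_or_ne i j with rfl | hij
  · rfl
  rw [← sub_eq_zero, theta_eq_sum, theta_eq_sum]
  let s : Fin n → Fin n → MonoidAlgebra ℂ (Equiv.Perm (Fin n)) := fun a b =>
    MonoidAlgebra.of ℂ (Equiv.Perm (Fin n)) (Equiv.swap a b)
  let x : Fin n → Fin n → ℂ := fun a b => (z a - z b)⁻¹
  let T : Fin n → Fin n → MonoidAlgebra ℂ (Equiv.Perm (Fin n)) := fun a b =>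
    (x i a * x j b) • (s i a * s j b - s j b * s i a)
  have hconj : ∀ a b c d : Fin n, s a b * s c d =
      s (Equiv.swap a b c) (Equiv.swap a b d) * s a b := by
    intro a b c d
    simp only [s, ← map_mul]
    rw [Equiv.mul_swap_eq_swap_mul]
  have hsymm : ∀ a b, s a b = s b a := fun a b => by simp only [s, Equiv.swap_comm]
  have hTi : ∀ b, T i b = 0 := fun b => by simp [T, x]
  have hTj : ∀ a, T a j = 0 := fun a => by simp [T, x]
  have hTji : T j i = 0 := by
    simp only [T]
    rw [hsymm i j, sub_self, smul_zero]
  -- the transpositions `(i a)` and `(j b)` commute unless `a = b`, `b = i` or `a = j`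
  have hT : ∀ a b, T a b = (if a = b then T a a else 0) + (if b = i then T a i else 0) +
      (if a = j then T j b else 0) := by
    intro a b
    rcases eq_or_ne a i with rfl | hai
    · simp [hTi, hij]
    rcases eq_or_ne b j with rfl | hbj
    · by_cases h : a = b
      · subst h; simp [hTj, hij.symm]
      · simp [h, hTj, hij.symm]
    rcases eq_or_ne b i with rfl | hbi
    · by_cases h : a = j
      · subst h; simp [hTji, hai]
      · simp [h, hai]
    rcases eq_or_ne a j with rfl | haj
    · simp [hbi, Ne.symm hbj]
    rcases eq_or_ne a b with rfl | hab
    · simp [hbi, haj]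
    · have : s i a * s j b = s j b * s i a := by
        rw [hconj, Equiv.swap_apply_of_ne_of_ne hij.symm haj.symm,
          Equiv.swap_apply_of_ne_of_ne hbi hab.symm]
      simp [hbi, hab, haj, T, this]
  have hsum : ∀ c, T c c + T c i + T j c = 0 := by
    intro c
    rcases eq_or_ne c i with rfl | hci
    · simp [hTi, hTji]
    rcases eq_or_ne c j with rfl | hcj
    · simp [hTj, hTji]
    have e1 : s i c * s j c = s i j * s i c := by
      rw [hconj, Equiv.swap_apply_of_ne_of_ne hij.symm hcj.symm, Equiv.swap_apply_right,
        hsymm j i]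
    have e2 : s i j * s j c = s i c * s i j := by
      rw [hconj, Equiv.swap_apply_right, Equiv.swap_apply_of_ne_of_ne hci hcj]
    have e3 : s j c * s i c = s i c * s i j := by
      rw [hconj, Equiv.swap_apply_of_ne_of_ne hij hci.symm, Equiv.swap_apply_right, e2]
    have e4 : s j c * s i j = s i j * s i c := by
      rw [hconj, Equiv.swap_apply_of_ne_of_ne hij hci.symm, Equiv.swap_apply_left, e1]
    have hcoef : - (x i c * x j c) + x i c * x j i + x i j * x j c = 0 := by
      have h1 : z i - z c ≠ 0 := sub_ne_zero.2 fun h => hci (hz h).symm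
      have h2 : z j - z c ≠ 0 := sub_ne_zero.2 fun h => hcj (hz h).symm
      have h3 : z i - z j ≠ 0 := sub_ne_zero.2 fun h => hij (hz h)
      have h4 : z j - z i ≠ 0 := sub_ne_zero.2 fun h => hij (hz h).symm
      simp only [x]
      rw [← neg_sub (z i) (z j), inv_neg]
      field_simp
      ring
    simp only [T]
    rw [e1, e2, e3, e4, hsymm j i, ← neg_sub (s i c * s i j), smul_neg, ← neg_smul, ← add_smul,
      ← add_smul, hcoef, zero_smul]
  calc _ = ∑ a, ∑ b, T a b := by
        rw [Finset.sum_mul_sum, Finset.sum_mul_sum, Finset.sum_comm (f := fun a b =>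
          (z j - z a)⁻¹ • (MonoidAlgebra.of ℂ (Equiv.Perm (Fin n))) (Equiv.swap j a) * _),
          ← Finset.sum_sub_distrib]
        refine Finset.sum_congr rfl fun a _ => ?_
        rw [← Finset.sum_sub_distrib]
        refine Finset.sum_congr rfl fun b _ => ?_
        simp only [T, s, x]
        rw [smul_mul_smul_comm, smul_mul_smul_comm, smul_sub, mul_comm (z j - z b)⁻¹]
    _ = ∑ c, (T c c + T c i + T j c) := by
        rw [Finset.sum_congr rfl fun a _ => Finset.sum_congr rfl fun b _ => hT a b]
        simp only [Finset.sum_add_distrib]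
        congr 1
        · simp
        · rw [Finset.sum_comm]
          simp
    _ = 0 := Finset.sum_eq_zero fun c _ => hsum c

theorem thetaOp_comm {n : ℕ} {z : Fin n → ℂ} (hz : Function.Injective z) (μ : YoungDiagram)
    (i j : Fin n) : thetaOp z μ i * thetaOp z μ j = thetaOp z μ j * thetaOp z μ i := by
  rw [thetaOp, thetaOp, ← map_mul, theta_comm hz, map_mul]

/-! ### Simplicity of the spectrum -/

/-- The operator `∑_{i,j} a_{ij} s_{ij}` on `V^{⊗ n}`. -/
def swapComb {n : ℕ} (a : Fin n × Fin n → ℂ) : TensorPow n →ₗ[ℂ] TensorPow n :=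
  ∑ s, a s • tensorRep n (Equiv.swap s.1 s.2)

/-- The operator `∑_{i,j} a_{ij} s_{ij}` on the Specht module `W^μ`. -/
def swapOp {n : ℕ} (μ : YoungDiagram) (a : Fin n × Fin n → ℂ) :
    Module.End ℂ (specht n μ).toSubmodule :=
  ∑ s, a s • (specht n μ).toRepresentation (Equiv.swap s.1 s.2)

theorem tensorRep_apply {n : ℕ} (σ : Equiv.Perm (Fin n)) (v : TensorPow n) (w : Fin n → ℕ) :
    tensorRep n σ v w = v (w ∘ σ) := by
  have hinj : Function.Injective (fun r : Fin n → ℕ => r ∘ σ.symm) :=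
    σ.symm.surjective.injective_comp_right
  have h : w = (fun r : Fin n → ℕ => r ∘ σ.symm) (w ∘ σ) := by
    funext k; simp
  conv_lhs => rw [h]
  exact Finsupp.mapDomain_apply hinj v (w ∘ σ)

theorem swapComb_apply {n : ℕ} (a : Fin n × Fin n → ℂ) (v : TensorPow n) (w : Fin n → ℕ) :
    swapComb a v w = ∑ s, a s * v (w ∘ Equiv.swap s.1 s.2) := by
  simp [swapComb, LinearMap.sum_apply, Finsupp.finsetSum_apply, tensorRep_apply]

theorem coe_swapOp {n : ℕ} (μ : YoungDiagram) (a : Fin n × Fin n → ℂ)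
    (v : (specht n μ).toSubmodule) : ((swapOp μ a v : (specht n μ).toSubmodule) : TensorPow n) =
      swapComb a v := by
  simp only [swapOp, swapComb, LinearMap.sum_apply, AddSubmonoidClass.coe_finsetSum]
  rfl

/-- The coefficients of `∑_i c_i θ_i` with respect to the transpositions. -/
def gaudinCoeff {n : ℕ} (z c : Fin n → ℂ) : Fin n × Fin n → ℂ :=
  fun s => c s.1 * (z s.1 - z s.2)⁻¹

theorem swapOp_gaudinCoeff {n : ℕ} (μ : YoungDiagram) (z c : Fin n → ℂ) :
    swapOp μ (gaudinCoeff z c) = ∑ i, c i • thetaOp z μ i := by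
  rw [swapOp, Fintype.sum_prod_type]
  refine Finset.sum_congr rfl fun i _ => ?_
  rw [thetaOp, theta_eq_sum, map_sum, Finset.smul_sum]
  refine Finset.sum_congr rfl fun j _ => ?_
  rw [map_smul, Representation.asAlgebraHom_of, smul_smul]
  rfl

/-- The Jucys–Murphy element `∑_k s_{0k}` acts on the top component of a singular vector by the
content of the removed box. -/
theorem sum_swap_zero_of_top {n : ℕ} {lam : ℕ → ℕ} {v : TensorPow (n + 1)}
    (hv : v ∈ sing (n + 1) lam) {r : ℕ} (hr : ∀ j, r < j → headComp n j v = 0) (w : Fin n → ℕ) :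
    ∑ k : Fin n, v ((Fin.cons r w : Fin (n + 1) → ℕ) ∘ Equiv.swap 0 k.succ) =
      ((lam r : ℂ) - 1 - r) * v (Fin.cons r w) := by
  classical
  have hcomp : ∀ k : Fin n, (Fin.cons r w : Fin (n + 1) → ℕ) ∘ Equiv.swap 0 k.succ =
      Fin.cons (w k) (Function.update w k r) := by
    intro k
    funext l
    refine Fin.cases ?_ (fun l => ?_) l
    · simp
    · rcases eq_or_ne l k with rfl | hlk
      · simp
      · rw [Function.comp_apply, Equiv.swap_apply_of_ne_of_ne (Fin.succ_ne_zero l)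
          (fun h => hlk (Fin.succ_injective n h))]
        simp [hlk]
  simp only [hcomp]
  have hle : ∑ k : Fin n, v (Fin.cons (w k) (Function.update w k r)) =
      ∑ k ∈ Finset.univ.filter (fun k => w k ≤ r),
        v (Fin.cons (w k) (Function.update w k r)) := by
    symm
    refine Finset.sum_subset (Finset.filter_subset _ _) fun k _ hk => ?_
    have hk' : r < w k := by simpa using hk
    exact DFunLike.congr_fun (hr _ hk') _
  rw [hle, ← Finset.sum_fiberwise_of_maps_to (t := Finset.range (r + 1)) (g := w)
    (fun k hk => by have := (Finset.mem_filter.1 hk).2; simp; omega), Finset.sum_range_succ]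
  have hlt : ∀ j ∈ Finset.range r, (∑ k ∈ (Finset.univ.filter fun k => w k ≤ r).filter
      (fun k => w k = j), v (Fin.cons (w k) (Function.update w k r))) = - v (Fin.cons r w) := by
    intro j hj
    have hj' := Finset.mem_range.1 hj
    have := (hv.2 j r hj').cons j w
    rw [if_pos rfl] at this
    rw [eq_neg_iff_add_eq_zero, add_comm, ← this]
    congr 1
    refine Finset.sum_congr ?_ fun k hk => ?_
    · ext k; simp; omega
    · rw [(Finset.mem_filter.1 hk).2]
  have heq : (∑ k ∈ (Finset.univ.filter fun k => w k ≤ r).filter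
      (fun k => w k = r), v (Fin.cons (w k) (Function.update w k r))) =
      ((lam r : ℂ) - 1) * v (Fin.cons r w) := by
    have h1 : ∀ k ∈ (Finset.univ.filter fun k => w k ≤ r).filter (fun k => w k = r),
        v (Fin.cons (w k) (Function.update w k r)) = v (Fin.cons r w) := by
      intro k hk
      have := (Finset.mem_filter.1 hk).2
      rw [← this, Function.update_eq_self]
    rw [Finset.sum_congr rfl h1, Finset.sum_const, nsmul_eq_mul]
    by_cases h0 : v (Fin.cons r w) = 0
    · simp [h0]
    · have hc := hv.1 _ h0 r
      rw [filter_cons_card, if_pos rfl] at hc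
      have : ((Finset.univ.filter fun k => w k ≤ r).filter (fun k => w k = r)) =
          Finset.univ.filter fun k => w k = r := by
        ext k; simp; omega
      rw [this, ← hc]
      push_cast
      ring
  rw [Finset.sum_congr rfl hlt, heq, Finset.sum_const, Finset.card_range, nsmul_eq_mul]
  ring

/-- The limit, as `u → ∞`, of the coefficients of `M u θ_0 + ∑_i c_i θ_{i+1}` at the point
`(u, z)`, where `a` are the coefficients of `∑_i c_i θ_i` at `z`. -/
def limitCoeff {n : ℕ} (M : ℂ) (a : Fin n × Fin n → ℂ) : Fin (n + 1) × Fin (n + 1) → ℂ :=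
  fun s => (Fin.cases (Fin.cases 0 (fun _ => M) s.2)
    (fun i => Fin.cases 0 (fun j => a (i, j)) s.2) s.1 : ℂ)

/-- On the top component the limit operator acts as the operator for `n` points, shifted by `M`
times the content of the removed box. -/
theorem headComp_swapComb {n : ℕ} {lam : ℕ → ℕ} {v : TensorPow (n + 1)}
    (hv : v ∈ sing (n + 1) lam) {r : ℕ} (hr : ∀ j, r < j → headComp n j v = 0) (M : ℂ)
    (a : Fin n × Fin n → ℂ) : headComp n r (swapComb (limitCoeff M a) v) =
      swapComb a (headComp n r v) + (M * ((lam r : ℂ) - 1 - r)) • headComp n r v := by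
  ext w
  have hcomp : ∀ i j : Fin n, (Fin.cons r w : Fin (n + 1) → ℕ) ∘ Equiv.swap i.succ j.succ =
      Fin.cons r (w ∘ Equiv.swap i j) := by
    intro i j
    funext l
    refine Fin.cases ?_ (fun l => ?_) l
    · rw [Function.comp_apply, Equiv.swap_apply_of_ne_of_ne (Fin.succ_ne_zero i).symm
        (Fin.succ_ne_zero j).symm]
      simp
    · have : Equiv.swap i.succ j.succ l.succ = (Equiv.swap i j l).succ :=
        ((Fin.succ_injective n).map_swap _ _ _).symm
      simp [this]
  rw [headComp_apply, swapComb_apply, Finsupp.add_apply, Finsupp.smul_apply, swapComb_apply,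
    headComp_apply, smul_eq_mul, mul_assoc, ← sum_swap_zero_of_top hv hr w, Fintype.sum_prod_type,
    Fintype.sum_prod_type, Fin.sum_univ_succ, Fin.sum_univ_succ, Finset.mul_sum, add_comm]
  congr 1
  · refine Finset.sum_congr rfl fun i _ => ?_
    rw [Fin.sum_univ_succ]
    simp [limitCoeff, hcomp]
  · simp [limitCoeff]

/-- The component of `W^μ` at a removable row lies in the smaller Specht module. -/
theorem headComp_mem_specht {n : ℕ} {μ : YoungDiagram} (hμ : μ.card = n + 1)
    {v : TensorPow (n + 1)} (hv : v ∈ (specht (n + 1) μ).toSubmodule) {r : ℕ}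
    (hr : r ∈ corners μ) (hv0 : ∀ j, r < j → headComp n j v = 0) :
    headComp n r v ∈ (specht n (removeBox μ r)).toSubmodule := by
  rw [specht_eq_sing hμ] at hv
  rw [specht_eq_sing (card_removeBox hμ hr)]
  have : (removeBox μ r).rowLen = (fun i => μ.rowLen i - if r = i then 1 else 0) := by
    funext i
    have := (addsBox_removeBox hr).rowLen i
    dsimp only at this
    omega
  rw [this]
  exact headComp_mem_sing hv hv0

theorem swapComb_mem_specht {n : ℕ} {μ : YoungDiagram} (a : Fin n × Fin n → ℂ) {v : TensorPow n}
    (hv : v ∈ (specht n μ).toSubmodule) : swapComb a v ∈ (specht n μ).toSubmodule := by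
  rw [← coe_swapOp μ a ⟨v, hv⟩]
  exact (swapOp μ a ⟨v, hv⟩).2

/-- An operator that preserves a finite-dimensional subspace and is injective on it maps the
subspace onto itself. -/
theorem exists_mem_apply_eq_of_injOn {V : Type} [AddCommGroup V] [Module ℂ V] (D : V →ₗ[ℂ] V)
    {F : Submodule ℂ V} [FiniteDimensional ℂ F] (hDF : ∀ v ∈ F, D v ∈ F)
    (hinj : ∀ v ∈ F, D v = 0 → v = 0) {x : V} (hx : x ∈ F) : ∃ y ∈ F, D y = x := by
  have hi : Function.Injective (D.restrict hDF) := by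
    rw [← LinearMap.ker_eq_bot, LinearMap.ker_eq_bot']
    rintro ⟨v, hv⟩ h0
    exact Subtype.ext (hinj v hv (congrArg Subtype.val h0))
  obtain ⟨⟨y, hy⟩, hyx⟩ := LinearMap.surjective_of_injective hi ⟨x, hx⟩
  exact ⟨y, hy, congrArg Subtype.val hyx⟩

/-- Every eigenvalue on `W^{μ'}` contributes an eigenvalue on `W^μ`, shifted by a multiple of the
content of the removed box: otherwise the limit operator minus this number would be bijective on
the vectors whose letters at position `0` are at most `r`, hence surjective on `W^{μ'}`. -/
theorem hasEigenvalue_limitCoeff {n : ℕ} {μ : YoungDiagram} (hμ : μ.card = n + 1) (M : ℂ)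
    (a : Fin n × Fin n → ℂ) {r : ℕ} (hr : r ∈ corners μ) {κ : Type} {e : κ → ℂ}
    (b : Module.Basis κ ℂ (specht n (removeBox μ r)).toSubmodule)
    (hb : ∀ k, swapOp (removeBox μ r) a (b k) = e k • b k) (k : κ) :
    Module.End.HasEigenvalue (M := (specht (n + 1) μ).toSubmodule) (swapOp μ (limitCoeff M a))
      (e k + M * ((μ.rowLen r : ℂ) - 1 - r)) := by
  classical
  by_contra hno
  set ev := e k + M * ((μ.rowLen r : ℂ) - 1 - r) with hev
  let D : TensorPow (n + 1) →ₗ[ℂ] TensorPow (n + 1) :=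
    swapComb (limitCoeff M a) - ev • LinearMap.id
  let F : Submodule ℂ (TensorPow (n + 1)) := (specht (n + 1) μ).toSubmodule ⊓
    ⨅ j : {j // r < j}, LinearMap.ker (headComp n j)
  have hF : ∀ v, v ∈ F ↔ v ∈ (specht (n + 1) μ).toSubmodule ∧
      ∀ j, r < j → headComp n j v = 0 := by
    intro v
    simp [F, Submodule.mem_inf, Submodule.mem_iInf]
  have hDF : ∀ v ∈ F, D v ∈ F := by
    intro v hv
    obtain ⟨h1, h2⟩ := (hF v).1 hv
    have h1' := h1
    rw [specht_eq_sing hμ] at h1'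
    refine (hF _).2 ⟨Submodule.sub_mem _ (swapComb_mem_specht _ h1) (Submodule.smul_mem _ _ h1),
      fun j hj => ?_⟩
    simp only [D, LinearMap.sub_apply, map_sub, LinearMap.smul_apply, map_smul, LinearMap.id_apply]
    rw [headComp_swapComb h1' (fun l hl => h2 l (hj.trans hl)), h2 j hj]
    simp
  have hinj : ∀ v ∈ F, D v = 0 → v = 0 := by
    intro v hv h0
    by_contra hne
    have hvW := ((hF v).1 hv).1
    refine hno (Module.End.hasEigenvalue_of_hasEigenvector (x := ⟨v, hvW⟩) ⟨?_, ?_⟩)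
    · rw [Module.End.mem_eigenspace_iff]
      refine Subtype.ext ?_
      rw [coe_swapOp]
      exact sub_eq_zero.1 h0
    · exact fun h => hne (congrArg Subtype.val h)
  have : FiniteDimensional ℂ F := Submodule.finiteDimensional_of_le inf_le_left
  obtain ⟨x, hx1, hx2, hx3⟩ := (addsBox_removeBox hr).exists_lift (b k).2
  obtain ⟨y, hy, hyx'⟩ := exists_mem_apply_eq_of_injOn D hDF hinj ((hF x).2 ⟨hx1, hx2⟩)
  obtain ⟨hy1, hy2⟩ := (hF y).1 hy
  have hy1' := hy1
  rw [specht_eq_sing hμ] at hy1'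
  let y' : (specht n (removeBox μ r)).toSubmodule :=
    ⟨headComp n r y, headComp_mem_specht hμ hy1 hr hy2⟩
  have hkey : swapOp (removeBox μ r) a y' - e k • y' = b k := by
    refine Subtype.ext ?_
    rw [← hx3]
    simp only
    rw [← hyx', AddSubgroupClass.coe_sub, coe_swapOp]
    simp only [D, LinearMap.sub_apply, map_sub, LinearMap.smul_apply, map_smul, LinearMap.id_apply]
    rw [headComp_swapComb hy1' hy2, hev]
    change swapComb a (headComp n r y) - e k • headComp n r y = _
    rw [add_smul]
    abel
  exact apply_sub_smul_ne_of_eigenbasis b hb y' k hkey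

/-! ### Rational functions -/

/-- The function `φ` is given on the set `U` by a rational function whose denominator has no zeros
there. -/
def RationalOn {Y : Type} (U : Set (Y → ℂ)) (φ : (Y → ℂ) → ℂ) : Prop :=
  ∃ p q : MvPolynomial Y ℂ, ∀ y ∈ U, MvPolynomial.eval y q ≠ 0 ∧
    φ y * MvPolynomial.eval y q = MvPolynomial.eval y p

namespace RationalOn

variable {Y : Type} {U : Set (Y → ℂ)} {φ ψ : (Y → ℂ) → ℂ}

theorem polynomial (p : MvPolynomial Y ℂ) : RationalOn U fun y => MvPolynomial.eval y p :=
  ⟨p, 1, fun y _ => by simp⟩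

theorem const (c : ℂ) : RationalOn U fun _ => c := by
  simpa using polynomial (U := U) (MvPolynomial.C c)

theorem coord (i : Y) : RationalOn U fun y => y i := by
  simpa using polynomial (U := U) (MvPolynomial.X i)

theorem add (hφ : RationalOn U φ) (hψ : RationalOn U ψ) : RationalOn U fun y => φ y + ψ y := by
  obtain ⟨p, q, h⟩ := hφ
  obtain ⟨p', q', h'⟩ := hψ
  refine ⟨p * q' + p' * q, q * q', fun y hy => ⟨?_, ?_⟩⟩
  · simpa using ⟨(h y hy).1, (h' y hy).1⟩
  · have e1 := (h y hy).2
    have e2 := (h' y hy).2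
    simp only [map_add, map_mul]
    rw [← e1, ← e2]
    ring

theorem mul (hφ : RationalOn U φ) (hψ : RationalOn U ψ) : RationalOn U fun y => φ y * ψ y := by
  obtain ⟨p, q, h⟩ := hφ
  obtain ⟨p', q', h'⟩ := hψ
  refine ⟨p * p', q * q', fun y hy => ⟨?_, ?_⟩⟩
  · simpa using ⟨(h y hy).1, (h' y hy).1⟩
  · have e1 := (h y hy).2
    have e2 := (h' y hy).2
    simp only [map_mul]
    rw [← e1, ← e2]
    ring

theorem sub (hφ : RationalOn U φ) (hψ : RationalOn U ψ) : RationalOn U fun y => φ y - ψ y := by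
  have := hφ.add ((const (U := U) (-1)).mul hψ)
  simpa [sub_eq_add_neg] using this

theorem inv (hφ : RationalOn U φ) (h0 : ∀ y ∈ U, φ y ≠ 0) : RationalOn U fun y => (φ y)⁻¹ := by
  obtain ⟨p, q, h⟩ := hφ
  refine ⟨q, p, fun y hy => ?_⟩
  obtain ⟨h1, h2⟩ := h y hy
  rw [← h2]
  refine ⟨mul_ne_zero (h0 y hy) h1, ?_⟩
  rw [inv_mul_cancel_left₀ (h0 y hy)]

theorem sum {ι : Type} {s : Finset ι} {f : ι → (Y → ℂ) → ℂ} (h : ∀ i ∈ s, RationalOn U (f i)) :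
    RationalOn U fun y => ∑ i ∈ s, f i y := by
  classical
  induction s using Finset.induction_on with
  | empty => simpa using const (U := U) 0
  | insert a s ha ih =>
    simp only [Finset.sum_insert ha]
    exact (h a (Finset.mem_insert_self _ _)).add
      (ih fun i hi => h i (Finset.mem_insert_of_mem hi))

theorem prod {ι : Type} {s : Finset ι} {f : ι → (Y → ℂ) → ℂ} (h : ∀ i ∈ s, RationalOn U (f i)) :
    RationalOn U fun y => ∏ i ∈ s, f i y := by
  classical
  induction s using Finset.induction_on with
  | empty => simpa using const (U := U) 1
  | insert a s ha ih =>
    simp only [Finset.prod_insert ha]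
    exact (h a (Finset.mem_insert_self _ _)).mul
      (ih fun i hi => h i (Finset.mem_insert_of_mem hi))

theorem eval {κ : Type} {f : κ → (Y → ℂ) → ℂ} (h : ∀ i, RationalOn U (f i))
    (Q : MvPolynomial κ ℂ) : RationalOn U fun y => MvPolynomial.eval (fun i => f i y) Q := by
  induction Q using MvPolynomial.induction_on with
  | C a => simpa using const (U := U) a
  | add p q hp hq => simpa using hp.add hq
  | mul_X p i hp => simpa using hp.mul (h i)

theorem det {ι : Type} [Fintype ι] [DecidableEq ι] {M : (Y → ℂ) → Matrix ι ι ℂ}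
    (h : ∀ i j, RationalOn U fun y => M y i j) : RationalOn U fun y => (M y).det := by
  simp only [Matrix.det_apply']
  exact sum fun σ _ => (const _).mul (prod fun i _ => h _ _)

end RationalOn

/-! ### Genericity of the simple spectrum -/

theorem tendsto_inv_ofReal_sub (c : ℂ) :
    Filter.Tendsto (fun u : ℝ => ((u : ℂ) - c)⁻¹) Filter.atTop (nhds 0) := by
  refine Filter.Tendsto.comp Filter.tendsto_inv₀_cobounded ?_
  rw [← tendsto_norm_atTop_iff_cobounded]
  refine Filter.tendsto_atTop_mono (f := fun u : ℝ => u - ‖c‖) (fun u => ?_)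
    (Filter.tendsto_atTop_add_const_right _ _ Filter.tendsto_id)
  have h1 := norm_sub_norm_le (u : ℂ) c
  have h2 : u ≤ ‖(u : ℂ)‖ := by
    rw [Complex.norm_real]; exact le_abs_self u
  linarith

theorem tendsto_mul_inv_ofReal_sub (c : ℂ) :
    Filter.Tendsto (fun u : ℝ => (u : ℂ) * ((u : ℂ) - c)⁻¹) Filter.atTop (nhds 1) := by
  have h1 : Filter.Tendsto (fun u : ℝ => 1 + c * ((u : ℂ) - c)⁻¹) Filter.atTop (nhds (1 + c * 0)) :=
    tendsto_const_nhds.add (tendsto_const_nhds.mul (tendsto_inv_ofReal_sub c))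
  rw [mul_zero, add_zero] at h1
  refine h1.congr' ?_
  filter_upwards [Filter.eventually_gt_atTop ‖c‖] with u hu
  have hne : (u : ℂ) - c ≠ 0 := by
    intro h
    rw [sub_eq_zero] at h
    rw [← h, Complex.norm_real] at hu
    exact absurd (le_abs_self u) (not_le.2 hu)
  field_simp
  ring

theorem eventually_injective_cons {n : ℕ} {z : Fin n → ℂ} (hz : Function.Injective z) :
    ∀ᶠ u : ℝ in Filter.atTop, Function.Injective (Fin.cons (u : ℂ) z : Fin (n + 1) → ℂ) := by
  have h : ∀ k, ∀ᶠ u : ℝ in Filter.atTop, (u : ℂ) ≠ z k := fun k => by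
    filter_upwards [Filter.eventually_gt_atTop ‖z k‖] with u hu h
    rw [← h, Complex.norm_real] at hu
    exact absurd (le_abs_self u) (not_le.2 hu)
  filter_upwards [Filter.eventually_all.2 h] with u hu
  rw [Fin.cons_injective_iff]
  exact ⟨fun ⟨k, hk⟩ => hu k hk.symm, hz⟩

/-- The coefficient of `θ_0` is `M u`, because `θ_0` at the point `(u, z)` is `u⁻¹ ∑_k s_{0k}` to
the leading order. -/
theorem tendsto_gaudinCoeff_cons {n : ℕ} (z c : Fin n → ℂ) (M : ℂ) :
    Filter.Tendsto (fun u : ℝ => gaudinCoeff (Fin.cons (u : ℂ) z : Fin (n + 1) → ℂ)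
      (Fin.cons (M * u) c)) Filter.atTop (nhds (limitCoeff M (gaudinCoeff z c))) := by
  rw [tendsto_pi_nhds]
  rintro ⟨i, j⟩
  refine Fin.cases ?_ (fun i => ?_) i <;> refine Fin.cases ?_ (fun j => ?_) j
  · simp [gaudinCoeff, limitCoeff]
  · simp only [gaudinCoeff, limitCoeff, Fin.cons_zero, Fin.cons_succ, Fin.cases_zero,
      Fin.cases_succ, mul_assoc]
    simpa using (tendsto_mul_inv_ofReal_sub (z j)).const_mul M
  · simp only [gaudinCoeff, limitCoeff, Fin.cons_zero, Fin.cons_succ, Fin.cases_zero,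
      Fin.cases_succ]
    have := (tendsto_inv_ofReal_sub (z i)).const_mul (-c i)
    rw [mul_zero] at this
    refine this.congr fun u => ?_
    rw [← neg_sub (u : ℂ) (z i), inv_neg]
    ring
  · simp [gaudinCoeff, limitCoeff]

theorem exists_discriminant_specht {n : ℕ} (μ : YoungDiagram) :
    ∃ Q : MvPolynomial (Fin n × Fin n) ℂ, ∀ a, MvPolynomial.eval a Q ≠ 0 ↔
      SimpleSpectrum (V := (specht n μ).toSubmodule) (swapOp μ a) :=
  exists_discriminant (V := (specht n μ).toSubmodule) _

/-- The contents `μ_r - 1 - r` of the last boxes of different rows are different. -/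
theorem eq_of_content_eq {μ : YoungDiagram} {r s : ℕ}
    (h : ((μ.rowLen r : ℂ) - 1 - r) = (μ.rowLen s : ℂ) - 1 - s) : r = s := by
  have h1 : ((μ.rowLen r : ℤ) - 1 - r) = (μ.rowLen s : ℤ) - 1 - s := by exact_mod_cast h
  rcases le_total r s with hrs | hrs
  · have := μ.rowLen_anti r s hrs; omega
  · have := μ.rowLen_anti s r hrs; omega

/-- For all but finitely many `M` the limit operator has simple spectrum on `W^μ`. -/
theorem eventually_simpleSpectrum_limitCoeff {n : ℕ} {μ : YoungDiagram} (hμ : μ.card = n + 1)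
    (a : Fin n × Fin n → ℂ) (ha : ∀ ν : YoungDiagram, ν.card = n →
      SimpleSpectrum (V := (specht n ν).toSubmodule) (swapOp ν a)) :
    ∀ᶠ M : ℂ in Filter.cofinite,
      SimpleSpectrum (V := (specht (n + 1) μ).toSubmodule) (swapOp μ (limitCoeff M a)) := by
  classical
  choose e b he hb using fun r : corners μ =>
    (ha (removeBox μ r) (card_removeBox hμ r.2)).exists_basis
  let ct : ℕ → ℂ := fun r => (μ.rowLen r : ℂ) - 1 - r
  have hdist : ∀ᶠ M : ℂ in Filter.cofinite, ∀ p q : (r : corners μ) ×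
      Fin (Module.finrank ℂ (specht n (removeBox μ r)).toSubmodule), p.1 ≠ q.1 →
      e p.1 p.2 + M * ct p.1 ≠ e q.1 q.2 + M * ct q.1 := by
    rw [Filter.eventually_all]
    intro p
    rw [Filter.eventually_all]
    intro q
    by_cases hpq : p.1 = q.1
    · simp [hpq]
    · have hct : ct p.1 - ct q.1 ≠ 0 := by
        intro h
        exact hpq (Subtype.ext (eq_of_content_eq (sub_eq_zero.1 h)))
      filter_upwards [(Set.finite_singleton
        ((e q.1 q.2 - e p.1 p.2) / (ct p.1 - ct q.1))).compl_mem_cofinite] with M hM _ h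
      refine hM ?_
      rw [Set.mem_singleton_iff, eq_div_iff hct]
      linear_combination h
  filter_upwards [hdist] with M hM
  let ev : ((r : corners μ) × Fin (Module.finrank ℂ (specht n (removeBox μ r)).toSubmodule)) →
      ℂ := fun p => e p.1 p.2 + M * ct p.1
  have hinj : Function.Injective ev := by
    rintro ⟨r, i⟩ ⟨s, j⟩ h
    by_cases hrs : r = s
    · subst hrs
      have h' : e r i = e r j := by simpa [ev] using h
      rw [he r h']
    · exact absurd h (hM ⟨r, i⟩ ⟨s, j⟩ hrs)
  refine simpleSpectrum_of_card_le (V := (specht (n + 1) μ).toSubmodule)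
    (Finset.univ.image ev) ?_ ?_
  · intro x hx
    obtain ⟨p, -, rfl⟩ := Finset.mem_image.1 hx
    exact hasEigenvalue_limitCoeff hμ M a p.1.2 (b p.1) (hb p.1) p.2
  · rw [Finset.card_image_of_injective _ hinj, Finset.card_univ, Fintype.card_sigma]
    simp only [Fintype.card_fin]
    refine le_of_eq ((finrank_specht_succ hμ).trans ?_)
    exact (Finset.sum_coe_sort (corners μ)
      fun r => Module.finrank ℂ (specht n (removeBox μ r)).toSubmodule).symm

theorem simpleSpectrum_of_finrank_le_one {V : Type} [AddCommGroup V] [Module ℂ V]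
    [FiniteDimensional ℂ V] (h : Module.finrank ℂ V ≤ 1) (A : Module.End ℂ V) :
    SimpleSpectrum A := by
  have hm := LinearMap.charpoly_monic A
  have hd := LinearMap.charpoly_natDegree A
  unfold SimpleSpectrum
  rcases Nat.le_one_iff_eq_zero_or_eq_one.1 h with h0 | h1
  · rw [h0] at hd
    rw [hm.natDegree_eq_zero.1 hd]
    exact Polynomial.separable_one
  · rw [h1] at hd
    rw [Polynomial.eq_X_add_C_of_natDegree_le_one hd.le]
    have hc : A.charpoly.coeff 1 = 1 := by
      have := hm.coeff_natDegree; rwa [hd] at this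
    rw [hc, map_one, one_mul]
    exact Polynomial.separable_X_add_C _

theorem finrank_specht_zero_le (μ : YoungDiagram) :
    Module.finrank ℂ (specht 0 μ).toSubmodule ≤ 1 := by
  refine (Submodule.finrank_le _).trans ?_
  rw [Module.finrank_finsupp_self]
  simp

/-- At some point `z` some combination of the `θ_i` has simple spectrum on all Specht modules.
One adds a point far away from the others: then `θ_0` degenerates to a Jucys–Murphy element. -/
theorem exists_simpleSpectrum (n : ℕ) : ∃ z c : Fin n → ℂ, Function.Injective z ∧
    ∀ μ : YoungDiagram, μ.card = n →
      SimpleSpectrum (V := (specht n μ).toSubmodule) (swapOp μ (gaudinCoeff z c)) := by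
  induction n with
  | zero => exact ⟨0, 0, Function.injective_of_subsingleton _, fun μ _ =>
      simpleSpectrum_of_finrank_le_one (finrank_specht_zero_le μ) _⟩
  | succ n ih =>
    obtain ⟨z, c, hz, hs⟩ := ih
    have := finite_youngDiagram (n + 1)
    have h1 : ∀ᶠ M : ℂ in Filter.cofinite, ∀ μ : {μ : YoungDiagram // μ.card = n + 1},
        SimpleSpectrum (V := (specht (n + 1) μ.1).toSubmodule)
          (swapOp μ.1 (limitCoeff M (gaudinCoeff z c))) :=
      Filter.eventually_all.2 fun μ => eventually_simpleSpectrum_limitCoeff μ.2 _ hs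
    obtain ⟨M, hM⟩ := h1.exists
    choose Q hQ using fun μ : YoungDiagram => exists_discriminant_specht (n := n + 1) μ
    have h2 : ∀ᶠ u : ℝ in Filter.atTop, ∀ μ : {μ : YoungDiagram // μ.card = n + 1},
        MvPolynomial.eval (gaudinCoeff (Fin.cons (u : ℂ) z : Fin (n + 1) → ℂ)
          (Fin.cons (M * u) c)) (Q μ.1) ≠ 0 := by
      refine Filter.eventually_all.2 fun μ => ?_
      have hlim := ((MvPolynomial.continuous_eval (Q μ.1)).tendsto _).comp
        (tendsto_gaudinCoeff_cons z c M)
      exact hlim.eventually_ne ((hQ μ.1 _).2 (hM μ))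
    obtain ⟨u, hu, huz⟩ := (h2.and (eventually_injective_cons hz)).exists
    exact ⟨_, _, huz, fun μ hμ => (hQ μ _).1 (hu ⟨μ, hμ⟩)⟩

/-- For generic `z` some combination of the `θ_i` has simple spectrum on all Specht modules. -/
theorem exists_polynomial_simpleSpectrum (n : ℕ) : ∃ P : MvPolynomial (Fin n) ℂ, P ≠ 0 ∧
    ∃ c : Fin n → ℂ, ∀ z : Fin n → ℂ, Function.Injective z → MvPolynomial.eval z P ≠ 0 →
      ∀ μ : YoungDiagram, μ.card = n →
        SimpleSpectrum (V := (specht n μ).toSubmodule) (swapOp μ (gaudinCoeff z c)) := by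
  classical
  obtain ⟨z₀, c, hz₀, hs⟩ := exists_simpleSpectrum n
  have := finite_youngDiagram n
  have := Fintype.ofFinite {μ : YoungDiagram // μ.card = n}
  choose Q hQ using fun μ : YoungDiagram => exists_discriminant_specht (n := n) μ
  let U : Set (Fin n → ℂ) := {z | Function.Injective z}
  have hrat : ∀ s, RationalOn U fun z => gaudinCoeff z c s := by
    intro s
    by_cases h : s.1 = s.2
    · simpa [gaudinCoeff, h] using RationalOn.const (U := U) 0
    · exact (RationalOn.const _).mul (((RationalOn.coord _).sub (RationalOn.coord _)).inv
        fun z hz => sub_ne_zero.2 fun h' => h (hz h'))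
  choose p q hpq using fun μ : YoungDiagram => RationalOn.eval hrat (Q μ)
  refine ⟨∏ μ : {μ : YoungDiagram // μ.card = n}, p μ.1, ?_, c, fun z hz hP μ hμ => ?_⟩
  · refine Finset.prod_ne_zero_iff.2 fun μ _ h0 => ?_
    obtain ⟨h1, h2⟩ := hpq μ.1 z₀ hz₀
    rw [h0, map_zero] at h2
    exact mul_ne_zero ((hQ μ.1 _).2 (hs μ.1 μ.2)) h1 h2
  · rw [map_prod, Finset.prod_ne_zero_iff] at hP
    refine (hQ μ _).1 fun h0 => hP ⟨μ, hμ⟩ (Finset.mem_univ _) ?_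
    obtain ⟨h1, h2⟩ := hpq μ z hz
    rw [← h2]
    exact mul_eq_zero_of_left h0 _

/-- A combination of the `θ_i` with simple spectrum lies in the algebra generated by them and
commutes with it, so that it forces the algebra to be diagonal with a joint spectrum of maximal
size. -/
theorem semisimple_of_simpleSpectrum {n : ℕ} {z c : Fin n → ℂ} (hz : Function.Injective z)
    {μ : YoungDiagram}
    (h : SimpleSpectrum (V := (specht n μ).toSubmodule) (swapOp μ (gaudinCoeff z c))) :
    ActsSemisimply (V := (specht n μ).toSubmodule) (thetaAlgebra z μ) ∧
      (jointSpectrum (V := (specht n μ).toSubmodule) (thetaAlgebra z μ)).encard =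
        (Module.finrank ℂ (specht n μ).toSubmodule : ℕ∞) := by
  have hmem : ∀ i, thetaOp z μ i ∈ thetaAlgebra z μ := fun i => Algebra.subset_adjoin ⟨i, rfl⟩
  refine SimpleSpectrum.semisimple_and_encard (V := (specht n μ).toSubmodule)
    (X := swapOp μ (gaudinCoeff z c)) ?_ h ?_
  · rw [swapOp_gaudinCoeff]
    exact Subalgebra.sum_mem _ fun i _ => Subalgebra.smul_mem _ (hmem i) _
  · have hle : thetaAlgebra z μ ≤ Subalgebra.centralizer ℂ {swapOp μ (gaudinCoeff z c)} := by
      refine Algebra.adjoin_le ?_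
      rintro _ ⟨i, rfl⟩
      refine Subalgebra.mem_centralizer_iff ℂ |>.2 ?_
      rintro _ rfl
      rw [swapOp_gaudinCoeff, Finset.sum_mul, Finset.mul_sum]
      refine Finset.sum_congr rfl fun j _ => ?_
      rw [smul_mul_assoc, mul_smul_comm, thetaOp_comm hz]
    intro A hA
    exact ((Subalgebra.mem_centralizer_iff ℂ).1 (hle hA) _ rfl).symm

/-! ### The weight function and raising operators -/

/-- The cells of a word `w`: the pairs `(k, i)` with `i < w k`, to which the variables of the weight
function are attached. -/
abbrev Cell {n : ℕ} (w : Fin n → ℕ) : Type := {p : Fin n × ℕ // p.2 < w p.1}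

instance {n : ℕ} (w : Fin n → ℕ) : Fintype (Cell w) :=
  Fintype.ofEquiv ((k : Fin n) × Fin (w k))
    { toFun := fun p => ⟨(p.1, p.2), p.2.2⟩
      invFun := fun p => ⟨p.1.1, ⟨p.1.2, p.2⟩⟩
      left_inv := fun _ => rfl
      right_inv := fun _ => rfl }

/-- The chain `z_k, x_{k,0}, x_{k,1}, …` at position `k`, where the values `x` sit in the cells
of `w` (continued by `0`). -/
def cellChain {n : ℕ} {w : Fin n → ℕ} (z : Fin n → ℂ) (x : Cell w → ℂ) (k : Fin n) : ℕ → ℂ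
  | 0 => z k
  | i + 1 => if h : i < w k then x ⟨(k, i), h⟩ else 0

/-- The product of the inverse differences of consecutive elements of the chains. -/
def cellWeight {n : ℕ} {w : Fin n → ℕ} (z : Fin n → ℂ) (x : Cell w → ℂ) : ℂ :=
  ∏ p : Cell w, (x p - cellChain z x p.1.1 p.1.2)⁻¹

/-- The placements of coloured variables on the cells of `w`. -/
abbrev ColPlacement {n : ℕ} {A : Type} (col : A → ℕ) (w : Fin n → ℕ) : Type :=
  {σ : Cell w ≃ A // ∀ p, col (σ p) = p.1.2}

instance {n : ℕ} {A : Type} [Fintype A] (col : A → ℕ) (w : Fin n → ℕ) :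
    Fintype (ColPlacement col w) := by
  classical exact inferInstance

/-- The coefficient of the word `w` in the universal weight function of coloured variables `t`. -/
def weightCoeff {n : ℕ} {A : Type} [Fintype A] (z : Fin n → ℂ) (col : A → ℕ) (t : A → ℂ)
    (w : Fin n → ℕ) : ℂ :=
  ∑ σ : ColPlacement col w, cellWeight z fun p => t (σ.1 p)

/-- The entries of the Cartan matrix of type `A`. -/
def cartan (i j : ℕ) : ℂ := if i = j then 2 else if i + 1 = j ∨ j + 1 = i then -1 else 0

/-- The partial derivative of the master function with respect to the variable `t_a`. The term
`b = a` of the sum vanishes because of `0⁻¹ = 0`. -/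
def masterDeriv {n : ℕ} {A : Type} [Fintype A] (z : Fin n → ℂ) (col : A → ℕ) (t : A → ℂ)
    (a : A) : ℂ :=
  ∑ b, cartan (col a) (col b) * (t a - t b)⁻¹ - if col a = 0 then ∑ k, (t a - z k)⁻¹ else 0

section

variable {n : ℕ} {w : Fin n → ℕ}

theorem cellChain_succ (z : Fin n → ℂ) (x : Cell w → ℂ) {k : Fin n} {i : ℕ} (h : i < w k) :
    cellChain z x k (i + 1) = x ⟨(k, i), h⟩ := dif_pos h

theorem cellChain_update (z : Fin n → ℂ) (x : Cell w → ℂ) (c : Cell w) (s : ℂ) (k : Fin n)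
    (j : ℕ) : cellChain z (Function.update x c s) k j =
      if k = c.1.1 ∧ j = c.1.2 + 1 then s else cellChain z x k j := by
  obtain ⟨⟨l, i⟩, hi⟩ := c
  cases j with
  | zero => simp [cellChain]
  | succ j =>
    by_cases hj : j < w k
    · rw [cellChain_succ z _ hj, cellChain_succ z _ hj, Function.update_apply]
      simp
    · have : ¬ (k = l ∧ j + 1 = i + 1) := by
        rintro ⟨rfl, h⟩
        exact hj (by simp only at hi; omega)
      simp [cellChain, hj]
      rintro rfl rfl
      exact absurd hi hj

/-- The dependence of the weight on the variable in one cell. -/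
theorem exists_cellWeight_update (z : Fin n → ℂ) (x : Cell w → ℂ) {l : Fin n} {i : ℕ}
    (h : i < w l) : ∃ R : ℂ, ∀ s : ℂ, cellWeight z (Function.update x ⟨(l, i), h⟩ s) =
      R * ((s - cellChain z x l i)⁻¹ *
        if i + 1 < w l then (cellChain z x l (i + 2) - s)⁻¹ else 1) := by
  classical
  set c : Cell w := ⟨(l, i), h⟩ with hc
  have hfc : ∀ s, Function.update x c s c - cellChain z (Function.update x c s) c.1.1 c.1.2 =
      s - cellChain z x l i := by
    intro s
    rw [Function.update_self, cellChain_update, if_neg (by simp)]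
  have hother : ∀ s, ∀ p : Cell w, p ≠ c → ¬ (p.1.1 = l ∧ p.1.2 = i + 1) →
      Function.update x c s p - cellChain z (Function.update x c s) p.1.1 p.1.2 =
        x p - cellChain z x p.1.1 p.1.2 := by
    intro s p hp hp'
    rw [Function.update_of_ne hp, cellChain_update, if_neg hp']
  by_cases hs : i + 1 < w l
  · set d : Cell w := ⟨(l, i + 1), hs⟩ with hd
    have hdc : d ≠ c := by simp [hd, hc]
    refine ⟨∏ p ∈ (Finset.univ.erase c).erase d, (x p - cellChain z x p.1.1 p.1.2)⁻¹,
      fun s => ?_⟩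
    rw [if_pos hs, cellWeight, ← Finset.mul_prod_erase Finset.univ _ (Finset.mem_univ c),
      ← Finset.mul_prod_erase (Finset.univ.erase c) _
        (Finset.mem_erase.2 ⟨hdc, Finset.mem_univ d⟩), hfc, Function.update_of_ne hdc,
      cellChain_update, if_pos ⟨rfl, rfl⟩, cellChain_succ z x hs]
    rw [Finset.prod_congr rfl fun p hp => ?_]
    · ring
    · have h1 := (Finset.mem_erase.1 hp).1
      have h2 := (Finset.mem_erase.1 (Finset.mem_erase.1 hp).2).1
      rw [hother s p h2 fun h => h1 (Subtype.ext (Prod.ext h.1 h.2))]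
  · refine ⟨∏ p ∈ Finset.univ.erase c, (x p - cellChain z x p.1.1 p.1.2)⁻¹, fun s => ?_⟩
    rw [if_neg hs, cellWeight, ← Finset.mul_prod_erase Finset.univ _ (Finset.mem_univ c), hfc]
    rw [Finset.prod_congr rfl fun p hp => ?_]
    · ring
    · rw [hother s p (Finset.mem_erase.1 hp).1 fun h => hs ?_]
      have := p.2
      rwa [h.1, h.2] at this

/-- The cancellation of the two terms that differ by the exchange of the variables `x` and `y` of
the same colour, when one of them is the end of a chain with the preceding element `p`. -/
theorem bethe_identity {x y p : ℂ} (hxy : x ≠ y) (hxp : x ≠ p) (hyp : y ≠ p) :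
    (y - p)⁻¹ * (2 * (x - y)⁻¹ - (x - p)⁻¹) + (x - p)⁻¹ * (2 * (y - x)⁻¹ - (y - p)⁻¹) = 0 := by
  have h1 := sub_ne_zero.2 hxy
  have h2 := sub_ne_zero.2 hxp
  have h3 := sub_ne_zero.2 hyp
  rw [← neg_sub x y, inv_neg]
  field_simp
  ring

/-- The cancellation of the two terms that differ by the exchange of the variables `x` and `y` of
the same colour, when one of them lies in a chain between `p` and `q`. -/
theorem bethe_identity' {x y p q : ℂ} (hxy : x ≠ y) (hxp : x ≠ p) (hyp : y ≠ p) (hxq : x ≠ q)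
    (hyq : y ≠ q) :
    (y - p)⁻¹ * (q - y)⁻¹ * (2 * (x - y)⁻¹ - (x - q)⁻¹ - (x - p)⁻¹) +
      (x - p)⁻¹ * (q - x)⁻¹ * (2 * (y - x)⁻¹ - (y - q)⁻¹ - (y - p)⁻¹) = 0 := by
  have h1 := sub_ne_zero.2 hxy
  have h2 := sub_ne_zero.2 hxp
  have h3 := sub_ne_zero.2 hyp
  have h4 := sub_ne_zero.2 hxq
  have h5 := sub_ne_zero.2 hyq
  rw [← neg_sub x y, ← neg_sub x q, ← neg_sub y q, inv_neg, inv_neg, inv_neg]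
  field_simp
  ring

theorem sum_cell {M : Type} [AddCommMonoid M] (j : ℕ) (F : Cell w → M) :
    (∑ p : Cell w, if p.1.2 = j then F p else 0) =
      ∑ k : Fin n, if h : j < w k then F ⟨(k, j), h⟩ else 0 := by
  classical
  rw [← Finset.sum_filter, Finset.sum_dite, Finset.sum_const_zero, add_zero]
  refine Finset.sum_bij' (fun p hp => ⟨p.1.1, ?_⟩) (fun k _ => ⟨(k.1, j), ?_⟩) ?_ ?_ ?_ ?_ ?_
  · have h := p.2
    rw [(Finset.mem_filter.1 hp).2] at h
    simpa using h
  · exact (Finset.mem_filter.1 k.2).2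
  · intro p hp; simp
  · intro k hk; simp
  · intro p hp
    have h := (Finset.mem_filter.1 hp).2
    exact Subtype.ext (Prod.ext rfl h.symm)
  · intro k hk; rfl
  · intro p hp
    have h := (Finset.mem_filter.1 hp).2
    congr 1
    exact Subtype.ext (Prod.ext rfl h)

variable {A : Type} [Fintype A] {col : A → ℕ}

/-- Placements on the cells of `w` and one additional cell of colour `i`. -/
abbrev ExtraPlacement (col : A → ℕ) (w : Fin n → ℕ) (i : ℕ) : Type :=
  {τ : Option (Cell w) ≃ A // col (τ none) = i ∧ ∀ p, col (τ (some p)) = p.1.2}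

instance (col : A → ℕ) (w : Fin n → ℕ) (i : ℕ) : Fintype (ExtraPlacement col w i) := by
  classical exact inferInstance

/-- Increasing the letter `i` at position `k` by one adds the cell `(k, i)`. -/
def optionCellEquiv (w : Fin n → ℕ) (k : Fin n) :
    Option (Cell w) ≃ Cell (Function.update w k (w k + 1)) where
  toFun o := o.elim ⟨(k, w k), by simp⟩ fun p => ⟨p.1, by
    have := p.2
    by_cases h : p.1.1 = k
    · simp only [h, Function.update_self] at this ⊢; omega
    · rwa [Function.update_of_ne h]⟩
  invFun p := if h : p.1.2 < w p.1.1 then some ⟨p.1, h⟩ else none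
  left_inv o := by
    rcases o with _ | p
    · simp
    · simp [p.2]
  right_inv p := by
    by_cases h : p.1.2 < w p.1.1
    · simp [h]
    · have h2 := p.2
      have hk : p.1.1 = k := by
        by_contra hk
        rw [Function.update_of_ne hk] at h2
        exact h h2
      rw [hk] at h h2
      rw [Function.update_self] at h2
      simp only [hk, h, dif_neg, not_false_iff]
      refine Subtype.ext (Prod.ext hk.symm ?_)
      change w k = p.1.2
      omega

/-- Raising the letter at position `k` by one prolongs the chain at `k` by one additional
variable. -/
theorem weightCoeff_update (z : Fin n → ℂ) (t : A → ℂ) (k : Fin n) :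
    weightCoeff z col t (Function.update w k (w k + 1)) =
      ∑ τ : ExtraPlacement col w (w k), cellWeight z (fun p => t (τ.1 (some p))) *
        (t (τ.1 none) - cellChain z (fun p => t (τ.1 (some p))) k (w k))⁻¹ := by
  classical
  let e := optionCellEquiv w k
  let E : ColPlacement col (Function.update w k (w k + 1)) ≃ ExtraPlacement col w (w k) :=
    (Equiv.equivCongr e.symm (Equiv.refl A)).subtypeEquiv fun σ => by
      constructor
      · intro h
        refine ⟨(h (e none)).trans rfl, fun p => (h (e (some p))).trans rfl⟩
      · rintro ⟨h0, h1⟩ p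
        obtain ⟨o, rfl⟩ := e.surjective p
        rcases o with _ | p
        · exact h0
        · exact h1 p
  rw [weightCoeff, ← E.sum_comp]
  refine Finset.sum_congr rfl fun σ _ => ?_
  have hE : ∀ o, (E σ).1 o = σ.1 (e o) := fun o => rfl
  simp only [hE]
  rw [cellWeight, ← e.prod_comp, Fintype.prod_option, mul_comm, cellWeight]
  have hchain : ∀ (l : Fin n) (j : ℕ), j ≤ w l →
      cellChain z (fun p => t (σ.1 p)) l j = cellChain z (fun p => t (σ.1 (e (some p)))) l j := by
    intro l j hj
    cases j with
    | zero => rfl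
    | succ j =>
      have h1 : j < Function.update w k (w k + 1) l := (e (some ⟨(l, j), hj⟩)).2
      rw [cellChain_succ z _ h1, cellChain_succ z _ hj]
      rfl
  congr 1
  · refine Finset.prod_congr rfl fun p _ => ?_
    congr 2
    exact hchain _ _ p.2.le
  · congr 2
    exact hchain _ _ le_rfl

/-- At a critical point the part of the sum over the extra positions is expressed by the occupied
positions. -/
theorem sum_extra_eq {z : Fin n → ℂ} {t : A → ℂ} (hg : ∀ a, masterDeriv z col t a = 0) {i : ℕ}
    (τ : ExtraPlacement col w i) :
    let x : Cell w → ℂ := fun p => t (τ.1 (some p))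
    ∑ k ∈ Finset.univ.filter (fun k => w k = i), (t (τ.1 none) - cellChain z x k i)⁻¹ =
      ∑ l ∈ Finset.univ.filter (fun l => i < w l), (2 * (t (τ.1 none) - cellChain z x l (i + 1))⁻¹ -
        (if i + 1 < w l then (t (τ.1 none) - cellChain z x l (i + 2))⁻¹ else 0) -
          (t (τ.1 none) - cellChain z x l i)⁻¹) := by
  classical
  intro x
  set x0 := t (τ.1 none) with hx0
  have hcol : ∀ j, (∑ p : Cell w, if p.1.2 = j then (x0 - x p)⁻¹ else 0) =
      ∑ k : Fin n, if j < w k then (x0 - cellChain z x k (j + 1))⁻¹ else 0 := by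
    intro j
    rw [sum_cell j fun p => (x0 - x p)⁻¹]
    refine Finset.sum_congr rfl fun k _ => ?_
    by_cases h : j < w k
    · rw [dif_pos h, if_pos h, cellChain_succ z x h]
    · rw [dif_neg h, if_neg h]
  have hprev : (∑ p : Cell w, if p.1.2 + 1 = i then (x0 - x p)⁻¹ else 0) +
      (if i = 0 then ∑ k, (x0 - z k)⁻¹ else 0) =
      ∑ k : Fin n, if i ≤ w k then (x0 - cellChain z x k i)⁻¹ else 0 := by
    cases i with
    | zero => simp [cellChain]
    | succ i => simpa [Nat.succ_le_iff] using hcol i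
  have hB := hg (τ.1 none)
  rw [masterDeriv, τ.2.1, ← τ.1.sum_comp, Fintype.sum_option, ← hx0, sub_self, inv_zero, mul_zero,
    zero_add] at hB
  have hsplit : ∑ p : Cell w, cartan i (col (τ.1 (some p))) * (x0 - t (τ.1 (some p)))⁻¹ =
      2 * (∑ p : Cell w, if p.1.2 = i then (x0 - x p)⁻¹ else 0) -
      (∑ p : Cell w, if p.1.2 = i + 1 then (x0 - x p)⁻¹ else 0) -
      (∑ p : Cell w, if p.1.2 + 1 = i then (x0 - x p)⁻¹ else 0) := by
    rw [Finset.mul_sum, ← Finset.sum_sub_distrib, ← Finset.sum_sub_distrib]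
    refine Finset.sum_congr rfl fun p _ => ?_
    rw [τ.2.2 p, cartan]
    rcases lt_trichotomy i p.1.2 with h | h | h
    · by_cases h1 : p.1.2 = i + 1
      · rw [if_neg (by omega), if_pos (Or.inl h1.symm), if_neg (by omega), if_pos h1,
          if_neg (by omega)]
        simp [x]
      · rw [if_neg (by omega), if_neg (by omega), if_neg (by omega), if_neg h1, if_neg (by omega)]
        simp
    · simp [← h, x]
    · by_cases h1 : p.1.2 + 1 = i
      · rw [if_neg (by omega), if_pos (Or.inr h1), if_neg (by omega), if_neg (by omega),
          if_pos h1]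
        simp [x]
      · rw [if_neg (by omega), if_neg (by omega), if_neg (by omega), if_neg (by omega), if_neg h1]
        simp
  rw [hsplit, hcol, hcol] at hB
  have hsum : (∑ k : Fin n, if i ≤ w k then (x0 - cellChain z x k i)⁻¹ else 0) =
      ∑ k ∈ Finset.univ.filter (fun k => w k = i), (x0 - cellChain z x k i)⁻¹ +
      ∑ k ∈ Finset.univ.filter (fun k => i < w k), (x0 - cellChain z x k i)⁻¹ := by
    rw [Finset.sum_filter, Finset.sum_filter, ← Finset.sum_add_distrib]
    refine Finset.sum_congr rfl fun k _ => ?_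
    rcases lt_trichotomy i (w k) with h | h | h
    · rw [if_pos h.le, if_neg h.ne', if_pos h, zero_add]
    · simp [h]
    · rw [if_neg (by omega), if_neg (by omega), if_neg (by omega), zero_add]
  have hnext : (∑ k : Fin n, if i + 1 < w k then (x0 - cellChain z x k (i + 1 + 1))⁻¹ else 0) =
      ∑ l ∈ Finset.univ.filter (fun l => i < w l),
        if i + 1 < w l then (x0 - cellChain z x l (i + 2))⁻¹ else 0 := by
    rw [Finset.sum_filter]
    refine Finset.sum_congr rfl fun k _ => ?_
    by_cases h : i + 1 < w k
    · rw [if_pos h, if_pos (by omega)]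
    · simp [h]
  rw [Finset.sum_sub_distrib, Finset.sum_sub_distrib, ← Finset.mul_sum, ← hnext]
  rw [← Finset.sum_filter] at hB
  linear_combination -hprev - hsum - hB

/-- Exchanging the extra variable with the variable in the cell `(l, i)`. -/
def swapExtra {l : Fin n} {i : ℕ} (h : i < w l) :
    ExtraPlacement col w i ≃ ExtraPlacement col w i where
  toFun τ := ⟨(Equiv.swap none (some ⟨(l, i), h⟩)).trans τ.1, by
    classical
    refine ⟨by simp [τ.2.2], fun p => ?_⟩
    by_cases hp : p = ⟨(l, i), h⟩
    · simp [hp, τ.2.1]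
    · rw [Equiv.trans_apply, Equiv.swap_apply_of_ne_of_ne (by simp) (by simpa using hp)]
      exact τ.2.2 p⟩
  invFun τ := ⟨(Equiv.swap none (some ⟨(l, i), h⟩)).trans τ.1, by
    classical
    refine ⟨by simp [τ.2.2], fun p => ?_⟩
    by_cases hp : p = ⟨(l, i), h⟩
    · simp [hp, τ.2.1]
    · rw [Equiv.trans_apply, Equiv.swap_apply_of_ne_of_ne (by simp) (by simpa using hp)]
      exact τ.2.2 p⟩
  left_inv τ := by
    refine Subtype.ext (Equiv.ext fun o => ?_)
    simp
  right_inv τ := by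
    refine Subtype.ext (Equiv.ext fun o => ?_)
    simp

/-- At a critical point the weight function is killed by the simple raising operators. The terms
cancel in pairs under the exchange of two variables of the same colour. -/
theorem kills_weightCoeff {z : Fin n → ℂ} {t : A → ℂ} (ht : Function.Injective t)
    (hz : ∀ a k, col a = 0 → t a ≠ z k) (hg : ∀ a, masterDeriv z col t a = 0) (i : ℕ) :
    Kills i (i + 1) (weightCoeff (n := n) z col t) := by
  classical
  intro w
  have h1 : ∀ k ∈ Finset.univ.filter (fun k => w k = i),
      weightCoeff z col t (Function.update w k (i + 1)) =
      ∑ τ : ExtraPlacement col w i, cellWeight z (fun p => t (τ.1 (some p))) *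
        (t (τ.1 none) - cellChain z (fun p => t (τ.1 (some p))) k i)⁻¹ := by
    intro k hk
    have hk' : w k = i := (Finset.mem_filter.1 hk).2
    subst hk'
    exact weightCoeff_update z t k
  rw [Finset.sum_congr rfl h1, Finset.sum_comm]
  simp only [← Finset.mul_sum, sum_extra_eq hg]
  simp only [Finset.mul_sum]
  rw [Finset.sum_comm]
  refine Finset.sum_eq_zero fun l hl => ?_
  have hl' : i < w l := (Finset.mem_filter.1 hl).2
  set f : ExtraPlacement col w i → ℂ := fun τ =>
    cellWeight z (fun p => t (τ.1 (some p))) *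
      (2 * (t (τ.1 none) - cellChain z (fun p => t (τ.1 (some p))) l (i + 1))⁻¹ -
        (if i + 1 < w l then
          (t (τ.1 none) - cellChain z (fun p => t (τ.1 (some p))) l (i + 2))⁻¹ else 0) -
        (t (τ.1 none) - cellChain z (fun p => t (τ.1 (some p))) l i)⁻¹) with hf
  -- exchanging the extra variable and that of the cell `(l, i)` changes the sign
  have hpair : ∀ τ, f τ + f (swapExtra hl' τ) = 0 := by
    intro τ
    set x : Cell w → ℂ := fun p => t (τ.1 (some p)) with hx
    set c : Cell w := ⟨(l, i), hl'⟩ with hc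
    have hx' : (fun p => t ((swapExtra hl' τ).1 (some p))) =
        Function.update x c (t (τ.1 none)) := by
      funext p
      by_cases hp : p = c
      · simp [hp, swapExtra, hc]
      · rw [Function.update_of_ne hp]
        simp only [swapExtra, Equiv.coe_fn_mk, Equiv.trans_apply]
        rw [Equiv.swap_apply_of_ne_of_ne (by simp) (by simpa using hp)]
    have hx0' : t ((swapExtra hl' τ).1 none) = x c := by
      simp [swapExtra, hx, hc]
    obtain ⟨R, hR⟩ := exists_cellWeight_update z x hl'
    have hW : cellWeight z x = R * ((x c - cellChain z x l i)⁻¹ *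
        if i + 1 < w l then (cellChain z x l (i + 2) - x c)⁻¹ else 1) := by
      rw [← hR, Function.update_eq_self]
    have hinj : Function.Injective fun o => t (τ.1 o) := ht.comp τ.1.injective
    have hxy : t (τ.1 none) ≠ x c := fun h => by simpa using hinj h
    have hp : ∀ o : Option (Cell w), o = none ∨ o = some c → t (τ.1 o) ≠ cellChain z x l i := by
      intro o ho
      have hco : col (τ.1 o) = i := by
        rcases ho with rfl | rfl
        · exact τ.2.1
        · exact τ.2.2 c
      rcases Nat.eq_zero_or_pos i with h0 | h0
      · subst h0
        exact hz _ _ hco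
      · obtain ⟨j, rfl⟩ : ∃ j, i = j + 1 := ⟨i - 1, by omega⟩
        rw [cellChain_succ z x (show j < w l by omega)]
        intro h
        have h2 := hinj h
        rcases ho with rfl | rfl
        · simp at h2
        · simp [hc] at h2
    have hq : ∀ o : Option (Cell w), o = none ∨ o = some c → i + 1 < w l →
        t (τ.1 o) ≠ cellChain z x l (i + 2) := by
      intro o ho hs h
      rw [cellChain_succ z x hs] at h
      have h2 := hinj h
      rcases ho with rfl | rfl
      · simp at h2
      · simp [hc] at h2
    have hy : cellChain z x l (i + 1) = x c := cellChain_succ z x hl'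
    simp only [hf, hx', hx0']
    have e1 : ∀ s, cellChain z (Function.update x c s) l (i + 1) = s := fun s => by
      rw [cellChain_update, if_pos ⟨rfl, rfl⟩]
    have e2 : ∀ s, cellChain z (Function.update x c s) l (i + 2) = cellChain z x l (i + 2) :=
      fun s => by rw [cellChain_update, if_neg (by simp [hc])]
    have e3 : ∀ s, cellChain z (Function.update x c s) l i = cellChain z x l i := fun s => by
      rw [cellChain_update, if_neg (by simp [hc])]
    rw [← hx, hR, hW, e1, e2, e3, hy]
    by_cases hs : i + 1 < w l
    · simp only [if_pos hs]
      have := bethe_identity' hxy (hp none (Or.inl rfl)) (hp (some c) (Or.inr rfl))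
        (hq none (Or.inl rfl) hs) (hq (some c) (Or.inr rfl) hs)
      linear_combination R * this
    · simp only [if_neg hs]
      have := bethe_identity hxy (hp none (Or.inl rfl)) (hp (some c) (Or.inr rfl))
      linear_combination R * this
  have h2 : ∑ τ, f τ + ∑ τ, f (swapExtra hl' τ) = 0 := by
    rw [← Finset.sum_add_distrib]
    exact Finset.sum_eq_zero fun τ _ => hpair τ
  rw [(swapExtra hl').sum_comp f] at h2
  have : (2 : ℂ) * ∑ τ, f τ = 0 := by rw [two_mul]; exact h2
  simpa using this

/-- The weights of the words that occur in the weight function. -/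
theorem card_of_weightCoeff_ne_zero {z : Fin n → ℂ} {t : A → ℂ}
    (h : weightCoeff z col t w ≠ 0) (j : ℕ) :
    (Finset.univ.filter fun k => j < w k).card = (Finset.univ.filter fun a => col a = j).card := by
  classical
  obtain ⟨σ, -, -⟩ := Finset.exists_ne_zero_of_sum_ne_zero h
  refine Finset.card_bij' (fun k hk => σ.1 ⟨(k, j), (Finset.mem_filter.1 hk).2⟩)
    (fun a _ => (σ.1.symm a).1.1) ?_ ?_ ?_ ?_
  · intro k hk
    exact Finset.mem_filter.2 ⟨Finset.mem_univ _, σ.2 _⟩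
  · intro a ha
    refine Finset.mem_filter.2 ⟨Finset.mem_univ _, ?_⟩
    have h1 := σ.2 (σ.1.symm a)
    rw [Equiv.apply_symm_apply, (Finset.mem_filter.1 ha).2] at h1
    rw [h1]
    exact (σ.1.symm a).2
  · intro k hk
    simp
  · intro a ha
    have h1 := σ.2 (σ.1.symm a)
    rw [Equiv.apply_symm_apply, (Finset.mem_filter.1 ha).2] at h1
    rw [← Equiv.eq_symm_apply]
    exact Subtype.ext (Prod.ext rfl h1)

end

/-! ### The critical point equations at two scales -/

/-- The factor by which a quantity of the kind `p` is multiplied; the kind `true` stands for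
quantities of order `1`, the kind `false` for quantities of order `ε⁻¹`. -/
def scl (p : Bool) (ε : ℂ) : ℂ := if p then 1 else ε⁻¹

/-- The ratio of the scales of `q` and of `p`, when the latter is the smaller one, and `1`
otherwise. -/
def damp (p q : Bool) (ε : ℂ) : ℂ := if p && !q then ε else 1

/-- The function `s_p / (s_p x - s_q y)`, where `s_p` and `s_q` are the scales of `p` and `q`,
written such that it is regular at `ε = 0`. -/
def dInv (p q : Bool) (ε x y : ℂ) : ℂ :=
  damp p q ε * (damp p q ε * x - damp q p ε * y)⁻¹

@[simp] theorem damp_self (p : Bool) (ε : ℂ) : damp p p ε = 1 := by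
  cases p <;> simp [damp]

@[simp] theorem dInv_kind_self (p : Bool) (ε x y : ℂ) : dInv p p ε x y = (x - y)⁻¹ := by
  simp [dInv]

/-- For `ε ≠ 0` the definition of `dInv` is the quantity it stands for. -/
theorem dInv_eq (p q : Bool) {ε : ℂ} (hε : ε ≠ 0) (x y : ℂ) :
    dInv p q ε x y = scl p ε * (scl p ε * x - scl q ε * y)⁻¹ := by
  cases p <;> cases q
  · simp [dInv, damp, scl]
    rw [← mul_sub, mul_inv, inv_inv, ← mul_assoc, inv_mul_cancel₀ hε, one_mul]
  · simp [dInv, damp, scl]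
    rw [← mul_inv, mul_sub, mul_inv_cancel_left₀ hε]
  · simp [dInv, damp, scl]
    rw [← inv_inv ε, ← mul_inv, inv_inv, mul_sub, inv_mul_cancel_left₀ hε]
  · simp [dInv, damp, scl]

theorem hasDerivAt_dInv_left (p q : Bool) (ε : ℂ) {x y : ℂ}
    (h : damp p q ε * x - damp q p ε * y ≠ 0) :
    HasDerivAt (fun s => dInv p q ε s y) (-(dInv p q ε x y) ^ 2) x := by
  have h1 : HasDerivAt (fun s => damp p q ε * s - damp q p ε * y) (damp p q ε) x := by
    simpa using ((hasDerivAt_id x).const_mul (damp p q ε)).sub_const (damp q p ε * y)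
  refine ((h1.inv h).const_mul (damp p q ε)).congr_deriv ?_
  rw [dInv]
  field_simp

theorem hasDerivAt_dInv_right (p q : Bool) (ε : ℂ) {x y : ℂ}
    (h : damp p q ε * x - damp q p ε * y ≠ 0) :
    HasDerivAt (fun s => dInv p q ε x s) (-(dInv p q ε x y * dInv q p ε y x)) y := by
  have h1 : HasDerivAt (fun s => damp p q ε * x - damp q p ε * s) (-damp q p ε) y := by
    simpa using ((hasDerivAt_id y).const_mul (damp q p ε)).const_sub (damp p q ε * x)
  refine ((h1.inv h).const_mul (damp p q ε)).congr_deriv ?_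
  rw [dInv, dInv, ← neg_sub (damp p q ε * x), inv_neg]
  field_simp

theorem contDiffAt_dInv {E : Type} [NormedAddCommGroup E] [NormedSpace ℂ E] (p q : Bool)
    {ε x y : E → ℂ} {e : E} (hε : ContDiffAt ℂ 1 ε e) (hx : ContDiffAt ℂ 1 x e)
    (hy : ContDiffAt ℂ 1 y e) (h : damp p q (ε e) * x e - damp q p (ε e) * y e ≠ 0) :
    ContDiffAt ℂ 1 (fun v => dInv p q (ε v) (x v) (y v)) e := by
  have hd : ∀ p q, ContDiffAt ℂ 1 (fun v => damp p q (ε v)) e := by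
    intro p q
    unfold damp
    split_ifs
    · exact hε
    · exact contDiffAt_const
  exact (hd p q).mul ((((hd p q).mul hx).sub ((hd q p).mul hy)).inv h)

section

variable {m : ℕ} {A : Type} [Fintype A] (oK : Fin m → Bool) (y : Fin m → ℂ) (col : A → ℕ)
  (o : A → Bool)

/-- The partial derivatives of the master function in rescaled variables `x`, where the
coordinates `t` and `z` with the kinds `o` and `oK` are obtained from `x` and `y` by rescaling.
As in `masterDeriv`, the term `b = a` is zero. -/
def dampedDeriv (ε : ℂ) (x : A → ℂ) (a : A) : ℂ :=
  ∑ b, cartan (col a) (col b) * dInv (o a) (o b) ε (x a) (x b) -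
    if col a = 0 then ∑ k, dInv (o a) (oK k) ε (x a) (y k) else 0

open Classical in
/-- The matrix of the derivatives of `dampedDeriv` with respect to `x`. -/
def dampedHess (ε : ℂ) (x : A → ℂ) : Matrix A A ℂ := Matrix.of fun a b =>
  -(cartan (col a) (col b) * (dInv (o a) (o b) ε (x a) (x b) * dInv (o b) (o a) ε (x b) (x a))) +
    if a = b then -(∑ c, cartan (col a) (col c) * dInv (o a) (o c) ε (x a) (x c) ^ 2) +
      if col a = 0 then ∑ k, dInv (o a) (oK k) ε (x a) (y k) ^ 2 else 0
    else 0

/-- The coordinates of `x` and of `y` are separated, also in the limit `ε = 0`. -/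
def DampedSep (ε : ℂ) (x : A → ℂ) : Prop :=
  (∀ a b, a ≠ b → damp (o a) (o b) ε * x a - damp (o b) (o a) ε * x b ≠ 0) ∧
    ∀ a k, col a = 0 → damp (o a) (oK k) ε * x a - damp (oK k) (o a) ε * y k ≠ 0

variable {oK y col o}

theorem hasDerivAt_dampedDeriv [DecidableEq A] {ε : ℂ} {x : A → ℂ}
    (h : DampedSep oK y col o ε x) (a b : A) :
    HasDerivAt (fun s => dampedDeriv oK y col o ε (Function.update x b s) a)
      (dampedHess oK y col o ε x a b) (x b) := by
  have h1 : ∀ c, HasDerivAt (fun s => cartan (col a) (col c) *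
      dInv (o a) (o c) ε (Function.update x b s a) (Function.update x b s c))
      (cartan (col a) (col c) * ((if a = b then -(dInv (o a) (o c) ε (x a) (x c)) ^ 2 else 0) +
        if c = b then -(dInv (o a) (o c) ε (x a) (x c) * dInv (o c) (o a) ε (x c) (x a)) else 0))
      (x b) := by
    intro c
    refine HasDerivAt.const_mul _ ?_
    by_cases hca : c = a
    · subst hca
      simpa using hasDerivAt_const (x b) (0 : ℂ)
    · by_cases hab : a = b
      · subst hab
        simpa [hca] using hasDerivAt_dInv_left (o a) (o c) ε (h.1 a c (Ne.symm hca))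
      · by_cases hcb : c = b
        · subst hcb
          simpa [hab] using hasDerivAt_dInv_right (o a) (o c) ε (h.1 a c hab)
        · simpa [hab, hcb] using hasDerivAt_const (x b) (dInv (o a) (o c) ε (x a) (x c))
  have h2 : HasDerivAt (fun s => if col a = 0 then
      ∑ k, dInv (o a) (oK k) ε (Function.update x b s a) (y k) else 0)
      (if a = b then if col a = 0 then -∑ k, dInv (o a) (oK k) ε (x a) (y k) ^ 2 else 0 else 0)
      (x b) := by
    by_cases hab : a = b
    · subst hab
      by_cases hc : col a = 0
      · simp only [if_pos hc, if_true, Function.update_self]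
        rw [← Finset.sum_neg_distrib]
        exact HasDerivAt.fun_sum fun k _ => hasDerivAt_dInv_left _ _ ε (h.2 a k hc)
      · simpa [hc] using hasDerivAt_const (x a) (0 : ℂ)
    · simpa [hab] using hasDerivAt_const (x b) (if col a = 0 then
        ∑ k, dInv (o a) (oK k) ε (x a) (y k) else 0)
  refine ((HasDerivAt.fun_sum (u := Finset.univ) fun c _ => h1 c).sub h2).congr_deriv ?_
  simp only [mul_add, Finset.sum_add_distrib, mul_ite, mul_zero, Finset.sum_ite_eq',
    Finset.mem_univ, if_true, dampedHess, Matrix.of_apply]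
  by_cases hab : a = b
  · subst hab
    by_cases hc : col a = 0
    · simp [hc]
    · simp [hc]
  · simp [hab]

end

/-- The Hessian matrix of the master function: the case in which nothing is rescaled. -/
def masterHess {n : ℕ} {A : Type} [Fintype A] (z : Fin n → ℂ) (col : A → ℕ) (t : A → ℂ) :
    Matrix A A ℂ :=
  dampedHess (fun _ => true) z col (fun _ => true) 1 t

section

variable {n : ℕ} {A : Type} [Fintype A] {z : Fin n → ℂ} {col : A → ℕ} {t : A → ℂ}

theorem masterDeriv_eq_dampedDeriv :
    masterDeriv z col t = dampedDeriv (fun _ => true) z col (fun _ => true) 1 t := by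
  funext a
  simp [masterDeriv, dampedDeriv]

/-- The chain rule for the rescaling of the variables. -/
theorem dampedDeriv_eq (oK : Fin n → Bool) (o : A → Bool) {ε : ℂ} (hε : ε ≠ 0) (a : A) :
    dampedDeriv oK z col o ε t a = scl (o a) ε * masterDeriv (fun k => scl (oK k) ε * z k) col
      (fun b => scl (o b) ε * t b) a := by
  simp only [dampedDeriv, masterDeriv, dInv_eq _ _ hε]
  rw [mul_sub, Finset.mul_sum, mul_ite, mul_zero, Finset.mul_sum]
  congr 1
  exact Finset.sum_congr rfl fun b _ => by ring

theorem dampedHess_eq [DecidableEq A] (oK : Fin n → Bool) (o : A → Bool) {ε : ℂ} (hε : ε ≠ 0) :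
    dampedHess oK z col o ε t = Matrix.diagonal (fun a => scl (o a) ε) *
      masterHess (fun k => scl (oK k) ε * z k) col (fun b => scl (o b) ε * t b) *
        Matrix.diagonal fun a => scl (o a) ε := by
  ext a b
  rw [Matrix.mul_diagonal, Matrix.diagonal_mul]
  simp only [dampedHess, masterHess, Matrix.of_apply, dInv_eq _ _ hε, dInv_kind_self]
  by_cases hab : a = b
  · subst hab
    by_cases hc : col a = 0
    · simp only [hc, if_true, mul_pow, mul_add, add_mul, Finset.mul_sum, Finset.sum_mul,
        ← Finset.sum_neg_distrib, mul_neg, neg_mul]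
      congr 1
      · ring
      · congr 1 <;> exact Finset.sum_congr rfl fun b _ => by ring
    · simp only [hc, if_true, if_false, mul_pow, mul_add, add_mul, Finset.mul_sum, Finset.sum_mul,
        ← Finset.sum_neg_distrib, mul_neg, neg_mul, add_zero]
      congr 1
      · ring
      · exact Finset.sum_congr rfl fun b _ => by ring
  · simp only [hab, if_false]
    ring

/-- Nondegenerate critical points of the master function of coloured variables. -/
structure IsCritical [DecidableEq A] (z : Fin n → ℂ) (col : A → ℕ) (t : A → ℂ) : Prop where
  injective : Function.Injective t
  ne_z : ∀ a k, col a = 0 → t a ≠ z k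
  deriv_eq_zero : ∀ a, masterDeriv z col t a = 0
  hess : (masterHess z col t).det ≠ 0

end

/-! ### Logarithmic derivatives -/

/-- The function `f` has the logarithmic derivative `L` at `s`. -/
def HasLogDerivAt (f : ℂ → ℂ) (L s : ℂ) : Prop := HasDerivAt f (L * f s) s ∧ f s ≠ 0

namespace HasLogDerivAt

variable {f g : ℂ → ℂ} {L M s : ℂ}

theorem logDeriv_eq (h : HasLogDerivAt f L s) : logDeriv f s = L := by
  rw [logDeriv_apply, h.1.deriv, mul_div_cancel_right₀ _ h.2]

theorem one (s : ℂ) : HasLogDerivAt (fun _ => 1) 0 s :=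
  ⟨by simpa using hasDerivAt_const s (1 : ℂ), one_ne_zero⟩

theorem mul (hf : HasLogDerivAt f L s) (hg : HasLogDerivAt g M s) :
    HasLogDerivAt (fun x => f x * g x) (L + M) s :=
  ⟨(hf.1.mul hg.1).congr_deriv (by ring), mul_ne_zero hf.2 hg.2⟩

theorem inv (hf : HasLogDerivAt f L s) : HasLogDerivAt (fun x => (f x)⁻¹) (-L) s :=
  ⟨(hf.1.inv hf.2).congr_deriv (by have := hf.2; field_simp), inv_ne_zero hf.2⟩

theorem prod {ι : Type} (u : Finset ι) {f : ι → ℂ → ℂ} {L : ι → ℂ}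
    (h : ∀ i ∈ u, HasLogDerivAt (f i) (L i) s) :
    HasLogDerivAt (fun x => ∏ i ∈ u, f i x) (∑ i ∈ u, L i) s := by
  classical
  induction u using Finset.induction_on with
  | empty => simpa using one s
  | insert i u hi ih =>
    simp only [Finset.prod_insert hi, Finset.sum_insert hi]
    exact (h i (Finset.mem_insert_self _ _)).mul (ih fun j hj => h j (Finset.mem_insert_of_mem hj))

theorem ite {P : Prop} [Decidable P] (h : P → HasLogDerivAt f L s) :
    HasLogDerivAt (fun x => if P then f x else 1) (if P then L else 0) s := by
  by_cases hP : P
  · simpa [hP] using h hP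
  · simpa [hP] using one s

theorem sub_update {A : Type} [DecidableEq A] {t : A → ℂ} {b c : A} (h : t b ≠ t c) (a : A) :
    HasLogDerivAt (fun s => Function.update t a s b - Function.update t a s c)
      (((if b = a then 1 else 0) - if c = a then 1 else 0) * (t b - t c)⁻¹) (t a) := by
  have h' := sub_ne_zero.2 h
  have hu : ∀ b, HasDerivAt (fun s => Function.update t a s b) (if b = a then 1 else 0) (t a) := by
    intro b
    by_cases hb : b = a
    · subst hb; simpa using hasDerivAt_id' (t b)
    · simpa [hb] using hasDerivAt_const (t a) (t b)
  refine ⟨((hu b).sub (hu c)).congr_deriv ?_, by simpa using h'⟩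
  simp only [Function.update_eq_self]
  rw [mul_assoc, inv_mul_cancel₀ h', mul_one]

end HasLogDerivAt

theorem sum_sum_mul_ite_sub {A : Type} [Fintype A] [DecidableEq A] (g : A → A → ℂ) (a : A) :
    (∑ b, ∑ c, ((if b = a then 1 else 0) - if c = a then 1 else 0) * g b c) =
      ∑ c, (g a c - g c a) := by
  simp only [sub_mul, Finset.sum_sub_distrib, ite_mul, one_mul, zero_mul, Finset.sum_ite_eq',
    Finset.mem_univ, if_true]
  congr 1
  rw [Finset.sum_comm]
  simp

section

variable {n : ℕ} {μ : YoungDiagram} {z : Fin n → ℂ} {t : BetheVar μ → ℂ}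

/-- The colour of a variable. -/
def betheCol (μ : YoungDiagram) (a : BetheVar μ) : ℕ := a.1.val

/-- The logarithmic derivative of the product `expMaster` is the sum of the logarithmic
derivatives of its factors. Every unordered pair of variables of the same colour contributes two
factors, which gives the diagonal entries `2` of the Cartan matrix. -/
theorem masterGrad_eq (hz : Function.Injective z) (ht : Function.Injective t)
    (htz : ∀ (a : BetheVar μ) (k : Fin n), a.1.val = 0 → t a ≠ z k) (a : BetheVar μ) :
    masterGrad z t a = masterDeriv z (betheCol μ) t a := by
  classical
  have h1 : HasLogDerivAt (fun _ : ℂ => ∏ k : Fin n, ∏ l : Fin n, if k < l then z k - z l else 1)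
      0 (t a) := by
    refine ⟨by simpa using hasDerivAt_const (t a) _, ?_⟩
    refine Finset.prod_ne_zero_iff.2 fun k _ => Finset.prod_ne_zero_iff.2 fun l _ => ?_
    split_ifs with h
    · exact sub_ne_zero.2 fun h' => h.ne (hz h')
    · exact one_ne_zero
  have h2 : HasLogDerivAt (fun s : ℂ => ∏ k : Fin n, ∏ b : BetheVar μ,
      if b.1.val = 0 then (z k - Function.update t a s b)⁻¹ else 1)
      (∑ k : Fin n, ∑ b : BetheVar μ, if b.1.val = 0 then
        -(-(if b = a then 1 else 0) * (z k - t b)⁻¹) else 0) (t a) := by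
    refine HasLogDerivAt.prod _ fun k _ => HasLogDerivAt.prod _ fun b _ =>
      HasLogDerivAt.ite fun hb => HasLogDerivAt.inv ?_
    have hne := sub_ne_zero.2 (htz b k hb).symm
    by_cases hba : b = a
    · subst hba
      refine ⟨?_, by simpa using hne⟩
      have := (hasDerivAt_id (t b)).const_sub (z k)
      refine (HasDerivAt.congr_deriv (by simpa using this) (?_ : (-1 : ℂ) = _))
      simp [hne]
    · simp only [hba, if_false, neg_zero, zero_mul, Function.update_of_ne, ne_eq, not_false_iff]
      exact ⟨by simpa using hasDerivAt_const (t a) (z k - t b), hne⟩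
  have h3 : HasLogDerivAt (fun s : ℂ => ∏ b : BetheVar μ, ∏ c : BetheVar μ,
      if b.1 = c.1 ∧ b ≠ c then Function.update t a s b - Function.update t a s c else 1)
      (∑ b : BetheVar μ, ∑ c : BetheVar μ, if b.1 = c.1 ∧ b ≠ c then
        ((if b = a then 1 else 0) - if c = a then 1 else 0) * (t b - t c)⁻¹ else 0) (t a) :=
    HasLogDerivAt.prod _ fun b _ => HasLogDerivAt.prod _ fun c _ =>
      HasLogDerivAt.ite fun hb => HasLogDerivAt.sub_update (fun h => hb.2 (ht h)) a
  have h4 : HasLogDerivAt (fun s : ℂ => ∏ b : BetheVar μ, ∏ c : BetheVar μ,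
      if b.1.val + 1 = c.1.val then
        (Function.update t a s b - Function.update t a s c)⁻¹ else 1)
      (∑ b : BetheVar μ, ∑ c : BetheVar μ, if b.1.val + 1 = c.1.val then
        -(((if b = a then 1 else 0) - if c = a then 1 else 0) * (t b - t c)⁻¹) else 0) (t a) :=
    HasLogDerivAt.prod _ fun b _ => HasLogDerivAt.prod _ fun c _ =>
      HasLogDerivAt.ite fun hb => HasLogDerivAt.inv
        (HasLogDerivAt.sub_update (fun h => by have := ht h; subst this; omega) a)
  have h := (((h1.mul h2).mul h3).mul h4).logDeriv_eq
  rw [masterGrad]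
  unfold expMaster
  rw [h]
  have e2 : (∑ k : Fin n, ∑ b : BetheVar μ, if b.1.val = 0 then
        -(-(if b = a then 1 else 0) * (z k - t b)⁻¹) else 0) =
      -if betheCol μ a = 0 then ∑ k, (t a - z k)⁻¹ else 0 := by
    by_cases ha : a.1.val = 0
    · simp only [betheCol, ha, if_true]
      rw [← Finset.sum_neg_distrib]
      refine Finset.sum_congr rfl fun k _ => ?_
      rw [Finset.sum_eq_single a (fun b _ hb => by simp [hb]) (by simp), if_pos ha, if_pos rfl,
        ← neg_sub (t a), inv_neg]
      ring
    · simp only [betheCol, ha, if_false, neg_zero]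
      refine Finset.sum_eq_zero fun k _ => Finset.sum_eq_zero fun b _ => ?_
      by_cases hb : b = a
      · subst hb; simp [ha]
      · simp [hb]
  have e3 : (∑ b : BetheVar μ, ∑ c : BetheVar μ, if b.1 = c.1 ∧ b ≠ c then
        ((if b = a then 1 else 0) - if c = a then 1 else 0) * (t b - t c)⁻¹ else 0) =
      ∑ c, ((if a.1.val = c.1.val then (t a - t c)⁻¹ else 0) -
        if c.1.val = a.1.val then (t c - t a)⁻¹ else 0) := by
    rw [← sum_sum_mul_ite_sub (fun b c => if b.1.val = c.1.val then (t b - t c)⁻¹ else 0)]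
    refine Finset.sum_congr rfl fun b _ => Finset.sum_congr rfl fun c _ => ?_
    by_cases hbc : b = c
    · simp [hbc]
    · simp [hbc, Fin.ext_iff]
  have e4 : (∑ b : BetheVar μ, ∑ c : BetheVar μ, if b.1.val + 1 = c.1.val then
        -(((if b = a then 1 else 0) - if c = a then 1 else 0) * (t b - t c)⁻¹) else 0) =
      ∑ c, ((if a.1.val + 1 = c.1.val then -(t a - t c)⁻¹ else 0) -
        if c.1.val + 1 = a.1.val then -(t c - t a)⁻¹ else 0) := by
    rw [← sum_sum_mul_ite_sub (fun b c => if b.1.val + 1 = c.1.val then -(t b - t c)⁻¹ else 0)]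
    refine Finset.sum_congr rfl fun b _ => Finset.sum_congr rfl fun c _ => ?_
    split_ifs <;> ring
  rw [e2, e3, e4, masterDeriv, zero_add, add_assoc, ← Finset.sum_add_distrib, add_comm,
    sub_eq_add_neg]
  congr 1
  refine Finset.sum_congr rfl fun c _ => ?_
  rw [← neg_sub (t a) (t c), inv_neg]
  change _ = cartan a.1.val c.1.val * _
  unfold cartan
  rcases Nat.lt_trichotomy a.1.val c.1.val with hac | hac | hac
  · have h1 : ¬ c.1.val = a.1.val := by omega
    have h2 : ¬ a.1.val = c.1.val := by omega
    have h3 : ¬ c.1.val + 1 = a.1.val := by omega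
    by_cases h : a.1.val + 1 = c.1.val
    · simp only [h, h1, h2, h3, if_true, if_false, true_or]
      ring
    · simp only [h, h1, h2, h3, if_false, or_self]
      ring
  · simp [hac]
    ring
  · have h1 : ¬ c.1.val = a.1.val := by omega
    have h2 : ¬ a.1.val = c.1.val := by omega
    have h3 : ¬ a.1.val + 1 = c.1.val := by omega
    by_cases h : c.1.val + 1 = a.1.val
    · simp only [h, h1, h2, h3, if_true, if_false, or_true]
      ring
    · simp only [h, h1, h2, h3, if_false, or_self]
      ring

/-- The formula for the gradient holds in a neighbourhood of a point with distinct coordinates,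
so that it may be differentiated. -/
theorem masterHessian_eq (hz : Function.Injective z) (ht : Function.Injective t)
    (htz : ∀ (a : BetheVar μ) (k : Fin n), a.1.val = 0 → t a ≠ z k) :
    masterHessian z t = masterHess z (betheCol μ) t := by
  classical
  ext a b
  rw [masterHessian, Matrix.of_apply]
  have hev : (fun s => masterGrad z (Function.update t b s) a) =ᶠ[nhds (t b)]
      fun s => masterDeriv z (betheCol μ) (Function.update t b s) a := by
    have h1 : ∀ᶠ s in nhds (t b), ∀ c, c ≠ b → s ≠ t c := by
      refine Filter.eventually_all.2 fun c => ?_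
      by_cases hc : c = b
      · simp [hc]
      · filter_upwards [isOpen_ne.mem_nhds (show t b ≠ t c from fun h => hc (ht h).symm)] with s hs
        exact fun _ => hs
    have h2 : ∀ᶠ s in nhds (t b), ∀ k, b.1.val = 0 → s ≠ z k := by
      refine Filter.eventually_all.2 fun k => ?_
      by_cases hb : b.1.val = 0
      · filter_upwards [isOpen_ne.mem_nhds (htz b k hb)] with s hs
        exact fun _ => hs
      · simp [hb]
    filter_upwards [h1, h2] with s hs hs'
    refine masterGrad_eq hz ?_ ?_ a
    · intro c d hcd
      by_contra hne
      by_cases hc : c = b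
      · subst hc
        rw [Function.update_self, Function.update_of_ne (Ne.symm hne)] at hcd
        exact hs d (Ne.symm hne) hcd
      · by_cases hd : d = b
        · subst hd
          rw [Function.update_self, Function.update_of_ne hc] at hcd
          exact hs c hc hcd.symm
        · rw [Function.update_of_ne hc, Function.update_of_ne hd] at hcd
          exact hne (ht hcd)
    · intro c k hc
      by_cases hcb : c = b
      · subst hcb
        rw [Function.update_self]
        exact hs' k hc
      · rw [Function.update_of_ne hcb]
        exact htz c k hc
  rw [hev.deriv_eq]
  have hsep : DampedSep (fun _ : Fin n => true) z (betheCol μ) (fun _ => true) 1 t :=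
    ⟨fun a b hab => by simpa [sub_eq_zero] using fun h => hab (ht h),
      fun a k ha => by simpa [sub_eq_zero] using htz a k ha⟩
  simp only [masterDeriv_eq_dampedDeriv]
  exact (hasDerivAt_dampedDeriv hsep a b).deriv

/-- The Bethe equations and the Hessian of a Young diagram are those of coloured variables, in
the formulas without logarithms. -/
theorem isNondegenerateCritical_iff (hz : Function.Injective z) :
    IsNondegenerateCritical z t ↔ IsCritical z (betheCol μ) t := by
  constructor
  · intro h
    refine ⟨h.injective, h.ne_z, fun a => ?_, ?_⟩
    · rw [← masterGrad_eq hz h.injective h.ne_z]; exact h.grad_eq_zero a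
    · rw [← masterHessian_eq hz h.injective h.ne_z]; exact h.hessian
  · intro h
    refine ⟨h.injective, h.ne_z, fun a => ?_, ?_⟩
    · rw [masterGrad_eq hz h.injective h.ne_z]; exact h.deriv_eq_zero a
    · rw [masterHessian_eq hz h.injective h.ne_z]; exact h.hess

end

/-! ### Bethe vectors as singular vectors -/

section

variable {n : ℕ} {μ : YoungDiagram}

/-- A placement puts the variables on the cells of the word. -/
def placementEquiv (μ : YoungDiagram) (r : Fin n → Fin (μ.colLen 0)) :
    Placement μ r ≃ ColPlacement (betheCol μ) (fun k => (r k).val) where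
  toFun σ := ⟨{
    toFun := fun p => ⟨⟨p.1.2, p.2.trans (r p.1.1).isLt⟩, σ ⟨p.1.2, p.2.trans (r p.1.1).isLt⟩
      ⟨p.1.1, p.2⟩⟩
    invFun := fun a => ⟨(((σ a.1).symm a.2).1, a.1.val), ((σ a.1).symm a.2).2⟩
    left_inv := fun p => by simp
    right_inv := fun a => by simp }, fun p => rfl⟩
  invFun τ i := {
    toFun := fun k => ⟨(τ.1 ⟨(k.1, i.val), k.2⟩).2.1, by
      have h1 : (τ.1 ⟨(k.1, i.val), k.2⟩).1.val = i.val := τ.2 ⟨(k.1, i.val), k.2⟩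
      have h2 := (τ.1 ⟨(k.1, i.val), k.2⟩).2.2
      exact h1.symm.trans_lt h2⟩
    invFun := fun b => ⟨(τ.1.symm ⟨i, b⟩).1.1, by
      have h1 : _ = (τ.1.symm ⟨i, b⟩).1.2 := τ.2 (τ.1.symm ⟨i, b⟩)
      have h2 := (τ.1.symm ⟨i, b⟩).2
      rw [← h1, Equiv.apply_symm_apply] at h2
      exact h2⟩
    left_inv := fun k => by
      have h1 : (τ.1 ⟨(k.1, i.val), k.2⟩).1 = i := Fin.ext (τ.2 ⟨(k.1, i.val), k.2⟩)
      have h3 : ∀ (a : BetheVar μ) (h : a.1 = i) (h'), (⟨i, ⟨a.2.1, h'⟩⟩ : BetheVar μ) = a := by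
        rintro ⟨j, b⟩ rfl h'
        rfl
      refine Subtype.ext ?_
      simp only
      rw [h3 _ h1, Equiv.symm_apply_apply]
    right_inv := fun b => by
      have h1 : betheCol μ (τ.1 (τ.1.symm ⟨i, b⟩)) = _ := τ.2 (τ.1.symm ⟨i, b⟩)
      rw [Equiv.apply_symm_apply] at h1
      have h3 : ∀ (c : Cell fun k => (r k).val) (h : i.val = c.1.2) (h'),
          (⟨(c.1.1, i.val), h'⟩ : Cell fun k => (r k).val) = c := by
        rintro ⟨⟨k, j⟩, hj⟩ h h'
        simp only at h
        subst h
        rfl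
      refine Subtype.ext ?_
      simp only
      rw [h3 _ h1, Equiv.apply_symm_apply] }
  left_inv σ := by
    funext i
    exact Equiv.ext fun k => rfl
  right_inv τ := by
    refine Subtype.ext (Equiv.ext fun p => ?_)
    have h1 : (τ.1 p).1 = ⟨p.1.2, p.2.trans (r p.1.1).isLt⟩ := Fin.ext (τ.2 p)
    have h3 : ∀ (a : BetheVar μ) (i) (h : a.1 = i) (h'),
        (⟨i, ⟨a.2.1, h'⟩⟩ : BetheVar μ) = a := by
      rintro ⟨j, b⟩ _ rfl h'
      rfl
    exact h3 _ _ h1 _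

theorem prod_cell {w : Fin n → ℕ} (F : Fin n → ℕ → ℂ) :
    ∏ p : Cell w, F p.1.1 p.1.2 = ∏ k, ∏ i ∈ Finset.range (w k), F k i := by
  let e : ((k : Fin n) × Fin (w k)) ≃ Cell w :=
    { toFun := fun p => ⟨(p.1, p.2), p.2.2⟩
      invFun := fun p => ⟨p.1.1, ⟨p.1.2, p.2⟩⟩
      left_inv := fun _ => rfl
      right_inv := fun _ => rfl }
  rw [← e.prod_comp, Fintype.prod_sigma]
  refine Finset.prod_congr rfl fun k _ => ?_
  rw [Finset.prod_range]
  rfl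

/-- The letters of a word on whose cells the variables can be placed are rows of `μ`. The
hypothesis on the number of boxes excludes the empty diagram when there are positions. -/
theorem lt_colLen_of_colPlacement (hμ : μ.card = n) {w : Fin n → ℕ}
    (σ : ColPlacement (betheCol μ) w) (k : Fin n) : w k < μ.colLen 0 := by
  have hrow : ∀ c ∈ μ.cells, c.1 < μ.colLen 0 := fun c hc =>
    YoungDiagram.mem_iff_lt_colLen.1 (μ.isLowerSet (show (c.1, 0) ≤ c from
      ⟨le_rfl, Nat.zero_le _⟩) hc)
  rcases Nat.eq_zero_or_pos (w k) with h | h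
  · have hne : μ.cells.Nonempty := by
      rw [← Finset.card_pos]
      change 0 < μ.card
      have := k.pos
      omega
    obtain ⟨c, hc⟩ := hne
    have := hrow c hc
    omega
  · let p : Cell w := ⟨(k, w k - 1), by simp only; omega⟩
    have h1 : (σ.1 p).1.val = w k - 1 := σ.2 p
    have h2 := (σ.1 p).2.2
    have h3 := hrow _ (σ.1 p).2.1.2
    omega

/-- The sum over the words in the rows of `μ` that defines the Bethe vector has the weight
function as its coefficients; words with other letters admit no placements. -/
theorem betheVector_apply (hμ : μ.card = n) (z : Fin n → ℂ) (t : BetheVar μ → ℂ) (w : Fin n → ℕ) :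
    betheVector z t w = weightCoeff z (betheCol μ) t w := by
  classical
  rw [betheVector, Finsupp.finsetSum_apply]
  by_cases hw : ∀ k, w k < μ.colLen 0
  · let r : Fin n → Fin (μ.colLen 0) := fun k => ⟨w k, hw k⟩
    rw [Finset.sum_eq_single r]
    · rw [show w = fun k => (r k).val from rfl, Finsupp.single_eq_same, weightCoeff,
        ← (placementEquiv μ r).sum_comp]
      refine Finset.sum_congr rfl fun σ _ => ?_
      rw [cellWeight]
      have hchain : ∀ k i, chain z t r σ k i =
          cellChain z (fun p => t ((placementEquiv μ r σ).1 p)) k i := by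
        intro k i
        cases i with
        | zero => rfl
        | succ i => rfl
      rw [← prod_cell fun k i => (chain z t r σ k (i + 1) - chain z t r σ k i)⁻¹]
      refine Finset.prod_congr rfl fun p _ => ?_
      rw [hchain, hchain, cellChain_succ z _ p.2]
    · intro s _ hs
      refine Finsupp.single_eq_of_ne fun h => hs ?_
      funext k
      exact Fin.ext (congrFun h k).symm
    · simp
  · rw [Finset.sum_eq_zero, weightCoeff]
    · have : IsEmpty (ColPlacement (betheCol μ) w) :=
        ⟨fun σ => hw fun k => lt_colLen_of_colPlacement hμ σ k⟩
      simp
    · intro s _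
      refine Finsupp.single_eq_of_ne fun h => hw fun k => ?_
      rw [h]
      exact (s k).isLt

/-- The number of boxes of `μ` below row `j`. -/
def numBelow (μ : YoungDiagram) (j : ℕ) : ℕ := (μ.cells.filter fun c => j < c.1).card

theorem numBelow_succ (μ : YoungDiagram) (j : ℕ) :
    numBelow μ j = numBelow μ (j + 1) + μ.rowLen (j + 1) := by
  rw [numBelow, numBelow, YoungDiagram.rowLen_eq_card, YoungDiagram.row,
    ← Finset.card_union_of_disjoint]
  · congr 1
    ext c
    simp only [Finset.mem_filter, Finset.mem_union]
    constructor
    · rintro ⟨h1, h2⟩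
      by_cases h : c.1 = j + 1
      · exact Or.inr ⟨h1, h⟩
      · exact Or.inl ⟨h1, by omega⟩
    · rintro (⟨h1, h2⟩ | ⟨h1, h2⟩)
      · exact ⟨h1, by omega⟩
      · exact ⟨h1, by omega⟩
  · rw [Finset.disjoint_filter]
    intro c _ h1 h2
    omega

theorem card_eq_numBelow_add (μ : YoungDiagram) : μ.card = numBelow μ 0 + μ.rowLen 0 := by
  rw [numBelow, YoungDiagram.rowLen_eq_card, YoungDiagram.row, ← Finset.card_union_of_disjoint]
  · change μ.cells.card = _
    congr 1
    ext c
    simp only [Finset.mem_filter, Finset.mem_union]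
    constructor
    · intro h1
      by_cases h : c.1 = 0
      · exact Or.inr ⟨h1, h⟩
      · exact Or.inl ⟨h1, by omega⟩
    · rintro (⟨h1, h2⟩ | ⟨h1, h2⟩) <;> exact h1
  · rw [Finset.disjoint_filter]
    intro c _ h1 h2
    omega

theorem numBelow_eq_zero {j : ℕ} (h : μ.colLen 0 ≤ j) : numBelow μ j = 0 := by
  rw [numBelow, Finset.card_eq_zero, Finset.filter_eq_empty_iff]
  intro c hc
  have : c.1 < μ.colLen 0 :=
    YoungDiagram.mem_iff_lt_colLen.1 (μ.isLowerSet (show (c.1, 0) ≤ c from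
      ⟨le_rfl, Nat.zero_le _⟩) hc)
  omega

theorem card_betheCol (μ : YoungDiagram) (j : ℕ) :
    (Finset.univ.filter fun a => betheCol μ a = j).card = numBelow μ j := by
  classical
  by_cases hj : j < μ.colLen 0
  · refine Finset.card_bij' (fun a _ => a.2.1.1)
      (fun c hc => ⟨⟨j, hj⟩, ⟨⟨c, (Finset.mem_filter.1 hc).1⟩, (Finset.mem_filter.1 hc).2⟩⟩)
      ?_ ?_ ?_ ?_
    · intro a ha
      have h1 : a.1.val = j := (Finset.mem_filter.1 ha).2
      exact Finset.mem_filter.2 ⟨a.2.1.2, h1 ▸ a.2.2⟩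
    · intro c hc
      exact Finset.mem_filter.2 ⟨Finset.mem_univ _, rfl⟩
    · rintro ⟨i, b⟩ ha
      have h1 : i.val = j := (Finset.mem_filter.1 ha).2
      subst h1
      rfl
    · intro c hc
      rfl
  · rw [numBelow_eq_zero (not_lt.1 hj), Finset.card_eq_zero, Finset.filter_eq_empty_iff]
    intro a _ h
    exact hj (h ▸ a.1.2)

theorem card_filter_eq_add {n : ℕ} (w : Fin n → ℕ) (j : ℕ) :
    (Finset.univ.filter fun k => j ≤ w k).card =
      (Finset.univ.filter fun k => j < w k).card + (Finset.univ.filter fun k => w k = j).card := by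
  rw [← Finset.card_union_of_disjoint]
  · congr 1
    ext k
    simp only [Finset.mem_filter, Finset.mem_union, Finset.mem_univ, true_and]
    omega
  · rw [Finset.disjoint_filter]
    intro c _ h1 h2
    omega

/-- A coordinate function of weight `μ` which is killed by the simple raising operators defines
an element of the Specht module. -/
theorem exists_mem_specht (hμ : μ.card = n) {c : (Fin n → ℕ) → ℂ} (hk : ∀ i, Kills i (i + 1) c)
    (hw : ∀ w, c w ≠ 0 → ∀ j, (Finset.univ.filter fun k => j < w k).card = numBelow μ j) :
    ∃ v ∈ (specht n μ).toSubmodule, ∀ w, v w = c w := by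
  classical
  let S : Finset (Fin n → ℕ) := Fintype.piFinset fun _ => Finset.range (μ.colLen 0 + 1)
  have hS : ∀ w, c w ≠ 0 → w ∈ S := by
    intro w h
    refine Fintype.mem_piFinset.2 fun k => Finset.mem_range.2 ?_
    by_contra hlt
    have h1 := hw w h (μ.colLen 0)
    rw [numBelow_eq_zero le_rfl, Finset.card_eq_zero, Finset.filter_eq_empty_iff] at h1
    exact h1 (Finset.mem_univ k) (by omega)
  refine ⟨Finsupp.onFinset S c hS, ?_, fun w => rfl⟩
  rw [specht_eq_sing hμ, mem_sing]
  refine ⟨fun w h i => ?_, fun i j hij => ?_⟩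
  · have h1 := hw w h
    cases i with
    | zero =>
      have h2 := card_filter_eq_add w 0
      have h3 := card_eq_numBelow_add μ
      simp only [Nat.zero_le, Finset.filter_true, Finset.card_univ, Fintype.card_fin] at h2
      have := h1 0
      omega
    | succ i =>
      have h2 := card_filter_eq_add w (i + 1)
      have h3 := numBelow_succ μ i
      have h4 := h1 i
      have h5 := h1 (i + 1)
      simp only [Nat.succ_le_iff] at h2
      omega
  · exact kills_of_simple hk hij

/-- Bethe vectors are singular vectors of weight `μ`. -/
theorem betheVector_mem_specht (hμ : μ.card = n) {z : Fin n → ℂ} {t : BetheVar μ → ℂ}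
    (ht : IsCritical z (betheCol μ) t) : betheVector z t ∈ (specht n μ).toSubmodule := by
  obtain ⟨v, hv, h⟩ := exists_mem_specht hμ
    (fun i => kills_weightCoeff ht.injective ht.ne_z ht.deriv_eq_zero i)
    (fun w hw j => by rw [card_of_weightCoeff_ne_zero hw, card_betheCol])
  have : betheVector z t = v := Finsupp.ext fun w => by rw [h, betheVector_apply hμ]
  rwa [this]

/-! ### Reindexing the variables -/

variable {A B : Type} [Fintype A] [Fintype B] {colA : A → ℕ} {colB : B → ℕ} {z : Fin n → ℂ}

theorem masterDeriv_reindex (e : A ≃ B) (he : ∀ a, colB (e a) = colA a) (t : B → ℂ) (a : A) :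
    masterDeriv z colA (t ∘ e) a = masterDeriv z colB t (e a) := by
  rw [masterDeriv, masterDeriv, ← e.sum_comp]
  simp [he]

theorem masterHess_reindex (e : A ≃ B) (he : ∀ a, colB (e a) = colA a) (t : B → ℂ) :
    masterHess z colA (t ∘ e) = (masterHess z colB t).submatrix e e := by
  ext a b
  simp only [masterHess, dampedHess, Matrix.of_apply, Matrix.submatrix_apply, Function.comp_apply,
    he, e.injective.eq_iff]
  rw [← e.sum_comp]
  by_cases hab : a = b
  · subst hab
    simp [he]
  · simp [hab]

theorem isCritical_reindex [DecidableEq A] [DecidableEq B] (e : A ≃ B)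
    (he : ∀ a, colB (e a) = colA a) {t : B → ℂ} (h : IsCritical z colB t) :
    IsCritical z colA (t ∘ e) := by
  refine ⟨h.injective.comp e.injective, fun a k ha => h.ne_z _ k ((he a).trans ha), fun a => ?_, ?_⟩
  · rw [masterDeriv_reindex e he, h.deriv_eq_zero]
  · rw [masterHess_reindex e he, Matrix.det_submatrix_equiv_self]
    exact h.hess

theorem weightCoeff_reindex (e : A ≃ B) (he : ∀ a, colB (e a) = colA a) (t : B → ℂ)
    (w : Fin n → ℕ) : weightCoeff z colA (t ∘ e) w = weightCoeff z colB t w := by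
  let E : ColPlacement colA w ≃ ColPlacement colB w :=
    { toFun := fun σ => ⟨σ.1.trans e, fun p => (he _).trans (σ.2 p)⟩
      invFun := fun σ => ⟨σ.1.trans e.symm, fun p => by
        rw [← he]; simpa using σ.2 p⟩
      left_inv := fun σ => Subtype.ext (Equiv.ext fun p => by simp)
      right_inv := fun σ => Subtype.ext (Equiv.ext fun p => by simp) }
  rw [weightCoeff, weightCoeff, ← E.sum_comp]
  rfl

/-- Two families of coloured variables with the same numbers of variables of each colour are
equivalent. -/
theorem exists_equiv_of_card_eq
    (h : ∀ j, (Finset.univ.filter fun a => colA a = j).card =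
      (Finset.univ.filter fun b => colB b = j).card) :
    ∃ e : A ≃ B, ∀ a, colB (e a) = colA a := by
  classical
  have e : ∀ j, {a // colA a = j} ≃ {b // colB b = j} := fun j =>
    Fintype.equivOfCardEq (by rw [Fintype.card_subtype, Fintype.card_subtype, h])
  exact ⟨Equiv.ofFiberEquiv e, fun a => Equiv.ofFiberEquiv_map e a⟩

end

/-! ### Persistence of critical points -/

section

variable {m : ℕ} {A : Type} [Fintype A] {oK : Fin m → Bool} {y : Fin m → ℂ} {col : A → ℕ}
  {o : A → Bool}

theorem contDiffAt_dInv_coord {ε : ℂ} {x : A → ℂ} (h : DampedSep oK y col o ε x) (a b : A) :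
    ContDiffAt ℂ 1 (fun v : ℂ × (A → ℂ) => dInv (o a) (o b) v.1 (v.2 a) (v.2 b)) (ε, x) := by
  by_cases hab : a = b
  · subst hab
    simpa using contDiffAt_const
  · exact contDiffAt_dInv _ _ contDiffAt_fst ((contDiffAt_pi.1 contDiffAt_snd) a)
      ((contDiffAt_pi.1 contDiffAt_snd) b) (h.1 a b hab)

theorem contDiffAt_dInv_point {ε : ℂ} {x : A → ℂ} (h : DampedSep oK y col o ε x) (a : A)
    (ha : col a = 0) (k : Fin m) :
    ContDiffAt ℂ 1 (fun v : ℂ × (A → ℂ) => dInv (o a) (oK k) v.1 (v.2 a) (y k)) (ε, x) :=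
  contDiffAt_dInv _ _ contDiffAt_fst ((contDiffAt_pi.1 contDiffAt_snd) a) contDiffAt_const
    (h.2 a k ha)

theorem contDiffAt_dampedDeriv {ε : ℂ} {x : A → ℂ} (h : DampedSep oK y col o ε x) :
    ContDiffAt ℂ 1 (fun v : ℂ × (A → ℂ) => dampedDeriv oK y col o v.1 v.2) (ε, x) := by
  refine contDiffAt_pi.2 fun a => ?_
  refine ContDiffAt.sub (ContDiffAt.sum fun b _ =>
    contDiffAt_const.mul (contDiffAt_dInv_coord h a b)) ?_
  by_cases ha : col a = 0
  · simp only [ha, if_true]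
    exact ContDiffAt.sum fun k _ => contDiffAt_dInv_point h a ha k
  · simpa [ha] using contDiffAt_const

theorem continuousAt_dampedHess {ε : ℂ} {x : A → ℂ} (h : DampedSep oK y col o ε x) :
    ContinuousAt (fun v : ℂ × (A → ℂ) => dampedHess oK y col o v.1 v.2) (ε, x) := by
  have hc := fun a b => (contDiffAt_dInv_coord h a b).continuousAt
  refine continuousAt_pi.2 fun a => continuousAt_pi.2 fun b => ?_
  refine ContinuousAt.add (((hc a b).mul (hc b a)).const_mul _).neg ?_
  by_cases hab : a = b
  · simp only [hab, if_true]
    refine ContinuousAt.add (ContinuousAt.neg (tendsto_finsetSum _ fun c _ =>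
      ((hc b c).pow 2).const_mul _)) ?_
    by_cases hb : col b = 0
    · simp only [hb, if_true]
      exact tendsto_finsetSum _ fun k _ => (contDiffAt_dInv_point h b hb k).continuousAt.pow 2
    · simpa [hb] using continuousAt_const
  · simpa [hab] using continuousAt_const

theorem continuous_damp (p q : Bool) : Continuous (damp p q) := by
  unfold damp
  split_ifs
  · exact continuous_id
  · exact continuous_const

theorem eventually_dampedSep {ε : ℂ} {x : A → ℂ} (h : DampedSep oK y col o ε x) :
    ∀ᶠ v : ℂ × (A → ℂ) in nhds (ε, x), DampedSep oK y col o v.1 v.2 := by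
  have hd : ∀ p q, Continuous fun v : ℂ × (A → ℂ) => damp p q v.1 :=
    fun p q => (continuous_damp p q).comp continuous_fst
  have hx : ∀ a, Continuous fun v : ℂ × (A → ℂ) => v.2 a :=
    fun a => (continuous_apply a).comp continuous_snd
  refine Filter.Eventually.and ?_ ?_
  · refine Filter.eventually_all.2 fun a => Filter.eventually_all.2 fun b => ?_
    by_cases hab : a = b
    · simp [hab]
    · have hc : Continuous fun v : ℂ × (A → ℂ) =>
        damp (o a) (o b) v.1 * v.2 a - damp (o b) (o a) v.1 * v.2 b :=
        ((hd _ _).mul (hx a)).sub ((hd _ _).mul (hx b))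
      filter_upwards [hc.continuousAt.eventually_ne (h.1 a b hab)] with v hv _ using hv
  · refine Filter.eventually_all.2 fun a => Filter.eventually_all.2 fun k => ?_
    by_cases ha : col a = 0
    · have hc : Continuous fun v : ℂ × (A → ℂ) =>
        damp (o a) (oK k) v.1 * v.2 a - damp (oK k) (o a) v.1 * y k :=
        ((hd _ _).mul (hx a)).sub ((hd _ _).mul continuous_const)
      filter_upwards [hc.continuousAt.eventually_ne (h.2 a k ha)] with v hv _ using hv
    · simp [ha]

/-- A nondegenerate solution of the rescaled equations at `ε = 0` extends to small `ε`. -/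
theorem exists_tendsto_dampedDeriv_eq_zero [DecidableEq A] {x : A → ℂ}
    (h : DampedSep oK y col o 0 x)
    (h0 : ∀ a, dampedDeriv oK y col o 0 x a = 0) (hdet : (dampedHess oK y col o 0 x).det ≠ 0) :
    ∃ ψ : ℂ → A → ℂ, Filter.Tendsto ψ (nhds 0) (nhds x) ∧ ∀ᶠ ε in nhds 0,
      (∀ a, dampedDeriv oK y col o ε (ψ ε) a = 0) ∧ DampedSep oK y col o ε (ψ ε) ∧
        (dampedHess oK y col o ε (ψ ε)).det ≠ 0 := by
  have hs := (contDiffAt_dampedDeriv h).hasStrictFDerivAt one_ne_zero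
  set f' := fderiv ℂ (fun v : ℂ × (A → ℂ) => dampedDeriv oK y col o v.1 v.2) (0, x) with hf'
  -- the matrix of the partial derivative with respect to `x` is `dampedHess`
  have hmat : ∀ b a, f' (0, Pi.single b 1) a = dampedHess oK y col o 0 x a b := by
    intro b a
    have h1 : HasDerivAt (fun s : ℂ => ((0 : ℂ), Function.update x b s)) (0, Pi.single b 1)
        (x b) := (hasDerivAt_const _ _).prodMk (hasDerivAt_update x b (x b))
    have h2 : HasFDerivAt (fun v : ℂ × (A → ℂ) => dampedDeriv oK y col o v.1 v.2) f'
        ((0 : ℂ), Function.update x b (x b)) := by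
      rw [Function.update_eq_self]; exact hs.hasFDerivAt
    have h3 := hasDerivAt_pi.1 (h2.comp_hasDerivAt (x b) h1) a
    exact h3.unique (hasDerivAt_dampedDeriv h a b)
  have hlin : ∀ v : A → ℂ, f' (0, v) = (dampedHess oK y col o 0 x).mulVec v := by
    intro v
    have hv : ((0 : ℂ), v) = ∑ b, v b • ((0 : ℂ), (Pi.single b 1 : A → ℂ)) := by
      refine Prod.ext ?_ ?_
      · simp [Prod.fst_sum]
      · rw [Prod.snd_sum]
        funext a
        simp [Finset.sum_apply, Pi.single_apply]
    rw [hv, map_sum]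
    funext a
    rw [Finset.sum_apply, Matrix.mulVec, dotProduct]
    refine Finset.sum_congr rfl fun b _ => ?_
    rw [map_smul, Pi.smul_apply, hmat, smul_eq_mul, mul_comm]
  have hinv : (f' ∘L .inr ℂ ℂ (A → ℂ)).IsInvertible := by
    have hinj : Function.Injective (f' ∘L .inr ℂ ℂ (A → ℂ)).toLinearMap := by
      rw [injective_iff_map_eq_zero]
      intro v hv
      by_contra hne
      exact hdet (Matrix.exists_mulVec_eq_zero_iff.1 ⟨v, hne, (hlin v).symm.trans hv⟩)
    exact ⟨(LinearEquiv.ofInjectiveEndo _ hinj).toContinuousLinearEquiv, by ext; rfl⟩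
  have htend := hs.tendsto_implicitFunctionOfProdDomain hinv
  have hev := hs.eventually_apply_implicitFunctionOfProdDomain hinv
  refine ⟨hs.implicitFunctionOfProdDomain hinv, htend, ?_⟩
  have hpair : Filter.Tendsto (fun ε => (ε, hs.implicitFunctionOfProdDomain hinv ε)) (nhds 0)
      (nhds ((0 : ℂ), x)) := (Filter.tendsto_id).prodMk_nhds htend
  have hdet' : ContinuousAt (fun v : ℂ × (A → ℂ) => (dampedHess oK y col o v.1 v.2).det)
      (0, x) := (Continuous.matrix_det continuous_id).continuousAt.comp (continuousAt_dampedHess h)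
  filter_upwards [hev, hpair.eventually (eventually_dampedSep h),
    hpair.eventually (hdet'.eventually_ne hdet)] with ε h1 h2 h3
  exact ⟨fun a => (congrFun h1 a).trans (h0 a), h2, h3⟩

/-- The damping factors of two quantities are proportional to their scales. -/
theorem exists_damp_eq (p q : Bool) {ε : ℂ} (hε : ε ≠ 0) :
    ∃ c, damp p q ε = c * scl p ε ∧ damp q p ε = c * scl q ε := by
  cases p <;> cases q
  · exact ⟨ε, by simp [damp, scl, hε]⟩
  · exact ⟨ε, by simp [damp, scl, hε]⟩
  · exact ⟨ε, by simp [damp, scl, hε]⟩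
  · exact ⟨1, by simp [damp, scl]⟩

/-- A nondegenerate solution of the rescaled equations at `ε ≠ 0` is a nondegenerate critical
point in the original coordinates. -/
theorem isCritical_of_dampedDeriv [DecidableEq A] {ε : ℂ} (hε : ε ≠ 0) {x : A → ℂ}
    (h0 : ∀ a, dampedDeriv oK y col o ε x a = 0) (h : DampedSep oK y col o ε x)
    (hdet : (dampedHess oK y col o ε x).det ≠ 0) :
    IsCritical (fun k => scl (oK k) ε * y k) col (fun a => scl (o a) ε * x a) := by
  have hs : ∀ p, scl p ε ≠ 0 := by
    intro p
    cases p <;> simp [scl, hε]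
  refine ⟨fun a b hab => ?_, fun a k ha hak => ?_, fun a => ?_, fun hd => ?_⟩
  · by_contra hne
    obtain ⟨c, h1, h2⟩ := exists_damp_eq (o a) (o b) hε
    refine h.1 a b hne ?_
    rw [h1, h2, mul_assoc, mul_assoc, hab, sub_self]
  · obtain ⟨c, h1, h2⟩ := exists_damp_eq (o a) (oK k) hε
    refine h.2 a k ha ?_
    rw [h1, h2, mul_assoc, mul_assoc, hak, sub_self]
  · have := h0 a
    rw [dampedDeriv_eq oK o hε] at this
    exact (mul_eq_zero.1 this).resolve_left (hs _)
  · refine hdet ?_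
    rw [dampedHess_eq oK o hε, Matrix.det_mul, Matrix.det_mul, hd, mul_zero, zero_mul]

/-! ### The weight function at two scales -/

/-- The predecessor of a cell in its chain: a point or another cell. -/
def cellPred {w : Fin m → ℕ} (p : Cell w) : Fin m ⊕ Cell w :=
  if p.1.2 = 0 then Sum.inl p.1.1
  else Sum.inr ⟨(p.1.1, p.1.2 - 1), lt_of_le_of_lt (Nat.sub_le _ _) p.2⟩

theorem cellChain_eq_cellPred {w : Fin m → ℕ} (z : Fin m → ℂ) (x : Cell w → ℂ) (p : Cell w) :
    cellChain z x p.1.1 p.1.2 = Sum.elim z x (cellPred p) := by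
  obtain ⟨⟨k, i⟩, hi⟩ := p
  cases i with
  | zero => rfl
  | succ i =>
    have hi' : i < w k := lt_of_le_of_lt (Nat.le_succ i) hi
    exact cellChain_succ z x hi'

variable (oK y col o)

/-- The weight function in rescaled variables. -/
def dampedWeight (ε : ℂ) (x : A → ℂ) (w : Fin m → ℕ) : ℂ :=
  ∑ σ : ColPlacement col w, ∏ p : Cell w,
    dInv (o (σ.1 p)) (Sum.elim oK (fun p => o (σ.1 p)) (cellPred p)) ε (x (σ.1 p))
      (Sum.elim y (fun p => x (σ.1 p)) (cellPred p))

variable {oK y col o}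

/-- Every variable occurs in exactly one cell, so that the rescaling multiplies the weight
function by the product of the scales of all variables. -/
theorem dampedWeight_eq {ε : ℂ} (hε : ε ≠ 0) (x : A → ℂ) (w : Fin m → ℕ) :
    dampedWeight oK y col o ε x w = (∏ a, scl (o a) ε) *
      weightCoeff (fun k => scl (oK k) ε * y k) col (fun a => scl (o a) ε * x a) w := by
  rw [dampedWeight, weightCoeff, Finset.mul_sum]
  refine Finset.sum_congr rfl fun σ _ => ?_
  rw [cellWeight, ← σ.1.prod_comp, ← Finset.prod_mul_distrib]
  refine Finset.prod_congr rfl fun p _ => ?_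
  rw [dInv_eq _ _ hε, cellChain_eq_cellPred]
  cases cellPred p <;> rfl

theorem continuousAt_dampedWeight {ε : ℂ} {x : A → ℂ} (h : DampedSep oK y col o ε x)
    (w : Fin m → ℕ) :
    ContinuousAt (fun v : ℂ × (A → ℂ) => dampedWeight oK y col o v.1 v.2 w) (ε, x) := by
  refine tendsto_finsetSum _ fun σ _ => tendsto_finsetProd _ fun p _ => ?_
  by_cases hp : p.1.2 = 0
  · simp only [cellPred, if_pos hp, Sum.elim_inl]
    exact (contDiffAt_dInv_point h _ ((σ.2 p).trans hp) _).continuousAt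
  · simp only [cellPred, if_neg hp, Sum.elim_inr]
    exact (contDiffAt_dInv_coord h _ _).continuousAt

end

/-! ### Weighted graph Laplacians -/

/-- The Laplacian of a weighted graph with a positive absorption at some vertex of each component
is nonsingular. -/
theorem det_laplacian_ne_zero {ι : Type} [Fintype ι] [DecidableEq ι] {k : ι → ι → ℝ} {c : ι → ℝ}
    (hsymm : ∀ i j, k i j = k j i) (hk : ∀ i j, i ≠ j → 0 ≤ k i j) (hc : ∀ i, 0 ≤ c i)
    (hconn : ∀ δ : ι → ℝ, (∀ i j, i ≠ j → k i j ≠ 0 → δ i = δ j) → (∀ i, c i ≠ 0 → δ i = 0) →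
      δ = 0) :
    (Matrix.of fun i j => (if i = j then ∑ l, k i l + c i else 0) - k i j).det ≠ 0 := by
  intro hdet
  obtain ⟨δ, hne, hδ⟩ := Matrix.exists_mulVec_eq_zero_iff.2 hdet
  refine hne ?_
  have h1 : ∀ i, (∑ l, k i l + c i) * δ i - ∑ j, k i j * δ j = 0 := by
    intro i
    have := congrFun hδ i
    simpa [Matrix.mulVec, dotProduct, sub_mul, Finset.sum_sub_distrib] using this
  -- the quadratic form of the Laplacian at `δ`
  have h2 : (∑ i, c i * δ i ^ 2) + (1 / 2) * ∑ i, ∑ j, k i j * (δ i - δ j) ^ 2 = 0 := by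
    have h3 : ∑ i, δ i * ((∑ l, k i l + c i) * δ i - ∑ j, k i j * δ j) = 0 :=
      Finset.sum_eq_zero fun i _ => by rw [h1, mul_zero]
    have h4 : ∑ i, ∑ j, k i j * (δ i - δ j) ^ 2 =
        2 * ∑ i, ∑ j, (k i j * δ i ^ 2 - k i j * δ i * δ j) := by
      have h5 : ∑ i, ∑ j, k i j * δ j ^ 2 = ∑ i, ∑ j, k i j * δ i ^ 2 := by
        rw [Finset.sum_comm]
        exact Finset.sum_congr rfl fun i _ => Finset.sum_congr rfl fun j _ => by rw [hsymm]
      have h6 : ∑ i, ∑ j, k i j * (δ i - δ j) ^ 2 = ∑ i, ∑ j, k i j * δ i ^ 2 +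
          ∑ i, ∑ j, k i j * δ j ^ 2 - 2 * ∑ i, ∑ j, k i j * δ i * δ j := by
        simp only [Finset.mul_sum, ← Finset.sum_add_distrib, ← Finset.sum_sub_distrib]
        exact Finset.sum_congr rfl fun i _ => Finset.sum_congr rfl fun j _ => by ring
      rw [h6, h5]
      simp only [Finset.sum_sub_distrib]
      ring
    rw [h4, ← h3]
    rw [← mul_assoc, show (1 / 2 : ℝ) * 2 = 1 by norm_num, one_mul, ← Finset.sum_add_distrib]
    refine Finset.sum_congr rfl fun i _ => ?_
    rw [Finset.sum_sub_distrib, ← Finset.sum_mul, mul_sub, Finset.mul_sum]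
    rw [Finset.sum_congr rfl fun j _ => show δ i * (k i j * δ j) = k i j * δ i * δ j by ring]
    ring
  have hterm : ∀ i j, 0 ≤ k i j * (δ i - δ j) ^ 2 := by
    intro i j
    by_cases hij : i = j
    · simp [hij]
    · exact mul_nonneg (hk i j hij) (sq_nonneg _)
  have hA : 0 ≤ ∑ i, c i * δ i ^ 2 :=
    Finset.sum_nonneg fun i _ => mul_nonneg (hc i) (sq_nonneg _)
  have hB : 0 ≤ ∑ i, ∑ j, k i j * (δ i - δ j) ^ 2 :=
    Finset.sum_nonneg fun i _ => Finset.sum_nonneg fun j _ => hterm i j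
  have hA0 : ∑ i, c i * δ i ^ 2 = 0 := by linarith
  have hB0 : ∑ i, ∑ j, k i j * (δ i - δ j) ^ 2 = 0 := by linarith
  rw [Finset.sum_eq_zero_iff_of_nonneg fun i _ => mul_nonneg (hc i) (sq_nonneg _)] at hA0
  rw [Finset.sum_eq_zero_iff_of_nonneg fun i _ => Finset.sum_nonneg fun j _ => hterm i j] at hB0
  refine hconn δ (fun i j hij hkij => ?_) fun i hi => ?_
  · have := hB0 i (Finset.mem_univ _)
    rw [Finset.sum_eq_zero_iff_of_nonneg fun j _ => hterm i j] at this
    have h7 := (mul_eq_zero.1 (this j (Finset.mem_univ _))).resolve_left hkij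
    exact sub_eq_zero.1 (pow_eq_zero_iff two_ne_zero |>.1 h7)
  · have h7 := (mul_eq_zero.1 (hA0 i (Finset.mem_univ _))).resolve_left hi
    exact pow_eq_zero_iff two_ne_zero |>.1 h7

/-! ### The variables that follow a distant point -/

section

variable (lam : ℕ → ℕ) (r : ℕ)

/-- The hook length of the box in row `j` of the column in which a box is added to row `r` of the
diagram with the rows `lam`. -/
def hgt (j : ℕ) : ℝ := (lam j : ℝ) - lam r + (r - 1 - j)

/-- The limiting positions of the new variables relative to the distant point, which is at `1`;
the new variable of colour `i` is at `limPt (i + 1)`. -/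
def limPt (k : ℕ) : ℝ := ∏ j ∈ Finset.range k, hgt lam r j / (hgt lam r j + 1)

variable {lam r}

theorem limPt_zero : limPt lam r 0 = 1 := by simp [limPt]

theorem limPt_succ (k : ℕ) :
    limPt lam r (k + 1) = limPt lam r k * (hgt lam r k / (hgt lam r k + 1)) :=
  Finset.prod_range_succ _ _

variable (hr : ∀ i < r, lam r < lam i)
include hr

theorem hgt_pos {i : ℕ} (hi : i < r) : 0 < hgt lam r i := by
  have h1 : (lam r : ℝ) + 1 ≤ lam i := by exact_mod_cast hr i hi
  have h2 : (i : ℝ) + 1 ≤ r := by exact_mod_cast hi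
  unfold hgt
  linarith

theorem limPt_pos {k : ℕ} (hk : k ≤ r) : 0 < limPt lam r k :=
  Finset.prod_pos fun j hj => by
    have := hgt_pos hr ((Finset.mem_range.1 hj).trans_le hk)
    positivity

theorem limPt_lt {i j : ℕ} (hij : i < j) (hj : j ≤ r) : limPt lam r j < limPt lam r i := by
  induction j, hij using Nat.le_induction with
  | base =>
    rw [limPt_succ]
    have h1 := hgt_pos hr (show i < r by omega)
    have h2 := limPt_pos hr (show i ≤ r by omega)
    have h3 : hgt lam r i / (hgt lam r i + 1) < 1 := by
      rw [div_lt_one (by positivity)]; linarith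
    nlinarith
  | succ j hij ih =>
    refine lt_trans ?_ (ih (by omega))
    rw [limPt_succ]
    have h1 := hgt_pos hr (show j < r by omega)
    have h2 := limPt_pos hr (show j ≤ r by omega)
    have h3 : hgt lam r j / (hgt lam r j + 1) < 1 := by
      rw [div_lt_one (by positivity)]; linarith
    nlinarith

theorem limPt_ne {i j : ℕ} (hij : i ≠ j) (hi : i ≤ r) (hj : j ≤ r) :
    limPt lam r i ≠ limPt lam r j := by
  rcases lt_or_gt_of_ne hij with h | h
  · exact (limPt_lt hr h hj).ne'
  · exact (limPt_lt hr h hi).ne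

/-- The equations for the limiting positions. -/
theorem limPt_equation {i : ℕ} (hi : i < r) :
    (limPt lam r (i + 1) - limPt lam r i)⁻¹ +
      (if i + 1 < r then (limPt lam r (i + 1) - limPt lam r (i + 1 + 1))⁻¹ else 0) +
        ((lam i : ℝ) - lam (i + 1)) * (limPt lam r (i + 1))⁻¹ = 0 := by
  have h1 := hgt_pos hr hi
  have h2 := limPt_pos hr hi.le
  have h3 := limPt_pos hr (show i + 1 ≤ r from hi)
  have e1 : (limPt lam r (i + 1) - limPt lam r i)⁻¹ =
      -hgt lam r i * (limPt lam r (i + 1))⁻¹ := by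
    have : limPt lam r (i + 1) - limPt lam r i = -(limPt lam r (i + 1) / hgt lam r i) := by
      rw [limPt_succ]; field_simp; ring
    rw [this, inv_neg, inv_div]
    ring
  rw [e1]
  by_cases h : i + 1 < r
  · have h4 := hgt_pos hr h
    have e2 : (limPt lam r (i + 1) - limPt lam r (i + 1 + 1))⁻¹ =
        (hgt lam r (i + 1) + 1) * (limPt lam r (i + 1))⁻¹ := by
      have : limPt lam r (i + 1) - limPt lam r (i + 1 + 1) =
          limPt lam r (i + 1) / (hgt lam r (i + 1) + 1) := by
        rw [limPt_succ (i + 1)]; field_simp; ring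
      rw [this, inv_div]
      ring
    rw [if_pos h, e2]
    simp only [hgt]
    push_cast
    ring
  · have : r = i + 1 := by omega
    rw [if_neg h]
    subst this
    simp only [hgt]
    push_cast
    ring

end

/-- The entries of the Cartan matrix of type `A` as real numbers. -/
def cartanReal (i j : ℕ) : ℝ := if i = j then 2 else if i + 1 = j ∨ j + 1 = i then -1 else 0

theorem ofReal_cartanReal (i j : ℕ) : ((cartanReal i j : ℝ) : ℂ) = cartan i j := by
  unfold cartanReal cartan
  split_ifs <;> simp

theorem cartanReal_comm (i j : ℕ) : cartanReal i j = cartanReal j i := by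
  unfold cartanReal
  simp only [eq_comm (a := i) (b := j), or_comm (a := i + 1 = j)]

/-- Only the neighbours of `i` contribute to a sum with the Cartan matrix if the diagonal term
vanishes. -/
theorem sum_cartan_mul {r i : ℕ} (hi : i < r) (f : ℕ → ℂ) (hf : f i = 0) :
    ∑ j : Fin r, cartan i j * f j =
      -(if 0 < i then f (i - 1) else 0) - if i + 1 < r then f (i + 1) else 0 := by
  rw [Fin.sum_univ_eq_sum_range fun j => cartan i j * f j]
  have h1 : ∀ j, cartan i j * f j =
      -(if j = i - 1 then (if 0 < i then f j else 0) else 0) - if j = i + 1 then f j else 0 := by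
    intro j
    unfold cartan
    by_cases h1 : i = j
    · subst h1
      have : ¬ (i = i - 1 ∧ 0 < i) := by omega
      simp [hf]
    · by_cases h2 : i + 1 = j
      · subst h2
        have : ¬ i + 1 = i - 1 := by omega
        simp [this]
      · have h2' : ¬ j = i + 1 := fun h => h2 h.symm
        by_cases h3 : j + 1 = i
        · subst h3
          simp [h2, h2']
        · by_cases h4 : j = i - 1
          · have h5 : ¬ 0 < i := by omega
            simp [h1, h2, h2', h3, h5]
          · simp [h1, h2, h2', h3, h4]
  rw [Finset.sum_congr rfl fun j _ => h1 j, Finset.sum_sub_distrib, Finset.sum_neg_distrib,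
    Finset.sum_ite_eq', Finset.sum_ite_eq']
  simp only [Finset.mem_range]
  rw [if_pos (by omega)]

section

variable {n : ℕ} {B : Type} [Fintype B] (z : Fin n → ℂ) (colB : B → ℕ) (s : B → ℂ)
  (lam : ℕ → ℕ) (r : ℕ)

/-- The kinds of the points: the first one is distant. -/
def farPtKind (n : ℕ) : Fin (n + 1) → Bool := Fin.cons false fun _ => true

/-- The kinds of the variables: the new ones are distant. -/
def farKind (B : Type) (r : ℕ) : Fin r ⊕ B → Bool := Sum.elim (fun _ => false) fun _ => true

/-- The colours of the variables; there is one new variable of each colour `i < r`. -/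
def farCol : Fin r ⊕ B → ℕ := Sum.elim (fun i => i.val) colB

/-- The rescaled points. -/
def farPoint : Fin (n + 1) → ℂ := Fin.cons 1 z

/-- The limits of the rescaled variables. -/
def farLimit : Fin r ⊕ B → ℂ := Sum.elim (fun i => ((limPt lam r (i.val + 1) : ℝ) : ℂ)) s

variable {z colB s lam r}

/-- The new variables tend to different nonzero multiples of the distant point, and the old
variables to the given critical point. -/
theorem dampedSep_farLimit [DecidableEq B] (hr : ∀ i < r, lam r < lam i)
    (hs : IsCritical z colB s) :
    DampedSep (farPtKind n) (farPoint z) (farCol colB r) (farKind B r) 0 (farLimit s lam r) := by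
  have hpos : ∀ i : Fin r, ((limPt lam r (i.val + 1) : ℝ) : ℂ) ≠ 0 := fun i => by
    exact_mod_cast (limPt_pos hr (show i.val + 1 ≤ r from i.2)).ne'
  refine ⟨?_, ?_⟩
  · rintro (i | a) (j | b) hab
    · have h1 : i.val ≠ j.val := fun h => hab (by rw [Fin.ext h])
      have h2 := limPt_ne hr (show i.val + 1 ≠ j.val + 1 by omega) i.2 j.2
      simpa [farKind, farLimit, damp, sub_eq_zero] using h2
    · simpa [farKind, farLimit, damp] using hpos i
    · simpa [farKind, farLimit, damp] using hpos j
    · have h1 : a ≠ b := fun h => hab (by rw [h])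
      simpa [farKind, farLimit, damp, sub_eq_zero] using fun h => h1 (hs.injective h)
  · rintro (i | a) k ha
    · refine Fin.cases ?_ (fun k => ?_) k
      · have h2 := limPt_ne hr (show i.val + 1 ≠ 0 by omega) i.2 (Nat.zero_le _)
        rw [limPt_zero] at h2
        simpa [farKind, farPtKind, farPoint, farLimit, damp, sub_eq_zero] using
          (by exact_mod_cast h2 : ((limPt lam r (i.val + 1) : ℝ) : ℂ) ≠ 1)
      · simpa [farKind, farPtKind, farPoint, farLimit, damp] using hpos i
    · refine Fin.cases ?_ (fun k => ?_) k
      · simp [farKind, farPtKind, farPoint, farLimit, damp]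
      · simpa [farKind, farPtKind, farPoint, farLimit, damp, sub_eq_zero] using hs.ne_z a k ha

theorem dInv_true_false_zero (x y : ℂ) : dInv true false 0 x y = 0 := by
  simp [dInv, damp]

theorem dInv_false_true_zero (x y : ℂ) : dInv false true 0 x y = x⁻¹ := by
  simp [dInv, damp]

/-- The limits solve the rescaled equations at `ε = 0`: the old variables do not feel the distant
ones, and the new variables feel the old variables and points only through their total charge, as
if they were all at `0`. The hypothesis `hcharge` says that the charge of colour `i` is that of
the weight `lam`. -/
theorem dampedDeriv_farLimit [DecidableEq B] (hr : ∀ i < r, lam r < lam i)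
    (hcharge : ∀ i < r, ∑ b, cartan i (colB b) - (if i = 0 then (n : ℂ) else 0) =
      lam (i + 1) - lam i)
    (hs : IsCritical z colB s) (a : Fin r ⊕ B) :
    dampedDeriv (farPtKind n) (farPoint z) (farCol colB r) (farKind B r) 0 (farLimit s lam r) a =
      0 := by
  rcases a with i | a
  · simp only [dampedDeriv, Fintype.sum_sum_type, farCol, farKind, farLimit, Sum.elim_inl,
      Sum.elim_inr, dInv_kind_self, dInv_false_true_zero, Fin.sum_univ_succ, farPtKind, farPoint,
      Fin.cons_zero, Fin.cons_succ]
    rw [sum_cartan_mul i.2 (fun j => (((limPt lam r (i.val + 1) : ℝ) : ℂ) -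
      ((limPt lam r (j + 1) : ℝ) : ℂ))⁻¹) (by simp), ← Finset.sum_mul]
    have h1 := hcharge i i.2
    have h2 := limPt_equation hr i.2
    have h3 : ((((limPt lam r (i.val + 1) - limPt lam r i.val)⁻¹ +
      (if i.val + 1 < r then (limPt lam r (i.val + 1) - limPt lam r (i.val + 1 + 1))⁻¹ else 0) +
        ((lam i.val : ℝ) - lam (i.val + 1)) * (limPt lam r (i.val + 1))⁻¹ : ℝ)) : ℂ) = 0 := by
      rw [h2]; simp
    push_cast [apply_ite] at h3
    rcases Nat.eq_zero_or_pos i.val with hi | hi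
    · simp only [hi, limPt_zero, Finset.sum_const, Finset.card_univ, Fintype.card_fin,
        nsmul_eq_mul, if_true, lt_irrefl, if_false, zero_add] at h1 h3 ⊢
      push_cast at h3
      split_ifs at h3 ⊢ <;>
        linear_combination -h3 + h1 * (((limPt lam r 1 : ℝ) : ℂ))⁻¹
    · have hi' : i.val ≠ 0 := by omega
      simp only [hi, hi', if_true, if_false, sub_zero, Nat.sub_add_cancel hi] at h1 h3 ⊢
      split_ifs at h3 ⊢ <;>
        linear_combination -h3 + h1 * (((limPt lam r (i.val + 1) : ℝ) : ℂ))⁻¹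
  · have h := hs.deriv_eq_zero a
    simp only [dampedDeriv, Fintype.sum_sum_type, farCol, farKind, farLimit, Sum.elim_inl,
      Sum.elim_inr, dInv_kind_self, dInv_true_false_zero, Fin.sum_univ_succ, farPtKind, farPoint,
      Fin.cons_zero, Fin.cons_succ, mul_zero, Finset.sum_const_zero, zero_add]
    exact h

/-- The Hessian at `ε = 0` is block diagonal. One block is the Hessian of the old critical point,
the other one is the Laplacian of a path whose vertices are the new variables; the first of them
is also joined to the distant point, which makes the Laplacian nonsingular. -/
theorem det_dampedHess_farLimit [DecidableEq B] (hr : ∀ i < r, lam r < lam i)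
    (hlam : Antitone lam)
    (hcharge : ∀ i < r, ∑ b, cartan i (colB b) - (if i = 0 then (n : ℂ) else 0) =
      lam (i + 1) - lam i)
    (hs : IsCritical z colB s) :
    (dampedHess (farPtKind n) (farPoint z) (farCol colB r) (farKind B r) 0
      (farLimit s lam r)).det ≠ 0 := by
  classical
  let k : Fin r → Fin r → ℝ := fun i j =>
    -(cartanReal i j * ((limPt lam r (i.val + 1) - limPt lam r (j.val + 1))⁻¹) ^ 2)
  let c : Fin r → ℝ := fun i =>
    ((lam i.val : ℝ) - lam (i.val + 1)) * ((limPt lam r (i.val + 1))⁻¹) ^ 2 +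
      if i.val = 0 then ((limPt lam r (i.val + 1) - 1)⁻¹) ^ 2 else 0
  have hk : (Matrix.of fun i j => (if i = j then ∑ l, k i l + c i else 0) - k i j).det ≠ 0 := by
    have hne : ∀ i j : Fin r, i ≠ j → limPt lam r (i.val + 1) - limPt lam r (j.val + 1) ≠ 0 :=
      fun i j hij => sub_ne_zero.2 (limPt_ne hr
        (fun h => hij (Fin.ext (Nat.succ_injective h))) i.2 j.2)
    refine det_laplacian_ne_zero (fun i j => ?_) (fun i j hij => ?_) (fun i => ?_) fun δ h1 h2 => ?_
    · simp only [k]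
      rw [cartanReal_comm, ← neg_sub (limPt lam r (j.val + 1)), inv_neg, neg_sq]
    · simp only [k]
      have h : cartanReal i j ≤ 0 := by
        unfold cartanReal
        rw [if_neg fun h => hij (Fin.ext h)]
        split_ifs <;> norm_num
      have := sq_nonneg ((limPt lam r (i.val + 1) - limPt lam r (j.val + 1))⁻¹)
      nlinarith
    · have h3 : (lam (i.val + 1) : ℝ) ≤ lam i.val := by exact_mod_cast hlam (Nat.le_succ _)
      have h4 := sub_nonneg.2 h3
      simp only [c]
      split_ifs <;> positivity
    · -- along the path the values of `δ` agree, and the absorption at its first vertex is positive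
      have h3 : ∀ m (hm : m < r), δ ⟨m, hm⟩ = 0 := by
        intro m
        induction m with
        | zero =>
          intro hm
          refine h2 _ ?_
          have h3 : (lam (0 + 1) : ℝ) ≤ lam 0 := by exact_mod_cast hlam (Nat.le_succ _)
          have h4 := sub_nonneg.2 h3
          have h5 : limPt lam r (0 + 1) - 1 ≠ 0 := by
            rw [← limPt_zero (lam := lam) (r := r)]
            exact sub_ne_zero.2 (limPt_ne hr (by omega) hm (Nat.zero_le _))
          simp only [c, if_true]
          positivity
        | succ m ih =>
          intro hm
          rw [← ih (by omega)]
          refine h1 _ _ (by simp) ?_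
          have h5 := hne ⟨m + 1, hm⟩ ⟨m, by omega⟩ (by simp)
          simp only at h5
          simp [k, cartanReal, h5]
      funext i
      exact h3 i.1 i.2
  have hM : dampedHess (farPtKind n) (farPoint z) (farCol colB r) (farKind B r) 0
      (farLimit s lam r) = Matrix.fromBlocks
        ((Matrix.of fun i j => (if i = j then ∑ l, k i l + c i else 0) - k i j).map Complex.ofReal)
        0 0 (masterHess z colB s) := by
    ext a b
    rcases a with i | a <;> rcases b with j | b
    · simp only [dampedHess, Matrix.of_apply, Fintype.sum_sum_type, farCol, farKind, farLimit,
        Sum.elim_inl, Sum.elim_inr, dInv_kind_self, dInv_false_true_zero, Fin.sum_univ_succ,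
        farPtKind, farPoint, Fin.cons_zero, Fin.cons_succ, Matrix.fromBlocks_apply₁₁,
        Matrix.map_apply, ← Finset.sum_mul, Sum.inl.injEq]
      have h1 := hcharge i i.2
      by_cases hij : i = j
      · subst hij
        simp only [if_true, k, c]
        push_cast [apply_ite]
        simp only [ofReal_cartanReal]
        rcases Nat.eq_zero_or_pos i.val with hi | hi
        · simp only [hi, if_true, Finset.sum_const, Finset.card_univ, Fintype.card_fin,
            nsmul_eq_mul, Finset.sum_neg_distrib] at h1 ⊢
          simp only [sub_self, inv_zero]
          linear_combination (-((((limPt lam r 1 : ℝ) : ℂ))⁻¹) ^ 2) * h1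
        · have hi' : i.val ≠ 0 := by omega
          simp only [hi', if_false, sub_zero, Finset.sum_neg_distrib] at h1 ⊢
          simp only [sub_self, inv_zero]
          linear_combination (-((((limPt lam r (i.val + 1) : ℝ) : ℂ))⁻¹) ^ 2) * h1
      · simp only [hij, if_false, k]
        push_cast
        rw [ofReal_cartanReal, ← neg_sub (((limPt lam r (i.val + 1) : ℝ) : ℂ)), inv_neg]
        ring
    · simp [dampedHess, farKind, dInv_true_false_zero]
    · simp [dampedHess, farKind, dInv_true_false_zero]
    · simp only [dampedHess, masterHess, Matrix.of_apply, Fintype.sum_sum_type, farCol, farKind,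
        farLimit, Sum.elim_inl, Sum.elim_inr, dInv_kind_self, dInv_true_false_zero,
        Fin.sum_univ_succ, farPtKind, farPoint, Fin.cons_zero, Fin.cons_succ,
        Matrix.fromBlocks_apply₂₂, Sum.inr.injEq]
      simp
  rw [hM, Matrix.det_fromBlocks_zero₂₁]
  refine mul_ne_zero ?_ hs.hess
  have h5 : ((Matrix.of fun i j => (if i = j then ∑ l, k i l + c i else 0) - k i j).map
      Complex.ofReal).det = ((Matrix.of fun i j =>
        (if i = j then ∑ l, k i l + c i else 0) - k i j).det : ℂ) :=
    (RingHom.map_det Complex.ofRealHom _).symm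
  rw [h5]
  exact_mod_cast hk

end

/-! ### Bethe vectors when a point moves away -/

section

variable {n : ℕ} {B : Type} {z : Fin n → ℂ} {colB : B → ℕ} {s : B → ℂ}
  {lam : ℕ → ℕ} {r : ℕ}

/-- In a nonzero term of the limit the new variables follow the distant point. -/
theorem eq_inl_of_prod_ne_zero {j : ℕ} {w : Fin n → ℕ}
    {σ : ColPlacement (farCol colB r) (Fin.cons j w : Fin (n + 1) → ℕ)}
    (h : ∏ p : Cell (Fin.cons j w : Fin (n + 1) → ℕ),
      dInv (farKind B r (σ.1 p))
        (Sum.elim (farPtKind n) (fun p => farKind B r (σ.1 p)) (cellPred p)) 0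
        (farLimit s lam r (σ.1 p))
        (Sum.elim (farPoint z) (fun p => farLimit s lam r (σ.1 p)) (cellPred p)) ≠ 0)
    (i : ℕ) (hi : i < (Fin.cons j w : Fin (n + 1) → ℕ) 0) :
    ∃ hir : i < r, σ.1 ⟨(0, i), hi⟩ = Sum.inl ⟨i, hir⟩ := by
  rw [Finset.prod_ne_zero_iff] at h
  have hkind : ∀ (i : ℕ) (hi : i < (Fin.cons j w : Fin (n + 1) → ℕ) 0),
      farKind B r (σ.1 ⟨(0, i), hi⟩) = false := by
    intro i
    induction i with
    | zero =>
      intro hi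
      by_contra hne
      rw [Bool.not_eq_false] at hne
      refine h ⟨(0, 0), hi⟩ (Finset.mem_univ _) ?_
      rw [hne]
      exact dInv_true_false_zero _ _
    | succ i ih =>
      intro hi
      by_contra hne
      rw [Bool.not_eq_false] at hne
      refine h ⟨(0, i + 1), hi⟩ (Finset.mem_univ _) ?_
      have hp : cellPred (⟨(0, i + 1), hi⟩ : Cell (Fin.cons j w : Fin (n + 1) → ℕ)) =
        Sum.inr ⟨(0, i), lt_of_le_of_lt (Nat.le_succ i) hi⟩ := rfl
      rw [hne, hp, Sum.elim_inr, Sum.elim_inr, ih]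
      exact dInv_true_false_zero _ _
  have h1 := hkind i hi
  have h2 := σ.2 ⟨(0, i), hi⟩
  rcases hσ : σ.1 ⟨(0, i), hi⟩ with a | b
  · rw [hσ] at h2
    have h3 : a.val = i := h2
    exact ⟨h3 ▸ a.2, congrArg Sum.inl (Fin.ext h3)⟩
  · rw [hσ] at h1
    exact absurd h1 (by simp [farKind])

/-- Only the `r` new variables can follow the distant point in the limit, so that its letter is
at most `r`. -/
theorem dampedWeight_farLimit_of_lt [Fintype B] {j : ℕ} (hj : r < j) (w : Fin n → ℕ) :
    dampedWeight (farPtKind n) (farPoint z) (farCol colB r) (farKind B r) 0 (farLimit s lam r)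
      (Fin.cons j w : Fin (n + 1) → ℕ) = 0 := by
  refine Finset.sum_eq_zero fun σ _ => ?_
  by_contra h
  obtain ⟨h1, -⟩ := eq_inl_of_prod_ne_zero h r hj
  exact lt_irrefl _ h1

/-- The cells of a word with the first letter `r`. -/
def consCell (r : ℕ) (w : Fin n → ℕ) :
    Fin r ⊕ Cell w → Cell (Fin.cons r w : Fin (n + 1) → ℕ) :=
  Sum.elim (fun i => ⟨(0, i.val), i.2⟩) fun p => ⟨(p.1.1.succ, p.1.2), p.2⟩

theorem consCell_bijective (r : ℕ) (w : Fin n → ℕ) : Function.Bijective (consCell r w) := by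
  constructor
  · rintro (i | p) (j | q) h
    · have h1 : i.val = j.val := congrArg (fun p => p.1.2) h
      rw [Fin.ext h1]
    · have h1 : (0 : Fin (n + 1)) = q.1.1.succ := congrArg (fun p => p.1.1) h
      exact absurd h1.symm (Fin.succ_ne_zero _)
    · have h1 : p.1.1.succ = (0 : Fin (n + 1)) := congrArg (fun p => p.1.1) h
      exact absurd h1 (Fin.succ_ne_zero _)
    · have h1 : p.1.1.succ = q.1.1.succ := congrArg (fun p => p.1.1) h
      have h2 : p.1.2 = q.1.2 := congrArg (fun p => p.1.2) h
      rw [Subtype.ext (Prod.ext (Fin.succ_injective _ h1) h2)]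
  · rintro ⟨⟨k, i⟩, h⟩
    revert h
    refine Fin.cases ?_ (fun k => ?_) k
    · intro h
      exact ⟨Sum.inl ⟨i, h⟩, rfl⟩
    · intro h
      exact ⟨Sum.inr ⟨(k, i), h⟩, rfl⟩

/-- The cells of a word with the first letter `r`, as an equivalence. -/
def consCellEquiv (r : ℕ) (w : Fin n → ℕ) :
    Fin r ⊕ Cell w ≃ Cell (Fin.cons r w : Fin (n + 1) → ℕ) :=
  Equiv.ofBijective _ (consCell_bijective r w)

/-- The placement of all variables, where the new ones follow the first point. -/
def consPlacement {w : Fin n → ℕ} (τ : ColPlacement colB w) :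
    ColPlacement (farCol colB r) (Fin.cons r w : Fin (n + 1) → ℕ) :=
  ⟨(consCellEquiv r w).symm.trans (Equiv.sumCongr (Equiv.refl _) τ.1), fun p => by
    obtain ⟨q, rfl⟩ := (consCellEquiv r w).surjective p
    change farCol colB r (Sum.map id τ.1 ((consCellEquiv r w).symm (consCellEquiv r w q))) = _
    rw [Equiv.symm_apply_apply]
    rcases q with i | q
    · rfl
    · exact τ.2 q⟩

theorem consPlacement_apply {w : Fin n → ℕ} (τ : ColPlacement colB w) (q : Fin r ⊕ Cell w) :
    (consPlacement (r := r) τ).1 (consCellEquiv r w q) = Sum.map id τ.1 q := by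
  simp [consPlacement]

/-- A placement for which the new variables follow the first point comes from a placement of the old
variables at the other points. -/
theorem exists_consPlacement_eq {w : Fin n → ℕ}
    {σ : ColPlacement (farCol colB r) (Fin.cons r w : Fin (n + 1) → ℕ)}
    (h : ∀ i : Fin r, σ.1 (consCellEquiv r w (Sum.inl i)) = Sum.inl i) :
    ∃ τ : ColPlacement colB w, consPlacement τ = σ := by
  have h1 : ∀ q : Cell w, ∃ b, σ.1 (consCellEquiv r w (Sum.inr q)) = Sum.inr b := by
    intro q
    rcases hq : σ.1 (consCellEquiv r w (Sum.inr q)) with i | b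
    · have := (σ.1.injective.comp (consCellEquiv r w).injective) (hq.trans (h i).symm)
      simp at this
    · exact ⟨b, rfl⟩
  choose f hf using h1
  have hbij : Function.Bijective f := by
    constructor
    · intro p q hpq
      have := (σ.1.injective.comp (consCellEquiv r w).injective)
        (((hf p).trans (congrArg Sum.inr hpq)).trans (hf q).symm)
      simpa using this
    · intro b
      obtain ⟨p, hp⟩ := σ.1.surjective (Sum.inr b)
      obtain ⟨q, rfl⟩ := (consCellEquiv r w).surjective p
      rcases q with i | q
      · rw [h i] at hp
        simp at hp
      · rw [hf q] at hp
        exact ⟨q, by simpa using hp⟩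
  refine ⟨⟨Equiv.ofBijective f hbij, fun q => ?_⟩, ?_⟩
  · have h2 := σ.2 (consCellEquiv r w (Sum.inr q))
    rw [hf q] at h2
    exact h2
  · refine Subtype.ext (Equiv.ext fun p => ?_)
    obtain ⟨q, rfl⟩ := (consCellEquiv r w).surjective p
    rw [consPlacement_apply]
    rcases q with i | q
    · simp [h]
    · simp [hf]

theorem cellPred_consCell_inr {w : Fin n → ℕ} (q : Cell w) :
    cellPred (consCellEquiv r w (Sum.inr q)) =
      Sum.map Fin.succ (fun p => consCellEquiv r w (Sum.inr p)) (cellPred q) := by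
  obtain ⟨⟨k, i⟩, hi⟩ := q
  cases i with
  | zero => rfl
  | succ i => rfl

/-- The limit of the leading coefficients is a multiple of the weight function of the remaining
points. -/
theorem dampedWeight_farLimit [Fintype B] (w : Fin n → ℕ) :
    dampedWeight (farPtKind n) (farPoint z) (farCol colB r) (farKind B r) 0 (farLimit s lam r)
      (Fin.cons r w : Fin (n + 1) → ℕ) =
      (∏ i : Fin r, (((limPt lam r (i.val + 1) : ℝ) : ℂ) - ((limPt lam r i.val : ℝ) : ℂ))⁻¹) *
        weightCoeff z colB s w := by
  rw [dampedWeight, weightCoeff, Finset.mul_sum]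
  symm
  refine Fintype.sum_of_injective (consPlacement (r := r)) ?_ _ _ ?_ ?_
  · intro τ τ' h
    refine Subtype.ext (Equiv.ext fun q => ?_)
    have h1 := congrArg (fun σ => σ.1 (consCellEquiv r w (Sum.inr q))) h
    simp only [consPlacement_apply] at h1
    simpa using h1
  · intro σ hσ
    by_contra hne
    refine hσ ?_
    obtain ⟨τ, hτ⟩ := exists_consPlacement_eq (σ := σ) fun i => by
      exact (eq_inl_of_prod_ne_zero hne i.val i.2).2
    exact ⟨τ, hτ⟩
  · intro τ
    rw [← (consCellEquiv r w).prod_comp, Fintype.prod_sum_type]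
    congr 1
    · refine Finset.prod_congr rfl fun i _ => ?_
      rw [consPlacement_apply]
      obtain ⟨i, hi⟩ := i
      cases i with
      | zero =>
        have hp : cellPred (consCellEquiv r w (Sum.inl ⟨0, hi⟩)) = Sum.inl 0 := rfl
        rw [hp]
        simp [farKind, farLimit, farPtKind, farPoint, limPt_zero]
      | succ i =>
        have hp : cellPred (consCellEquiv r w (Sum.inl ⟨i + 1, hi⟩)) =
          Sum.inr (consCellEquiv r w (Sum.inl ⟨i, lt_of_le_of_lt (Nat.le_succ i) hi⟩)) := rfl
        rw [hp]
        simp only [Sum.elim_inr, consPlacement_apply]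
        simp [farKind, farLimit]
    · rw [cellWeight]
      refine Finset.prod_congr rfl fun q _ => ?_
      rw [consPlacement_apply, cellPred_consCell_inr, cellChain_eq_cellPred]
      rcases cellPred q with k | p
      · simp [farKind, farLimit, farPtKind, farPoint]
      · simp only [Sum.map_inr, Sum.elim_inr, consPlacement_apply]
        simp [farKind, farLimit]

end

theorem tendsto_inv_ofReal : Filter.Tendsto (fun u : ℝ => ((u : ℂ))⁻¹) Filter.atTop (nhds 0) := by
  simpa using tendsto_inv_ofReal_sub 0

/-- A critical point for `n` points extends, after adding a distant point and new variables near
it, to a critical point for `n + 1` points, and the rescaled weight functions converge. -/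
theorem exists_tendsto_weightCoeff {n : ℕ} {B : Type} [Fintype B] [DecidableEq B] {z : Fin n → ℂ}
    {colB : B → ℕ} {s : B → ℂ} {lam : ℕ → ℕ} {r : ℕ} (hr : ∀ i < r, lam r < lam i)
    (hlam : Antitone lam)
    (hcharge : ∀ i < r, ∑ b, cartan i (colB b) - (if i = 0 then (n : ℂ) else 0) =
      lam (i + 1) - lam i)
    (hs : IsCritical z colB s) :
    ∃ (t : ℝ → Fin r ⊕ B → ℂ) (c : ℝ → ℂ) (L : (Fin (n + 1) → ℕ) → ℂ),
      (∀ᶠ u : ℝ in Filter.atTop, IsCritical (Fin.cons (u : ℂ) z : Fin (n + 1) → ℂ)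
        (farCol colB r) (t u)) ∧
      (∀ w, Filter.Tendsto (fun u : ℝ => c u * weightCoeff (Fin.cons (u : ℂ) z : Fin (n + 1) → ℂ)
        (farCol colB r) (t u) w) Filter.atTop (nhds (L w))) ∧
      (∀ j, r < j → ∀ w : Fin n → ℕ, L (Fin.cons j w : Fin (n + 1) → ℕ) = 0) ∧
      ∀ w : Fin n → ℕ, L (Fin.cons r w : Fin (n + 1) → ℕ) = weightCoeff z colB s w := by
  have hsep := dampedSep_farLimit (lam := lam) hr hs
  obtain ⟨ψ, hψ, hev⟩ := exists_tendsto_dampedDeriv_eq_zero hsep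
    (dampedDeriv_farLimit hr hcharge hs) (det_dampedHess_farLimit hr hlam hcharge hs)
  set C : ℂ := ∏ i : Fin r,
    (((limPt lam r (i.val + 1) : ℝ) : ℂ) - ((limPt lam r i.val : ℝ) : ℂ))⁻¹ with hC
  have hC0 : C ≠ 0 := Finset.prod_ne_zero_iff.2 fun i _ => inv_ne_zero <| sub_ne_zero.2 <| by
    exact_mod_cast limPt_ne hr (by omega) i.2 i.2.le
  have hpoint : ∀ u : ℝ, (fun k => scl (farPtKind n k) ((u : ℂ))⁻¹ * farPoint z k) =
      (Fin.cons (u : ℂ) z : Fin (n + 1) → ℂ) := by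
    intro u
    funext k
    refine Fin.cases ?_ (fun k => ?_) k
    · simp [scl, farPtKind, farPoint]
    · simp [scl, farPtKind, farPoint]
  have hne : ∀ᶠ u : ℝ in Filter.atTop, ((u : ℂ))⁻¹ ≠ 0 := by
    filter_upwards [Filter.eventually_gt_atTop 0] with u hu
    simpa using hu.ne'
  refine ⟨fun u a => scl (farKind B r a) ((u : ℂ))⁻¹ * ψ ((u : ℂ))⁻¹ a,
    fun u => C⁻¹ * ∏ a, scl (farKind B r a) ((u : ℂ))⁻¹,
    fun w => C⁻¹ * dampedWeight (farPtKind n) (farPoint z) (farCol colB r) (farKind B r) 0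
      (farLimit s lam r) w, ?_, fun w => ?_, fun j hj w => ?_, fun w => ?_⟩
  · filter_upwards [tendsto_inv_ofReal.eventually hev, hne] with u h1 h2
    rw [← hpoint]
    exact isCritical_of_dampedDeriv h2 h1.1 h1.2.1 h1.2.2
  · have h1 : Filter.Tendsto (fun u : ℝ => ((u : ℂ)⁻¹, ψ (u : ℂ)⁻¹)) Filter.atTop
        (nhds ((0 : ℂ), farLimit s lam r)) :=
      tendsto_inv_ofReal.prodMk_nhds (hψ.comp tendsto_inv_ofReal)
    have h2 := ((continuousAt_dampedWeight hsep w).tendsto.comp h1).const_mul C⁻¹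
    refine h2.congr' ?_
    filter_upwards [hne] with u hu
    rw [Function.comp_apply, dampedWeight_eq hu, hpoint, mul_assoc]
  · simp only [dampedWeight_farLimit_of_lt hj, mul_zero]
  · simp only [dampedWeight_farLimit, ← hC]
    rw [inv_mul_cancel_left₀ hC0]

/-! ### The combinatorics of the charges -/

theorem sum_cartan_eq {B : Type} [Fintype B] (colB : B → ℕ) (i : ℕ) :
    ∑ b, cartan i (colB b) = 2 * ((Finset.univ.filter fun b => colB b = i).card : ℂ) -
      ((Finset.univ.filter fun b => colB b = i + 1).card : ℂ) -
      ((Finset.univ.filter fun b => colB b + 1 = i).card : ℂ) := by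
  rw [Finset.card_filter, Finset.card_filter, Finset.card_filter]
  push_cast
  rw [Finset.mul_sum, ← Finset.sum_sub_distrib, ← Finset.sum_sub_distrib]
  refine Finset.sum_congr rfl fun b _ => ?_
  unfold cartan
  rcases Nat.lt_trichotomy i (colB b) with h | h | h
  · have h1 : ¬ i = colB b := by omega
    have h2 : ¬ colB b = i := by omega
    have h3 : ¬ colB b + 1 = i := by omega
    by_cases h4 : colB b = i + 1
    · have h5 : ¬ i + 1 + 1 = i := by omega
      simp [h4, h5]
    · have h5 : ¬ i + 1 = colB b := fun h => h4 h.symm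
      simp [h1, h2, h3, h4, h5]
  · simp [← h]
  · have h1 : ¬ i = colB b := by omega
    have h2 : ¬ colB b = i := by omega
    have h3 : ¬ colB b = i + 1 := by omega
    have h5 : ¬ i + 1 = colB b := by omega
    by_cases h4 : colB b + 1 = i
    · simp [h1, h2, h3, h4]
    · simp [h1, h2, h3, h4, h5]

/-- The numbers of variables of each colour are chosen such that the charges are the differences of
consecutive rows. -/
theorem betheCol_charge {n : ℕ} {ν : YoungDiagram} (hν : ν.card = n) (i : ℕ) :
    ∑ b, cartan i (betheCol ν b) - (if i = 0 then (n : ℂ) else 0) =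
      ν.rowLen (i + 1) - ν.rowLen i := by
  rw [sum_cartan_eq, card_betheCol, card_betheCol]
  have h1 := numBelow_succ ν i
  cases i with
  | zero =>
    have h2 := card_eq_numBelow_add ν
    rw [hν] at h2
    rw [h2]
    simp only [Nat.add_eq_zero_iff, one_ne_zero, and_false, Finset.filter_false, Finset.card_empty,
      if_true]
    rw [h1]
    push_cast
    ring
  | succ i =>
    have h2 := numBelow_succ ν i
    simp only [Nat.add_right_cancel_iff, Nat.add_eq_zero_iff, one_ne_zero, and_false, if_false]
    rw [card_betheCol, h2, h1]
    push_cast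
    ring

theorem AddsBox.numBelow {ν μ : YoungDiagram} {c : ℕ × ℕ} (h : AddsBox ν μ c) (j : ℕ) :
    numBelow μ j = numBelow ν j + if j < c.1 then 1 else 0 := by
  rw [GaudinSymm.numBelow, GaudinSymm.numBelow, h.2, Finset.filter_insert]
  split_ifs with hc
  · rw [Finset.card_insert_of_notMem]
    exact fun hm => h.1 (Finset.mem_filter.1 hm).1
  · rfl

/-- A box added in row `c.1` brings one new variable of each colour `i < c.1`. -/
theorem AddsBox.exists_equiv {ν μ : YoungDiagram} {c : ℕ × ℕ} (h : AddsBox ν μ c) :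
    ∃ e : BetheVar μ ≃ Fin c.1 ⊕ BetheVar ν,
      ∀ a, farCol (betheCol ν) c.1 (e a) = betheCol μ a := by
  classical
  refine exists_equiv_of_card_eq fun j => ?_
  rw [card_betheCol, h.numBelow, ← card_betheCol, Finset.card_filter, Finset.card_filter,
    Fintype.sum_sum_type, add_comm]
  congr 1
  change _ = ∑ i : Fin c.1, if i.val = j then 1 else 0
  rw [Fin.sum_univ_eq_sum_range fun i => if i = j then 1 else 0, Finset.sum_ite_eq']
  simp

theorem AddsBox.rowLen_lt {ν μ : YoungDiagram} {c : ℕ × ℕ} (h : AddsBox ν μ c) {i : ℕ}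
    (hi : i < c.1) : ν.rowLen c.1 < ν.rowLen i := by
  have h1 := h.rowLen c.1
  have h2 := h.rowLen i
  have h3 := μ.rowLen_anti i c.1 hi.le
  rw [if_pos rfl] at h1
  rw [if_neg hi.ne'] at h2
  omega

/-- The limit of rescaled Bethe vectors, when a distant point is added, is an element of the Specht
module with a given leading component. -/
theorem exists_tendsto_betheVector {n : ℕ} {μ : YoungDiagram} (hμ : μ.card = n + 1) {r : ℕ}
    (hr : r ∈ corners μ) {z : Fin n → ℂ} (hz : Function.Injective z)
    {s : BetheVar (removeBox μ r) → ℂ} (hs : IsNondegenerateCritical z s) :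
    ∃ (t : ℝ → BetheVar μ → ℂ) (c : ℝ → ℂ) (L : TensorPow (n + 1)),
      (∀ᶠ u : ℝ in Filter.atTop,
        IsNondegenerateCritical (Fin.cons (u : ℂ) z : Fin (n + 1) → ℂ) (t u)) ∧
      (∀ w, Filter.Tendsto (fun u : ℝ => c u *
        betheVector (Fin.cons (u : ℂ) z : Fin (n + 1) → ℂ) (t u) w) Filter.atTop (nhds (L w))) ∧
      L ∈ (specht (n + 1) μ).toSubmodule ∧ (∀ j, r < j → headComp n j L = 0) ∧
      headComp n r L = betheVector z s := by
  have hν := card_removeBox hμ hr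
  have hadd := addsBox_removeBox hr
  rw [isNondegenerateCritical_iff hz] at hs
  obtain ⟨t, c, L, h1, h2, h3, h4⟩ := exists_tendsto_weightCoeff (lam := (removeBox μ r).rowLen)
    (fun i hi => hadd.rowLen_lt hi) (fun i j hij => (removeBox μ r).rowLen_anti i j hij)
    (fun i _ => betheCol_charge hν i) hs
  obtain ⟨e, he⟩ := hadd.exists_equiv
  have hcrit : ∀ᶠ u : ℝ in Filter.atTop,
      IsCritical (Fin.cons (u : ℂ) z : Fin (n + 1) → ℂ) (betheCol μ) (t u ∘ e) := by
    filter_upwards [h1] with u hu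
    exact isCritical_reindex e he hu
  have hbv : ∀ u : ℝ, ∀ w, betheVector (Fin.cons (u : ℂ) z : Fin (n + 1) → ℂ) (t u ∘ e) w =
      weightCoeff (Fin.cons (u : ℂ) z : Fin (n + 1) → ℂ) (farCol (betheCol (removeBox μ r)) r)
        (t u) w := fun u w => by
    rw [betheVector_apply hμ, weightCoeff_reindex e he]
  obtain ⟨v, hv, hvL⟩ := exists_mem_specht hμ (c := L) (fun i w => by
      refine tendsto_nhds_unique (tendsto_finsetSum _ fun k _ => h2 _)
        (tendsto_const_nhds.congr' ?_)
      filter_upwards [hcrit] with u hu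
      rw [← Finset.mul_sum]
      have := kills_weightCoeff hu.injective hu.ne_z hu.deriv_eq_zero i w
      simp only [weightCoeff_reindex e he] at this
      rw [this, mul_zero])
    (fun w hw j => by
      obtain ⟨u, hu⟩ := ((h2 w).eventually_ne hw).exists
      have hu' := right_ne_zero_of_mul hu
      rw [← weightCoeff_reindex e he] at hu'
      rw [card_of_weightCoeff_ne_zero hu', card_betheCol])
  refine ⟨fun u => t u ∘ e, c, v, ?_, fun w => ?_, hv, fun j hj => ?_, ?_⟩
  · filter_upwards [hcrit, eventually_injective_cons hz] with u hu hzu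
    exact (isNondegenerateCritical_iff hzu).2 hu
  · rw [hvL]
    simp only [hbv]
    exact h2 w
  · ext w
    rw [headComp_apply, hvL, h3 j hj]
    rfl
  · ext w
    rw [headComp_apply, hvL, h4, betheVector_apply hν]

/-! ### Detecting bases by coordinates -/

/-- A separating family of functionals contains a separating subfamily with as many members as the
dimension. -/
theorem exists_separating {X V : Type} [AddCommGroup V] [Module ℂ V] [FiniteDimensional ℂ V]
    (e : X → Module.Dual ℂ V) (he : ∀ v, (∀ x, e x v = 0) → v = 0) :
    ∃ w : Fin (Module.finrank ℂ V) → X, ∀ v, (∀ q, e (w q) v = 0) → v = 0 := by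
  obtain ⟨f, hf, hspan, -⟩ := Submodule.exists_fun_fin_finrank_span_eq ℂ (Set.range e)
  choose g hg using hf
  have hdet : ∀ v, (∀ q, e (g q) v = 0) → v = 0 := by
    intro v h
    have h1 : ∀ φ ∈ Submodule.span ℂ (Set.range e), φ v = 0 := by
      rw [← hspan]
      intro φ hφ
      induction hφ using Submodule.span_induction with
      | mem φ hφ =>
        obtain ⟨q, rfl⟩ := hφ
        rw [← hg q]
        exact h q
      | zero => rfl
      | add φ ψ _ _ h1 h2 => rw [LinearMap.add_apply, h1, h2, add_zero]
      | smul c φ _ h1 => rw [LinearMap.smul_apply, h1, smul_zero]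
    exact he v fun y => h1 _ (Submodule.subset_span ⟨y, rfl⟩)
  have hle : Module.finrank ℂ (Submodule.span ℂ (Set.range e)) ≤ Module.finrank ℂ V :=
    (Submodule.finrank_le _).trans Subspace.dual_finrank_eq.le
  have hX : 0 < Module.finrank ℂ V → Nonempty X := by
    intro hpos
    by_contra hX
    rw [not_nonempty_iff] at hX
    obtain ⟨v, hv⟩ := (Module.finrank_pos_iff_exists_ne_zero (R := ℂ)).1 hpos
    exact hv (he v fun x => hX.elim x)
  refine ⟨fun q => if h : q.1 < Module.finrank ℂ (Submodule.span ℂ (Set.range e))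
    then g ⟨q.1, h⟩ else (hX (lt_of_le_of_lt (Nat.zero_le _) q.2)).some,
    fun v h => hdet v fun q => ?_⟩
  have h2 := h ⟨q.1, q.2.trans_le hle⟩
  beta_reduce at h2
  rwa [dif_pos q.2] at h2

/-- Finitely many coordinates, as many as the dimension, determine the elements of a
finite-dimensional space of finitely supported functions. -/
theorem exists_detecting {X : Type} (W : Submodule ℂ (X →₀ ℂ)) [FiniteDimensional ℂ W] :
    ∃ w : Fin (Module.finrank ℂ W) → X, ∀ x ∈ W, (∀ q, x (w q) = 0) → x = 0 := by
  obtain ⟨w, hw⟩ := exists_separating (V := W)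
    (fun x => (Finsupp.lapply x).comp W.subtype) fun v hv => Subtype.ext (Finsupp.ext hv)
  exact ⟨w, fun x hx h => congrArg Subtype.val (hw ⟨x, hx⟩ h)⟩

/-- A spanning set contains a basis, indexed by `Fin` of the dimension. -/
theorem exists_basis_of_span_eq {V : Type} [AddCommGroup V] [Module ℂ V] {S : Set V}
    {W : Submodule ℂ V} (h : Submodule.span ℂ S = W) [FiniteDimensional ℂ W] :
    ∃ f : Fin (Module.finrank ℂ W) → V, (∀ i, f i ∈ S) ∧
      Submodule.span ℂ (Set.range f) = W ∧ LinearIndependent ℂ f := by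
  subst h
  exact Submodule.exists_fun_fin_finrank_span_eq ℂ S

/-- The matrix of the detecting coordinates of linearly independent vectors is nonsingular. -/
theorem det_ne_zero_of_detecting {X ι : Type} [Fintype ι] [DecidableEq ι]
    {W : Submodule ℂ (X →₀ ℂ)} {w : ι → X} (hw : ∀ x ∈ W, (∀ q, x (w q) = 0) → x = 0)
    {v : ι → X →₀ ℂ} (hv : ∀ p, v p ∈ W) (hli : LinearIndependent ℂ v) :
    (Matrix.of fun p q => v p (w q)).det ≠ 0 := by
  intro hdet
  obtain ⟨c, hc, h⟩ := Matrix.exists_vecMul_eq_zero_iff.2 hdet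
  refine hc ?_
  have h1 : ∑ p, c p • v p = 0 := by
    refine hw _ (Submodule.sum_mem _ fun p _ => Submodule.smul_mem _ _ (hv p)) fun q => ?_
    have := congrFun h q
    rw [Finsupp.finsetSum_apply]
    simpa [Matrix.vecMul, dotProduct] using this
  funext p
  exact Fintype.linearIndependent_iff.1 hli c h1 p

theorem linearIndependent_of_det_ne_zero {X ι : Type} [Fintype ι] [DecidableEq ι] {w : ι → X}
    {v : ι → X →₀ ℂ} (hdet : (Matrix.of fun p q => v p (w q)).det ≠ 0) :
    LinearIndependent ℂ v := by
  rw [Fintype.linearIndependent_iff]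
  intro c hc
  by_contra! hne
  refine hdet (Matrix.exists_vecMul_eq_zero_iff.1 ⟨c, fun h => ?_, ?_⟩)
  · obtain ⟨p, hp⟩ := hne
    exact hp (congrFun h p)
  · funext q
    have := DFunLike.congr_fun hc (w q)
    rw [Finsupp.finsetSum_apply] at this
    simpa [Matrix.vecMul, dotProduct] using this

theorem span_eq_of_det_ne_zero {X : Type} {W : Submodule ℂ (X →₀ ℂ)} [FiniteDimensional ℂ W]
    {w : Fin (Module.finrank ℂ W) → X} {v : Fin (Module.finrank ℂ W) → X →₀ ℂ}
    (hv : ∀ p, v p ∈ W) (hdet : (Matrix.of fun p q => v p (w q)).det ≠ 0) :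
    Submodule.span ℂ (Set.range v) = W := by
  refine Submodule.eq_of_le_of_finrank_le (Submodule.span_le.2 ?_) ?_
  · rintro _ ⟨p, rfl⟩
    exact hv p
  · rw [finrank_span_eq_card (linearIndependent_of_det_ne_zero hdet), Fintype.card_fin]

/-! ### Density of the points where the Bethe vectors span -/

theorem span_betheVectors_le {n : ℕ} {μ : YoungDiagram} (hμ : μ.card = n) {z : Fin n → ℂ}
    (hz : Function.Injective z) :
    Submodule.span ℂ (betheVectors z μ) ≤ (specht n μ).toSubmodule := by
  refine Submodule.span_le.2 ?_
  rintro _ ⟨t, ht, rfl⟩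
  exact betheVector_mem_specht hμ ((isNondegenerateCritical_iff hz).1 ht)

/-- The points where all Specht modules are spanned by Bethe vectors. -/
def spanningSet (n : ℕ) : Set (Fin n → ℂ) :=
  {z | Function.Injective z ∧ ∀ μ : YoungDiagram, μ.card = n →
    Submodule.span ℂ (betheVectors z μ) = (specht n μ).toSubmodule}

/-- The spanning property is inherited when a distant point is added. -/
theorem eventually_mem_spanningSet {n : ℕ} {z : Fin n → ℂ} (hz : z ∈ spanningSet n) :
    ∀ᶠ u : ℝ in Filter.atTop, (Fin.cons (u : ℂ) z : Fin (n + 1) → ℂ) ∈ spanningSet (n + 1) := by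
  classical
  obtain ⟨hz, hspan⟩ := hz
  have hfin := finite_youngDiagram (n + 1)
  suffices h : ∀ μ : {μ : YoungDiagram // μ.card = n + 1}, ∀ᶠ u : ℝ in Filter.atTop,
      Submodule.span ℂ (betheVectors (Fin.cons (u : ℂ) z : Fin (n + 1) → ℂ) μ.1) =
        (specht (n + 1) μ.1).toSubmodule by
    filter_upwards [eventually_injective_cons hz, Filter.eventually_all.2 h] with u h1 h2
    exact ⟨h1, fun μ hμ => h2 ⟨μ, hμ⟩⟩
  rintro ⟨μ, hμ⟩
  -- bases of Bethe vectors of the Specht modules for the diagrams with one box less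
  have hbasis : ∀ r : ℕ, ∃ s : Fin (Module.finrank ℂ (specht n (removeBox μ r)).toSubmodule) →
      BetheVar (removeBox μ r) → ℂ, r ∈ corners μ → (∀ a, IsNondegenerateCritical z (s a)) ∧
        LinearIndependent ℂ (fun a => betheVector z (s a)) ∧
        Submodule.span ℂ (Set.range fun a => betheVector z (s a)) =
          (specht n (removeBox μ r)).toSubmodule := by
    intro r
    by_cases hr : r ∈ corners μ
    · have h := hspan _ (card_removeBox hμ hr)
      obtain ⟨f, hf, hf1, hf2⟩ := exists_basis_of_span_eq h
      choose s hs hs' using hf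
      refine ⟨s, fun _ => ⟨hs, ?_⟩⟩
      rw [show (fun a => betheVector z (s a)) = f from funext fun a => (hs' a).symm]
      exact ⟨hf2, hf1⟩
    · exact ⟨fun _ _ => 0, fun h => absurd h hr⟩
  choose s hs using hbasis
  have hlim : ∀ (r : ℕ) (a : Fin (Module.finrank ℂ (specht n (removeBox μ r)).toSubmodule)),
      ∃ (t : ℝ → BetheVar μ → ℂ) (c : ℝ → ℂ) (L : TensorPow (n + 1)), r ∈ corners μ →
      (∀ᶠ u : ℝ in Filter.atTop,
        IsNondegenerateCritical (Fin.cons (u : ℂ) z : Fin (n + 1) → ℂ) (t u)) ∧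
      (∀ w, Filter.Tendsto (fun u : ℝ => c u *
        betheVector (Fin.cons (u : ℂ) z : Fin (n + 1) → ℂ) (t u) w) Filter.atTop (nhds (L w))) ∧
      L ∈ (specht (n + 1) μ).toSubmodule ∧ (∀ j, r < j → headComp n j L = 0) ∧
      headComp n r L = betheVector z (s r a) := by
    intro r a
    by_cases hr : r ∈ corners μ
    · obtain ⟨t, c, L, h⟩ := exists_tendsto_betheVector hμ hr hz ((hs r hr).1 a)
      exact ⟨t, c, L, fun _ => h⟩
    · exact ⟨fun _ _ => 0, fun _ => 0, 0, fun h => absurd h hr⟩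
  choose t c L hL using hlim
  obtain ⟨hli, hsp⟩ := specht_triangular hμ (fun r a => betheVector z (s r a)) L
    (fun r hr => (hs r hr).2.1) (fun r hr => (hs r hr).2.2) (fun r hr a => (hL r a hr).2.2.1)
    (fun r hr a => (hL r a hr).2.2.2.1) (fun r hr a => (hL r a hr).2.2.2.2)
  -- the limits form a basis, hence so do the Bethe vectors near the limit
  have hcard : Fintype.card ((r : corners μ) ×
      Fin (Module.finrank ℂ (specht n (removeBox μ r)).toSubmodule)) =
      Module.finrank ℂ (specht (n + 1) μ).toSubmodule := by
    rw [← hsp, finrank_span_eq_card hli]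
  let e := (Fintype.equivFinOfCardEq hcard).symm
  obtain ⟨w, hw⟩ := exists_detecting (specht (n + 1) μ).toSubmodule
  have hdet := det_ne_zero_of_detecting hw (v := fun p => L (e p).1 (e p).2)
    (fun p => (hL _ _ (e p).1.2).2.2.1) (hli.comp e e.injective)
  have htend : Filter.Tendsto (fun u : ℝ => (Matrix.of fun p q => (c (e p).1 (e p).2 u •
      betheVector (Fin.cons (u : ℂ) z : Fin (n + 1) → ℂ) (t (e p).1 (e p).2 u)) (w q)).det)
      Filter.atTop (nhds (Matrix.of fun p q => L (e p).1 (e p).2 (w q)).det) := by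
    refine ((Continuous.matrix_det continuous_id).tendsto _).comp ?_
    refine tendsto_pi_nhds.2 fun p => tendsto_pi_nhds.2 fun q => ?_
    exact (hL _ _ (e p).1.2).2.1 (w q)
  have hcrit : ∀ᶠ u : ℝ in Filter.atTop, ∀ p,
      IsNondegenerateCritical (Fin.cons (u : ℂ) z : Fin (n + 1) → ℂ) (t (e p).1 (e p).2 u) :=
    Filter.eventually_all.2 fun p => (hL _ _ (e p).1.2).1
  filter_upwards [htend.eventually_ne hdet, hcrit, eventually_injective_cons hz] with u h1 h2 h3
  refine le_antisymm (span_betheVectors_le hμ h3) ?_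
  have hmem : ∀ p, c (e p).1 (e p).2 u • betheVector (Fin.cons (u : ℂ) z : Fin (n + 1) → ℂ)
      (t (e p).1 (e p).2 u) ∈
        Submodule.span ℂ (betheVectors (Fin.cons (u : ℂ) z : Fin (n + 1) → ℂ) μ) :=
    fun p => Submodule.smul_mem _ _ (Submodule.subset_span ⟨_, h2 p, rfl⟩)
  rw [← span_eq_of_det_ne_zero (fun p => span_betheVectors_le hμ h3 (hmem p)) h1]
  refine Submodule.span_le.2 ?_
  rintro _ ⟨p, rfl⟩
  exact hmem p

theorem isEmpty_cells {μ : YoungDiagram} (hμ : μ.card = 0) : IsEmpty {c // c ∈ μ.cells} := by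
  have h : μ.cells = ∅ := Finset.card_eq_zero.1 hμ
  rw [h]
  exact ⟨fun c => Finset.notMem_empty _ c.2⟩

/-- Without points there are no variables: the empty configuration is a nondegenerate critical
point, and its Bethe vector is the basis vector of the one-dimensional `V^{⊗ 0}`. -/
theorem mem_spanningSet_zero (z : Fin 0 → ℂ) : z ∈ spanningSet 0 := by
  have hz : Function.Injective z := Function.injective_of_subsingleton z
  refine ⟨hz, fun μ hμ => ?_⟩
  have := isEmpty_cells hμ
  have hempty : IsEmpty (BetheVar μ) := ⟨fun a => this.false a.2.1⟩
  have ht : IsNondegenerateCritical z (fun a : BetheVar μ => hempty.elim a) :=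
    ⟨fun a => hempty.elim a, fun a => hempty.elim a, fun a => hempty.elim a, by simp⟩
  have hmem := Submodule.subset_span (R := ℂ) (show _ ∈ betheVectors z μ from ⟨_, ht, rfl⟩)
  have h1 : betheVector z (fun a : BetheVar μ => hempty.elim a) default = 1 := by
    rw [betheVector_apply hμ, weightCoeff]
    have hc : IsEmpty (Cell (default : Fin 0 → ℕ)) := ⟨fun p => p.1.1.elim0⟩
    have : Unique (ColPlacement (betheCol μ) (default : Fin 0 → ℕ)) :=
      { default := ⟨Equiv.equivOfIsEmpty _ _, fun p => hc.elim p⟩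
        uniq := fun σ => Subtype.ext (Equiv.ext fun p => hc.elim p) }
    rw [Fintype.sum_unique]
    simp [cellWeight]
  refine Submodule.eq_of_le_of_finrank_le (span_betheVectors_le hμ hz)
    ((finrank_specht_zero_le μ).trans ?_)
  have : FiniteDimensional ℂ (Submodule.span ℂ (betheVectors z μ)) :=
    Submodule.finiteDimensional_of_le (span_betheVectors_le hμ hz)
  rw [Nat.one_le_iff_ne_zero, Ne, Submodule.finrank_eq_zero]
  intro h0
  rw [h0] at hmem
  rw [(Submodule.mem_bot ℂ).1 hmem] at h1
  simp at h1

/-- The points where the Bethe vectors span are Zariski dense. -/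
theorem eq_zero_of_eval_spanningSet {n : ℕ} {P : MvPolynomial (Fin n) ℂ}
    (h : ∀ z ∈ spanningSet n, MvPolynomial.eval z P = 0) : P = 0 := by
  induction n with
  | zero =>
    have h1 := h 0 (mem_spanningSet_zero 0)
    rw [MvPolynomial.eq_C_of_isEmpty P, MvPolynomial.eval_C] at h1
    rw [MvPolynomial.eq_C_of_isEmpty P, h1, map_zero]
  | succ n ih =>
    refine (map_eq_zero_iff _ (MvPolynomial.finSuccEquiv ℂ n).injective).1 ?_
    refine Polynomial.ext fun k => ?_
    rw [Polynomial.coeff_zero]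
    refine ih fun z hz => ?_
    -- as a polynomial in the first variable, `P` has all large real numbers as roots
    have h2 : Polynomial.map (MvPolynomial.eval z) (MvPolynomial.finSuccEquiv ℂ n P) = 0 := by
      refine Polynomial.eq_zero_of_infinite_isRoot _ ?_
      obtain ⟨N, hN⟩ := Filter.eventually_atTop.1 (eventually_mem_spanningSet hz)
      refine Set.Infinite.mono ?_ ((Set.Ici_infinite N).image Complex.ofReal_injective.injOn)
      rintro _ ⟨u, hu, rfl⟩
      change Polynomial.eval _ _ = 0
      rw [← MvPolynomial.eval_eq_eval_mv_eval']
      exact h _ (hN u hu)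
    exact (Polynomial.coeff_map _ _).symm.trans (by rw [h2, Polynomial.coeff_zero])

/-! ### Genericity of the spanning property -/

section

variable {n d : ℕ} {A : Type}

/-- The pairs of coordinates that have to be distinct for `d` configurations of coloured variables
at the same points. -/
def MustDiffer (col : A → ℕ) : Fin n ⊕ Fin d × A → Fin n ⊕ Fin d × A → Prop
  | Sum.inl _, Sum.inl _ => True
  | Sum.inl _, Sum.inr _ => False
  | Sum.inr a, Sum.inl _ => col a.2 = 0
  | Sum.inr a, Sum.inr b => a.1 = b.1

/-- The configurations with distinct coordinates. -/
def distinctSet (n d : ℕ) (col : A → ℕ) : Set (Fin n ⊕ Fin d × A → ℂ) :=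
  {y | ∀ p q, p ≠ q → MustDiffer col p q → y p ≠ y q}

theorem exists_polynomial_distinctSet [Fintype A] (n d : ℕ) (col : A → ℕ) :
    ∃ V : MvPolynomial (Fin n ⊕ Fin d × A) ℂ, ∀ y,
      MvPolynomial.eval y V ≠ 0 ↔ y ∈ distinctSet n d col := by
  classical
  refine ⟨∏ p, ∏ q, if p ≠ q ∧ MustDiffer col p q then MvPolynomial.X p - MvPolynomial.X q else 1,
    fun y => ?_⟩
  simp only [map_prod, Finset.prod_ne_zero_iff, Finset.mem_univ, true_imp_iff]
  refine forall_congr' fun p => forall_congr' fun q => ?_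
  by_cases h : p ≠ q ∧ MustDiffer col p q
  · rw [if_pos h]
    simp [h.1, h.2, sub_eq_zero]
  · rw [if_neg h, map_one]
    simp only [ne_eq, one_ne_zero, not_false_iff, true_iff]
    exact fun h1 h2 => absurd ⟨h1, h2⟩ h

variable {col : A → ℕ}

theorem mem_distinctSet {z : Fin n → ℂ} {t : Fin d → A → ℂ} :
    Sum.elim z (fun p => t p.1 p.2) ∈ distinctSet n d col ↔
      Function.Injective z ∧ ∀ j, Function.Injective (t j) ∧ ∀ a k, col a = 0 → t j a ≠ z k := by
  constructor
  · refine fun h => ⟨fun k l hkl => ?_, fun j => ⟨fun a b hab => ?_, fun a k ha hk => ?_⟩⟩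
    · by_contra hne
      exact h (Sum.inl k) (Sum.inl l) (by simpa using hne) trivial hkl
    · by_contra hne
      exact h (Sum.inr (j, a)) (Sum.inr (j, b)) (by simpa using hne) rfl hab
    · exact h (Sum.inr (j, a)) (Sum.inl k) (by simp) ha hk
  · rintro ⟨h1, h2⟩ (k | ⟨i, a⟩) (l | ⟨j, b⟩) hne hd
    · exact fun h => hne (congrArg Sum.inl (h1 h))
    · exact absurd hd id
    · exact (h2 i).2 a l hd
    · have hij : i = j := hd
      subst hij
      exact fun h => hne (by rw [show a = b from (h2 i).1 h])

/-- The diagonal case `p = q` is the constant `0⁻¹ = 0`. -/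
theorem rationalOn_inv_sub {p q : Fin n ⊕ Fin d × A} (hd : MustDiffer col p q) :
    RationalOn (distinctSet n d col) fun y => (y p - y q)⁻¹ := by
  by_cases hpq : p = q
  · subst hpq
    simpa using RationalOn.const (U := distinctSet n d col) 0
  · exact ((RationalOn.coord _).sub (RationalOn.coord _)).inv
      fun y hy => sub_ne_zero.2 (hy p q hpq hd)

theorem rationalOn_masterDeriv [Fintype A] (j : Fin d) (a : A) :
    RationalOn (distinctSet n d col) fun y =>
      masterDeriv (fun k => y (Sum.inl k)) col (fun b => y (Sum.inr (j, b))) a := by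
  refine RationalOn.sub (RationalOn.sum fun b _ => (RationalOn.const _).mul
    (rationalOn_inv_sub (p := Sum.inr (j, a)) (q := Sum.inr (j, b)) rfl)) ?_
  by_cases ha : col a = 0
  · simp only [ha, if_true]
    exact RationalOn.sum fun k _ =>
      rationalOn_inv_sub (p := Sum.inr (j, a)) (q := Sum.inl k) ha
  · simpa [ha] using RationalOn.const (U := distinctSet n d col) 0

theorem RationalOn.pow {Y : Type} {U : Set (Y → ℂ)} {φ : (Y → ℂ) → ℂ} (h : RationalOn U φ)
    (m : ℕ) : RationalOn U fun y => φ y ^ m := by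
  induction m with
  | zero => simpa using RationalOn.const (U := U) 1
  | succ m ih => simpa [pow_succ] using ih.mul h

theorem RationalOn.neg {Y : Type} {U : Set (Y → ℂ)} {φ : (Y → ℂ) → ℂ} (h : RationalOn U φ) :
    RationalOn U fun y => -φ y := by
  simpa using (RationalOn.const (U := U) 0).sub h

theorem rationalOn_masterHess [Fintype A] (j : Fin d) (a b : A) :
    RationalOn (distinctSet n d col) fun y =>
      masterHess (fun k => y (Sum.inl k)) col (fun b => y (Sum.inr (j, b))) a b := by
  simp only [masterHess, dampedHess, Matrix.of_apply, dInv_kind_self]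
  have h1 : ∀ a b, RationalOn (distinctSet n d col) fun y =>
      (y (Sum.inr (j, a)) - y (Sum.inr (j, b)))⁻¹ := fun a b =>
    rationalOn_inv_sub (p := Sum.inr (j, a)) (q := Sum.inr (j, b)) rfl
  refine RationalOn.add ((RationalOn.const _).mul ((h1 a b).mul (h1 b a))).neg ?_
  by_cases hab : a = b
  · simp only [hab, if_true]
    refine RationalOn.add (RationalOn.sum fun c _ =>
      (RationalOn.const _).mul ((h1 b c).pow 2)).neg ?_
    by_cases hb : col b = 0
    · simp only [hb, if_true]
      exact RationalOn.sum fun k _ =>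
        (rationalOn_inv_sub (p := Sum.inr (j, b)) (q := Sum.inl k) hb).pow 2
    · simpa [hb] using RationalOn.const (U := distinctSet n d col) 0
  · simpa [hab] using RationalOn.const (U := distinctSet n d col) 0

theorem rationalOn_weightCoeff [Fintype A] (j : Fin d) (w : Fin n → ℕ) :
    RationalOn (distinctSet n d col) fun y =>
      weightCoeff (fun k => y (Sum.inl k)) col (fun b => y (Sum.inr (j, b))) w := by
  refine RationalOn.sum fun σ _ => RationalOn.prod fun p _ => ?_
  by_cases hp : p.1.2 = 0
  · simp only [cellChain_eq_cellPred, cellPred, if_pos hp, Sum.elim_inl]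
    exact rationalOn_inv_sub (p := Sum.inr (j, σ.1 p)) (q := Sum.inl p.1.1) ((σ.2 p).trans hp)
  · simp only [cellChain_eq_cellPred, cellPred, if_neg hp, Sum.elim_inr]
    exact rationalOn_inv_sub (p := Sum.inr (j, σ.1 p)) (q := Sum.inr (j, σ.1 _)) rfl

end

/-- For generic `z` the Bethe vectors span a given Specht module. -/
theorem exists_polynomial_span_betheVectors {n : ℕ} {μ : YoungDiagram} (hμ : μ.card = n) :
    ∃ P : MvPolynomial (Fin n) ℂ, P ≠ 0 ∧ ∀ z : Fin n → ℂ, MvPolynomial.eval z P ≠ 0 →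
      Submodule.span ℂ (betheVectors z μ) = (specht n μ).toSubmodule := by
  classical
  set d := Module.finrank ℂ (specht n μ).toSubmodule with hd
  obtain ⟨w, hw⟩ := exists_detecting (specht n μ).toSubmodule
  let U := distinctSet n d (betheCol μ)
  obtain ⟨V, hV⟩ := exists_polynomial_distinctSet n d (betheCol μ)
  choose pD qD hD using fun p : Fin d × BetheVar μ =>
    rationalOn_masterDeriv (n := n) (col := betheCol μ) p.1 p.2
  choose pH qH hH using fun j : Fin d => RationalOn.det (U := U) fun a b =>
    rationalOn_masterHess (n := n) (col := betheCol μ) j a b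
  obtain ⟨pW, qW, hW⟩ := RationalOn.det (U := U) (M := fun y => Matrix.of fun i j =>
    weightCoeff (fun k => y (Sum.inl k)) (betheCol μ) (fun b => y (Sum.inr (i, b))) (w j))
    fun i j => rationalOn_weightCoeff i (w j)
  -- the polynomial system: the `t j` are nondegenerate critical points with independent Bethe
  -- vectors
  have hsys : ∀ (z : Fin n → ℂ) (t : Fin d → BetheVar μ → ℂ),
      ((∀ f ∈ Set.range pD, MvPolynomial.eval (Sum.elim z fun p => t p.1 p.2) f = 0) ∧
        MvPolynomial.eval (Sum.elim z fun p => t p.1 p.2) (V * (∏ j, pH j) * pW) ≠ 0) ↔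
      Function.Injective z ∧ (∀ j, IsNondegenerateCritical z (t j)) ∧
        (Matrix.of fun i j => betheVector z (t i) (w j)).det ≠ 0 := by
    intro z t
    have hmul : ∀ {x q p : ℂ}, q ≠ 0 → x * q = p → (p = 0 ↔ x = 0) := by
      rintro x q p hq rfl
      simp [hq]
    simp only [map_mul, map_prod, mul_ne_zero_iff, Finset.prod_ne_zero_iff, Finset.mem_univ,
      true_imp_iff, hV, betheVector_apply hμ, Set.forall_mem_range]
    constructor
    · rintro ⟨h1, ⟨h2, h3⟩, h4⟩
      have h5 := mem_distinctSet.1 h2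
      refine ⟨h5.1, fun j => (isNondegenerateCritical_iff h5.1).2
        ⟨(h5.2 j).1, (h5.2 j).2, fun a => ?_, fun h => h3 j ?_⟩, fun h => h4 ?_⟩
      · exact (hmul (hD (j, a) _ h2).1 (hD (j, a) _ h2).2).1 (h1 (j, a))
      · exact (hmul (hH j _ h2).1 (hH j _ h2).2).2 h
      · exact (hmul (hW _ h2).1 (hW _ h2).2).2 h
    · rintro ⟨h1, h2, h3⟩
      have hc := fun j => (isNondegenerateCritical_iff h1).1 (h2 j)
      have h4 : Sum.elim z (fun p => t p.1 p.2) ∈ distinctSet n d (betheCol μ) :=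
        mem_distinctSet.2 ⟨h1, fun j => ⟨(hc j).injective, (hc j).ne_z⟩⟩
      refine ⟨fun p => ?_, ⟨h4, fun j h => (hc j).hess ?_⟩, fun h => h3 ?_⟩
      · exact (hmul (hD p _ h4).1 (hD p _ h4).2).2 ((hc p.1).deriv_eq_zero p.2)
      · exact (hmul (hH j _ h4).1 (hH j _ h4).2).1 h
      · exact (hmul (hW _ h4).1 (hW _ h4).2).1 h
  obtain ⟨P, hP0, hP⟩ := exists_ne_zero_forall_exists_of_dense (Set.range pD)
    (V * (∏ j, pH j) * pW) fun P hP => by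
      refine eq_zero_of_eval_spanningSet fun z hz => ?_
      obtain ⟨f, hf, hspan, hli⟩ := exists_basis_of_span_eq (hz.2 μ hμ)
      choose t ht ht' using hf
      have hdet := det_ne_zero_of_detecting hw (fun p => by
        rw [← hspan]; exact Submodule.subset_span ⟨p, rfl⟩) hli
      simp only [ht'] at hdet
      obtain ⟨h1, h2⟩ := (hsys z t).2 ⟨hz.1, ht, hdet⟩
      exact hP z _ h1 h2
  refine ⟨P, hP0, fun z hz => ?_⟩
  obtain ⟨t, h1, h2⟩ := hP z hz
  obtain ⟨hzi, hcrit, hdet⟩ := (hsys z fun j a => t (j, a)).1 ⟨h1, h2⟩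
  refine le_antisymm (span_betheVectors_le hμ hzi) ?_
  have hmem : ∀ j, betheVector z (fun a => t (j, a)) ∈ Submodule.span ℂ (betheVectors z μ) :=
    fun j => Submodule.subset_span ⟨_, hcrit j, rfl⟩
  rw [← span_eq_of_det_ne_zero (fun j => span_betheVectors_le hμ hzi (hmem j)) hdet]
  refine Submodule.span_le.2 ?_
  rintro _ ⟨j, rfl⟩
  exact hmem j

end GaudinSymm

end

theorem mainTheorem3 (n : ℕ) :
    ∃ P : MvPolynomial (Fin n) ℂ, P ≠ 0 ∧
      ∀ z : Fin n → ℂ, Function.Injective z → MvPolynomial.eval z P ≠ 0 →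
        ∀ μ : YoungDiagram, μ.card = n →
          GaudinSymm.ActsSemisimply (V := (GaudinSymm.specht n μ).toSubmodule)
            (GaudinSymm.thetaAlgebra z μ) ∧
          Submodule.span ℂ (GaudinSymm.betheVectors z μ)
            = (GaudinSymm.specht n μ).toSubmodule ∧
          (GaudinSymm.jointSpectrum (V := (GaudinSymm.specht n μ).toSubmodule)
            (GaudinSymm.thetaAlgebra z μ)).encard
            = (Module.finrank ℂ (GaudinSymm.specht n μ).toSubmodule : ℕ∞) := by
  classical
  obtain ⟨P, hP, c, hsimple⟩ := GaudinSymm.exists_polynomial_simpleSpectrum n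
  have := GaudinSymm.finite_youngDiagram n
  have := Fintype.ofFinite {μ : YoungDiagram // μ.card = n}
  choose Q hQ hspan using fun μ : {μ : YoungDiagram // μ.card = n} =>
    GaudinSymm.exists_polynomial_span_betheVectors μ.2
  refine ⟨P * ∏ μ, Q μ, mul_ne_zero hP (Finset.prod_ne_zero_iff.2 fun μ _ => hQ μ),
    fun z hz hz0 μ hμ => ?_⟩
  rw [map_mul, map_prod, mul_ne_zero_iff, Finset.prod_ne_zero_iff] at hz0
  obtain ⟨h1, h2⟩ := GaudinSymm.semisimple_of_simpleSpectrum hz (hsimple z hz hz0.1 μ hμ)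
  exact ⟨h1, hspan ⟨μ, hμ⟩ z (hz0.2 ⟨μ, hμ⟩ (Finset.mem_univ _)), h2⟩
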